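/- Theorem. Let $\alpha>0$, $\varphi>0$ and $w(t)=\frac1{2\pi}\,|\Gamma(\alpha/2+it)|^2e^{\pi t}$ for $t\in\mathbb R$. Let $\mathcal H[w]\subset L^2(\mathbb R,w(t)\,dt)$ be the space of functions $f$ that are holomorphic in a strip $|\operatorname{Im} z|<1+\delta$ for some $\delta>0$ and satisfy, for some $\varepsilon>0$, $$f(z)=O\bigl(|z|^{-\alpha/2-1-\varepsilon}\,e^{\pi(|\operatorname{Re}z|-\operatorname{Re}z)/2}\bigr),\qquad |z|\to\infty,\ |\operatorname{Im}z|\le 1 .$$ On $\mathcal H[w]$ consider the difference operator $$\mathcal Lf(t)=i(\alpha/2+it)f(t-i)+2\cosh\varphi\; t\,f(t)-i(\alpha/2-it)f(t+i).$$ Then $\mathcal L$ maps $\mathcal H[w]$ to $L^2(\mathbb R,w(t)\,dt)$ and is essentially self-adjoint in $L^2(\mathbb R,w(t)\,dt)$. The Vilenkin transform $$Vg(t)=\frac{(1-e^{-2\varphi})^{\alpha/2}e^{-i\varphi t}}{\Gamma(\alpha)}\int_{-\infty}^{\infty}g(s)\;{}_2F_1\!\left[\begin{matrix}\alpha/2-is,\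 \alpha/2+it\\ \alpha\end{matrix};1-e^{-2\varphi}\right]e^{-\pi s}\,w(s)\,ds ,$$ defined by this absolutely convergent integral for square-integrable $g$ with compact support, extends to a unitary operator $V$ of $L^2(\mathbb R,w(s)\,ds)$ onto $L^2(\mathbb R,w(t)\,dt)$. Its inverse is the continuous extension of $$V^{-1}f(s)=\frac{(1-e^{-2\varphi})^{\alpha/2}e^{-\pi s}}{\Gamma(\alpha)}\int_{-\infty}^{\infty}f(t)\;{}_2F_1\!\left[\begin{matrix}\alpha/2+is,\ \alpha/2-it\\ \alpha\end{matrix};1-e^{-2\varphi}\right]e^{i\varphi t}\,w(t)\,dt ,$$ likewise defined for square-integrable $f$ with compact support. The inverse transform $V^{-1}$ takes the closure $\overline{\mathcal L}$ to the operator $\mathcal N f(s)=2s\sinh\varphi\; f(s)$ of multiplication on its maximal domain: $V^{-1}\,\overline{\mathcal L}\,V=\mathcal N$, domains included. Consequently the spectrum of $\overline{\mathcal L}$ is the whole real line. -/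

import Mathlib

open MeasureTheory

namespace Vilenkin

noncomputable section

/-- The weight `w(t) = |Γ(α/2 + it)|² e^{πt} / 2π`. -/
def weight (α t : ℝ) : ℝ :=
  ‖Complex.Gamma (α / 2 + Complex.I * t)‖ ^ 2 * Real.exp (Real.pi * t) / (2 * Real.pi)

/-- The measure `w(t) dt` on the line. -/
def weightMeasure (α : ℝ) : Measure ℝ :=
  volume.withDensity fun t => ENNReal.ofReal (weight α t)

/-- The Hilbert space `L²(ℝ, w(t) dt)`. -/
abbrev L2w (α : ℝ) : Type := Lp ℂ 2 (weightMeasure α)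

/-- The difference expression
`(𝓛 f)(t) = i(α/2 + it) f(t - i) + 2 cosh φ · t f(t) - i(α/2 - it) f(t + i)`. -/
def diffExpr (α φ : ℝ) (f : ℂ → ℂ) (t : ℂ) : ℂ :=
  Complex.I * (α / 2 + Complex.I * t) * f (t - Complex.I)
    + 2 * (Real.cosh φ : ℂ) * t * f t
    - Complex.I * (α / 2 - Complex.I * t) * f (t + Complex.I)

/-- With `Ψ(x) = |x|^(α-1) e^{πx - π|x|}`, which is (up to a constant) the asymptotics of the
weight at infinity, this is `Ψ(x)^{-1/2} |x|^{-3/2-ε} = |x|^(-α/2-1-ε) e^{π(|x| - x)/2}`, with `|x|`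
replaced in the power by `1 + |x|`, so that it can serve as a bound on the whole strip. -/
def decayBound (α ε x : ℝ) : ℝ :=
  (1 + |x|) ^ (-(α / 2 + 1 + ε)) * Real.exp (Real.pi * (|x| - x) / 2)

/-- The space `𝓗[w]` of functions that are holomorphic in the closed strip `|Im z| ≤ 1` (that is,
in a larger open strip) and are `w`-decreasing in it. Only the values on a neighbourhood of the
closed strip matter. -/
def stripSpace (α : ℝ) : Submodule ℂ (ℂ → ℂ) where
  carrier := {f | (∃ δ > 0, DifferentiableOn ℂ f {z | |z.im| < 1 + δ}) ∧
    ∃ ε > 0, ∃ C : ℝ, ∀ z : ℂ, |z.im| ≤ 1 → ‖f z‖ ≤ C * decayBound α ε z.re}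
  zero_mem' := ⟨⟨1, one_pos, differentiableOn_const 0⟩, 1, one_pos, 0, by simp⟩
  add_mem' := by
    rintro f g ⟨⟨δ₁, h₁, hf⟩, ε₁, he₁, C₁, hC₁⟩ ⟨⟨δ₂, h₂, hg⟩, ε₂, he₂, C₂, hC₂⟩
    refine ⟨⟨min δ₁ δ₂, lt_min h₁ h₂, ?_⟩, min ε₁ ε₂, lt_min he₁ he₂, |C₁| + |C₂|, ?_⟩
    · refine (hf.mono fun z hz => ?_).add (hg.mono fun z hz => ?_)
      · exact lt_of_lt_of_le (show |z.im| < 1 + min δ₁ δ₂ from hz)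
          (add_le_add_right (min_le_left _ _) 1)
      · exact lt_of_lt_of_le (show |z.im| < 1 + min δ₁ δ₂ from hz)
          (add_le_add_right (min_le_right _ _) 1)
    · intro z hz
      have key : ∀ ε ε' C : ℝ, ε' ≤ ε →
          C * decayBound α ε z.re ≤ |C| * decayBound α ε' z.re := by
        intro ε ε' C hle
        have h0 : 0 ≤ decayBound α ε z.re := by unfold decayBound; positivity
        have h1 : decayBound α ε z.re ≤ decayBound α ε' z.re := by
          unfold decayBound
          gcongr
          linarith [abs_nonneg z.re]
        exact mul_le_mul (le_abs_self C) h1 h0 (abs_nonneg C)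
      calc ‖f z + g z‖ ≤ ‖f z‖ + ‖g z‖ := norm_add_le _ _
        _ ≤ _ := by
          rw [add_mul]
          exact add_le_add ((hC₁ z hz).trans (key _ _ _ (min_le_left _ _)))
            ((hC₂ z hz).trans (key _ _ _ (min_le_right _ _)))
  smul_mem' := by
    rintro c f ⟨⟨δ, h, hf⟩, ε, he, C, hC⟩
    refine ⟨⟨δ, h, hf.const_smul c⟩, ε, he, ‖c‖ * C, fun z hz => ?_⟩
    rw [Pi.smul_apply, norm_smul, mul_assoc]
    exact mul_le_mul_of_nonneg_left (hC z hz) (norm_nonneg c)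

/-- The graph of the difference operator on `𝓗[w]`, in `L²(ℝ, w dt)`. -/
def diffGraph (α φ : ℝ) : Submodule ℂ (L2w α × L2w α) where
  carrier := {p | ∃ f ∈ stripSpace α,
    (∀ᵐ t : ℝ ∂weightMeasure α, p.1 t = f t) ∧
    ∀ᵐ t : ℝ ∂weightMeasure α, p.2 t = diffExpr α φ f t}
  zero_mem' := by
    refine ⟨0, (stripSpace α).zero_mem, ?_, ?_⟩
    · filter_upwards [Lp.coeFn_zero ℂ 2 (weightMeasure α)] with t ht using by simpa using ht
    · filter_upwards [Lp.coeFn_zero ℂ 2 (weightMeasure α)] with t ht using by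
        simpa [diffExpr] using ht
  add_mem' := by
    rintro p q ⟨f, hf, hf₁, hf₂⟩ ⟨g, hg, hg₁, hg₂⟩
    refine ⟨f + g, (stripSpace α).add_mem hf hg, ?_, ?_⟩
    · filter_upwards [Lp.coeFn_add p.1 q.1, hf₁, hg₁] with t h h₁ h₂
      rw [Prod.fst_add, h, Pi.add_apply, h₁, h₂, Pi.add_apply]
    · filter_upwards [Lp.coeFn_add p.2 q.2, hf₂, hg₂] with t h h₁ h₂
      rw [Prod.snd_add, h, Pi.add_apply, h₁, h₂]
      simp only [diffExpr, Pi.add_apply]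
      ring
  smul_mem' := by
    rintro c p ⟨f, hf, hf₁, hf₂⟩
    refine ⟨c • f, (stripSpace α).smul_mem c hf, ?_, ?_⟩
    · filter_upwards [Lp.coeFn_smul c p.1, hf₁] with t h h₁
      rw [Prod.smul_fst, h, Pi.smul_apply, h₁, Pi.smul_apply]
    · filter_upwards [Lp.coeFn_smul c p.2, hf₂] with t h h₂
      rw [Prod.smul_snd, h, Pi.smul_apply, h₂]
      simp only [diffExpr, Pi.smul_apply, smul_eq_mul]
      ring

/-- The difference operator `𝓛` in `L²(ℝ, w dt)` with domain `𝓗[w]`. -/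
def diffOp (α φ : ℝ) : L2w α →ₗ.[ℂ] L2w α := (diffGraph α φ).toLinearPMap

theorem weight_pos {α : ℝ} (hα : 0 < α) (t : ℝ) : 0 < weight α t := by
  have h : Complex.Gamma (α / 2 + Complex.I * t) ≠ 0 :=
    Complex.Gamma_ne_zero_of_re_pos (by simp [hα])
  have h' := norm_pos_iff.2 h
  unfold weight
  positivity

theorem measurable_weight {α : ℝ} (hα : 0 < α) : Measurable (weight α) := by
  have h : Continuous fun t : ℝ => Complex.Gamma (α / 2 + Complex.I * t) := by
    refine continuous_iff_continuousAt.2 fun t => ?_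
    refine ContinuousAt.comp (f := fun t : ℝ => (α / 2 + Complex.I * t : ℂ)) ?_ (by fun_prop)
    refine (Complex.differentiableAt_Gamma _ fun m hm => ?_).continuousAt
    have := congrArg Complex.re hm
    simp at this
    have hm' : (0 : ℝ) ≤ m := Nat.cast_nonneg m
    linarith
  unfold weight
  exact (by fun_prop : Continuous fun t : ℝ =>
    ‖Complex.Gamma (α / 2 + Complex.I * t)‖ ^ 2 * Real.exp (Real.pi * t) / (2 * Real.pi)).measurable

/-- A function of `𝓗[w]` is determined by its class in `L²`, so that `𝓛` is well defined. -/
theorem diffGraph_singleValued {α : ℝ} (hα : 0 < α) (φ : ℝ) (p : L2w α × L2w α)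
    (hp : p ∈ diffGraph α φ) (h0 : p.1 = 0) : p.2 = 0 := by
  obtain ⟨f, ⟨⟨δ, hδ, hf⟩, -⟩, hf₁, hf₂⟩ := hp
  set S : Set ℂ := {z | |z.im| < 1 + δ} with hS
  have hSo : IsOpen S := isOpen_lt (by fun_prop) continuous_const
  have hSc : Convex ℝ S := by
    have : S = Complex.imLm ⁻¹' Set.Ioo (-(1 + δ)) (1 + δ) := by
      ext z; simp [hS, abs_lt]
    rw [this]
    exact (convex_Ioo _ _).linear_preimage Complex.imLm
  have hreal : ∀ t : ℝ, (t : ℂ) ∈ S := fun t => by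
    simp only [hS, Set.mem_ofPred_eq, Complex.ofReal_im, abs_zero]; linarith
  have hcont : Continuous fun t : ℝ => f t :=
    continuous_iff_continuousAt.2 fun t =>
      ((hf.continuousOn.continuousAt (hSo.mem_nhds (hreal t))).comp
        Complex.continuous_ofReal.continuousAt)
  have hae : ∀ᵐ t : ℝ, f t = 0 := by
    have h : ∀ᵐ t : ℝ ∂weightMeasure α, f t = 0 := by
      rw [h0] at hf₁
      filter_upwards [hf₁, Lp.coeFn_zero ℂ 2 (weightMeasure α)] with t h₁ h₂
      rw [← h₁, h₂]; rfl
    rw [weightMeasure, ae_withDensity_iff (measurable_weight hα).ennreal_ofReal] at h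
    filter_upwards [h] with t ht
    exact ht (by simpa using weight_pos hα t)
  have hzero : ∀ t : ℝ, f t = 0 := fun t =>
    congrFun (Continuous.ae_eq_iff_eq volume hcont continuous_const |>.1 hae) t
  have hS0 : Set.EqOn f 0 S := by
    refine (hf.analyticOnNhd hSo).eqOn_zero_of_preconnected_of_frequently_eq_zero
      hSc.isPreconnected (z₀ := 0) (by simpa using hreal 0) ?_
    have ht : Filter.Tendsto (fun n : ℕ => ((1 / ((n : ℝ) + 1) : ℝ) : ℂ)) Filter.atTop
        (nhdsWithin 0 {0}ᶜ) := by
      refine tendsto_nhdsWithin_iff.2 ⟨?_, Filter.Eventually.of_forall fun n => ?_⟩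
      · have := (Complex.continuous_ofReal.tendsto 0).comp
          (tendsto_one_div_add_atTop_nhds_zero_nat (𝕜 := ℝ))
        simpa [Function.comp_def] using this
      · have : (0 : ℝ) < 1 / ((n : ℝ) + 1) := by positivity
        exact Complex.ofReal_ne_zero.2 this.ne'
    exact ht.frequently (Filter.Frequently.of_forall fun n => hzero _)
  apply Lp.ext
  filter_upwards [hf₂, Lp.coeFn_zero ℂ 2 (weightMeasure α)] with t h₁ h₂
  have hm : f (t - Complex.I) = 0 := hS0 (by
    simp only [hS, Set.mem_ofPred_eq, Complex.sub_im, Complex.ofReal_im, Complex.I_im]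
    norm_num; exact hδ)
  have hpl : f (t + Complex.I) = 0 := hS0 (by
    simp only [hS, Set.mem_ofPred_eq, Complex.add_im, Complex.ofReal_im, Complex.I_im]
    norm_num; exact hδ)
  rw [h₁, h₂, diffExpr, hm, hpl, hzero t]
  simp

theorem diffOp_graph {α : ℝ} (hα : 0 < α) (φ : ℝ) : (diffOp α φ).graph = diffGraph α φ :=
  (diffGraph α φ).toLinearPMap_graph_eq (diffGraph_singleValued hα φ)

/-- The operator `𝓝 f(s) = 2 s sinh φ · f(s)` of multiplication in `L²(ℝ, w ds)`, on its maximal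
domain, which consists of all `f` such that `2 s sinh φ · f(s)` is again in `L²(ℝ, w ds)`. -/
def mulOp (α φ : ℝ) : L2w α →ₗ.[ℂ] L2w α where
  domain :=
    { carrier := {f | MemLp (fun s : ℝ => (2 * s * Real.sinh φ : ℂ) * f s) 2 (weightMeasure α)}
      zero_mem' := by
        refine (MemLp.zero (ε := ℂ)).ae_eq ?_
        filter_upwards [Lp.coeFn_zero ℂ 2 (weightMeasure α)] with s hs
        simp only [hs, Pi.zero_apply, mul_zero]
      add_mem' := by
        intro f g hf hg
        refine (MemLp.add hf hg).ae_eq ?_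
        filter_upwards [Lp.coeFn_add f g] with s hs
        simp only [hs, Pi.add_apply]; ring
      smul_mem' := by
        intro c f hf
        refine (MemLp.const_smul hf c).ae_eq ?_
        filter_upwards [Lp.coeFn_smul c f] with s hs
        simp only [hs, Pi.smul_apply, smul_eq_mul]; ring }
  toFun :=
    { toFun := fun f => MemLp.toLp _ f.2
      map_add' := by
        intro f g
        apply Lp.ext
        filter_upwards [MemLp.coeFn_toLp (f + g).2, MemLp.coeFn_toLp f.2, MemLp.coeFn_toLp g.2,
          Lp.coeFn_add (MemLp.toLp _ f.2) (MemLp.toLp _ g.2),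
          Lp.coeFn_add (f : L2w α) (g : L2w α)] with s h₁ h₂ h₃ h₄ h₅
        rw [h₁, h₄, Pi.add_apply, h₂, h₃, Submodule.coe_add, h₅, Pi.add_apply]; ring
      map_smul' := by
        intro c f
        apply Lp.ext
        filter_upwards [MemLp.coeFn_toLp (c • f).2, MemLp.coeFn_toLp f.2,
          Lp.coeFn_smul c (MemLp.toLp _ f.2), Lp.coeFn_smul c (f : L2w α)] with s h₁ h₂ h₃ h₄
        rw [h₁, RingHom.id_apply, h₃, Pi.smul_apply, h₂, Submodule.coe_smul, h₄, Pi.smul_apply,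
          smul_eq_mul, smul_eq_mul]
        ring }

/-- The kernel of the Vilenkin transform with respect to `w(s) ds`:
`(1 - e^{-2φ})^{α/2} e^{-iφt} ₂F₁(α/2 - is, α/2 + it; α; 1 - e^{-2φ}) e^{-πs} / Γ(α)`. -/
def kernel (α φ t s : ℝ) : ℂ :=
  ((1 - Real.exp (-2 * φ)) ^ (α / 2) : ℝ) * Complex.exp (-Complex.I * φ * t)
    * ₂F₁ (α / 2 - Complex.I * s : ℂ) (α / 2 + Complex.I * t) α (1 - Real.exp (-2 * φ) : ℂ)
    * (Real.exp (-Real.pi * s) / Real.Gamma α : ℝ)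

/-- The kernel of the inverse Vilenkin transform with respect to `w(t) dt`:
`(1 - e^{-2φ})^{α/2} (e^{-πs} / Γ(α)) ₂F₁(α/2 + is, α/2 - it; α; 1 - e^{-2φ}) e^{iφt}`. -/
def inverseKernel (α φ s t : ℝ) : ℂ :=
  ((1 - Real.exp (-2 * φ)) ^ (α / 2) : ℝ) * (Real.exp (-Real.pi * s) / Real.Gamma α : ℝ)
    * ₂F₁ (α / 2 + Complex.I * s : ℂ) (α / 2 - Complex.I * t) α (1 - Real.exp (-2 * φ) : ℂ)
    * Complex.exp (Complex.I * φ * t)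

/-- `T` is the integral operator in `L²(ℝ, w dx)` with kernel `k`: on the (dense) space of
square-integrable functions of compact support it is given by the absolutely convergent integral
`(T g)(x) = ∫ k(x, y) g(y) w(y) dy`. -/
def IsIntegralOperator {α : ℝ} (k : ℝ → ℝ → ℂ) (T : L2w α →L[ℂ] L2w α) : Prop :=
  ∀ (g : ℝ → ℂ) (hg : MemLp g 2 (weightMeasure α)), HasCompactSupport g →
    (∀ x, Integrable (fun y => k x y * g y) (weightMeasure α)) ∧
    ∀ᵐ x ∂weightMeasure α, T (hg.toLp g) x = ∫ y, k x y * g y ∂weightMeasure α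

/-- The spectrum of a (possibly unbounded) operator `A`: the complement of the set of those `z` for
which `A - z` has an everywhere defined bounded inverse. -/
def unboundedSpectrum {H : Type*} [NormedAddCommGroup H] [NormedSpace ℂ H] (A : H →ₗ.[ℂ] H) :
    Set ℂ :=
  {z | ∃ R : H →L[ℂ] H,
    (∀ x : H, ∃ hx : R x ∈ A.domain, A ⟨R x, hx⟩ - z • R x = x) ∧
    ∀ x : A.domain, R (A x - z • (x : H)) = x}ᶜ

end

end Vilenkin

/-! ### Mellin transforms of exponentials and Barnes' first lemma -/

namespace Vilenkin

open Complex Set Filter Topology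

/-! Everything is read off from the exponential vectors e_p(t) = e^{-πt/2} p^{-(α/2+it)}, Re p > 0,
which correspond to the functions e^{-px} under the Mellin transform. The Parseval formula for
Mellin transforms (`integral_gammaPow_mul_gammaPow`) gives their Gram matrix Γ(α)(p + q̄)^{-α}. They
are total, because pairing with e_r for r > 0 is a Fourier transform in the variable log r.

The Möbius map m = `mob φ` of the right half-plane satisfies m(p) + conj m(q) = 2 sinh φ (p + q̄) /
((1 - ip)(1 + iq̄)). Hence the vectors e_p and (2 sinh φ)^{α/2} (1 - ip)^{-α} e_{m(p)} have the same
Gram matrix, and a unitary V takes the first family to the second (`exists_unitary`). That V has the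
hypergeometric kernel is checked on the adjoint: expanding ₂F₁ under the integral against e_r
produces one Barnes integral per term, and these add up to a binomial series, which is V⁻¹e_r in
closed form (`integral_hyp_mul_gammaPow`, `isIntegralOperator_of_adjoint`). The inverse kernel is
treated in the same way.

The shifts t ± i multiply e_p by constants, so the matrix elements of 𝓛 and 𝓝 between exponential
vectors are explicit, and comparing them gives V𝓝e_p = 𝓛Ve_p (`apply_mulExpL`). A contour shift
shows that 𝓛 on 𝓗[w] is symmetric against every e_p (`integral_diffExpr_mul_conj_expVec`). The pivot
is `mem_graph_mulOp_symm_of_inner`: if ⟨e_p, v⟩ = ⟨𝓛e_p, u⟩ for all p, then V⁻¹ carries (u, v) into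
the graph of 𝓝. So V⁻¹ carries the closure of 𝓛 into 𝓝. If (a, b) in the transported graph of 𝓝 is
orthogonal to the graph of 𝓛, the same lemma yields (1 + 𝓝²)V⁻¹a = 0, whence a = b = 0 and the two
graphs coincide. Self-adjointness and the spectrum are then those of multiplication by a real
function with range ℝ. -/

/-- `Γ(s) q^{-s}`, the Mellin transform of `exp (-q x)`. -/
noncomputable def gammaPow (q s : ℂ) : ℂ := Complex.Gamma s * q ^ (-s)

theorem norm_cpow_mul_exp_neg (q s : ℂ) {x : ℝ} (hx : 0 < x) :
    ‖(x : ℂ) ^ (s - 1) * exp (-(q * x))‖ = x ^ (s.re - 1) * Real.exp (-(q.re * x)) := by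
  rw [norm_mul, norm_cpow_eq_rpow_re_of_pos hx, norm_exp]
  simp

theorem continuousOn_cpow_mul_exp_neg (q s : ℂ) :
    ContinuousOn (fun x : ℝ => (x : ℂ) ^ (s - 1) * exp (-(q * x))) (Ioi 0) := by
  refine ContinuousOn.mul (fun x hx => ?_) (by fun_prop)
  exact (ContinuousAt.cpow (by fun_prop) continuousAt_const
    (Or.inl (by simpa using hx))).continuousWithinAt

theorem integrableOn_rpow_mul_exp_neg {a r : ℝ} (ha : 0 < a) (hr : 0 < r) :
    IntegrableOn (fun x : ℝ => x ^ (a - 1) * Real.exp (-(r * x))) (Ioi 0) := by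
  have := integrableOn_rpow_mul_exp_neg_mul_rpow (p := 1) (s := a - 1) (b := r) (by linarith)
    one_pos hr
  simpa using this

theorem integrableOn_cpow_mul_exp_neg {q s : ℂ} (hs : 0 < s.re) (hq : 0 < q.re) :
    IntegrableOn (fun x : ℝ => (x : ℂ) ^ (s - 1) * exp (-(q * x))) (Ioi 0) := by
  refine (integrableOn_rpow_mul_exp_neg hs hq).mono'
    ((continuousOn_cpow_mul_exp_neg q s).aestronglyMeasurable measurableSet_Ioi) ?_
  filter_upwards [ae_restrict_mem measurableSet_Ioi] with x hx
  exact (norm_cpow_mul_exp_neg q s hx).le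

theorem differentiableOn_integral_cpow_mul_exp_neg {s : ℂ} (hs : 0 < s.re) :
    DifferentiableOn ℂ (fun q : ℂ => ∫ x : ℝ in Ioi 0, (x : ℂ) ^ (s - 1) * exp (-(q * x)))
      {q | 0 < q.re} := by
  intro q (hq : 0 < q.re)
  have hopen : IsOpen {z : ℂ | q.re / 2 < z.re} := isOpen_lt continuous_const continuous_re
  have hmem : {z : ℂ | q.re / 2 < z.re} ∈ 𝓝 q := hopen.mem_nhds (by
    simp only [mem_ofPred_eq]; linarith)
  have hmeas : ∀ z : ℂ, AEStronglyMeasurable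
      (fun x : ℝ => (x : ℂ) ^ (s - 1) * exp (-(z * x))) (volume.restrict (Ioi 0)) := fun z =>
    (continuousOn_cpow_mul_exp_neg z s).aestronglyMeasurable measurableSet_Ioi
  have h := hasDerivAt_integral_of_dominated_loc_of_deriv_le
    (μ := volume.restrict (Ioi (0 : ℝ)))
    (F := fun (z : ℂ) (x : ℝ) => (x : ℂ) ^ (s - 1) * exp (-(z * x)))
    (F' := fun (z : ℂ) (x : ℝ) => -(x * ((x : ℂ) ^ (s - 1) * exp (-(z * x)))))
    -- Near `q` real parts stay above `q.re / 2`, and differentiation brings down a factor `x`;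
    -- hence the raised exponent and the halved rate.
    (bound := fun x : ℝ => x ^ ((s.re + 1) - 1) * Real.exp (-(q.re / 2 * x)))
    hmem (Eventually.of_forall hmeas) (integrableOn_cpow_mul_exp_neg hs hq)
    ((continuous_ofReal.aestronglyMeasurable.mul (hmeas q)).neg) ?_
    (integrableOn_rpow_mul_exp_neg (by linarith) (by linarith)) ?_
  · exact h.2.differentiableAt.differentiableWithinAt
  · filter_upwards [ae_restrict_mem measurableSet_Ioi] with x hx z hz
    have hx' : 0 < x := hx
    have hz' : q.re / 2 < z.re := hz
    rw [norm_neg, norm_mul, norm_cpow_mul_exp_neg z s hx, norm_real, Real.norm_of_nonneg hx'.le,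
      ← mul_assoc, add_sub_right_comm, Real.rpow_add_one hx'.ne', mul_comm x]
    gcongr
  · refine Eventually.of_forall fun x z _ => ?_
    have h1 : HasDerivAt (fun z : ℂ => exp (-(z * x))) (exp (-(z * x)) * (-(1 * x))) z :=
      (((hasDerivAt_id z).mul_const (x : ℂ)).neg).cexp
    convert! h1.const_mul ((x : ℂ) ^ (s - 1)) using 1
    ring

theorem convex_re_pos : Convex ℝ {q : ℂ | 0 < q.re} := convex_halfSpace_re_gt 0

theorem isOpen_re_pos : IsOpen {q : ℂ | 0 < q.re} := isOpen_lt continuous_const continuous_re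

theorem mem_slitPlane_of_re_pos {q : ℂ} (hq : 0 < q.re) : q ∈ slitPlane := Or.inl hq

theorem ne_zero_of_re_pos {q : ℂ} (hq : 0 < q.re) : q ≠ 0 := by
  rintro rfl; simp at hq

/-- Both sides are holomorphic in `q` on the right half-plane and agree at the real points 1 +
1/(n+1), which accumulate at 1; the identity theorem does the rest. -/
theorem gammaPow_eq_integral {q s : ℂ} (hs : 0 < s.re) (hq : 0 < q.re) :
    gammaPow q s = ∫ x : ℝ in Ioi 0, (x : ℂ) ^ (s - 1) * exp (-(q * x)) := by
  have hf : AnalyticOnNhd ℂ (fun q : ℂ => gammaPow q s) {q | 0 < q.re} := by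
    refine DifferentiableOn.analyticOnNhd (fun q hq => ?_) isOpen_re_pos
    refine DifferentiableAt.differentiableWithinAt ?_
    unfold gammaPow
    exact ((differentiableAt_id.cpow_const (mem_slitPlane_of_re_pos hq))).const_mul _
  have hg := (differentiableOn_integral_cpow_mul_exp_neg hs).analyticOnNhd isOpen_re_pos
  refine hf.eqOn_of_preconnected_of_frequently_eq hg convex_re_pos.isPreconnected (z₀ := 1)
    (by simp) ?_ hq
  have ht : Tendsto (fun n : ℕ => ((1 + 1 / ((n : ℝ) + 1) : ℝ) : ℂ)) atTop (𝓝[≠] 1) := by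
    refine tendsto_nhdsWithin_iff.2 ⟨?_, Eventually.of_forall fun n => ?_⟩
    · have h := (tendsto_one_div_add_atTop_nhds_zero_nat (𝕜 := ℝ)).const_add 1
      rw [add_zero] at h
      simpa [Function.comp_def] using (continuous_ofReal.tendsto 1).comp h
    · have : (0 : ℝ) < 1 / ((n : ℝ) + 1) := by positivity
      rw [mem_compl_iff, mem_singleton_iff, ← ofReal_one, ofReal_inj]
      linarith
  refine ht.frequently (Frequently.of_forall fun n => ?_)
  have hn : (0 : ℝ) < 1 + 1 / ((n : ℝ) + 1) := by positivity
  rw [Complex.integral_cpow_mul_exp_neg_mul_Ioi hs hn, gammaPow, one_div (ofReal _),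
    inv_cpow, cpow_neg, mul_comm]
  rw [arg_ofReal_of_nonneg hn.le]
  exact Real.pi_pos.ne

theorem norm_gammaPow_le {q s : ℂ} (hs : 0 < s.re) (hq : 0 < q.re) :
    ‖gammaPow q s‖ ≤ Real.Gamma s.re * q.re ^ (-s.re) := by
  rw [gammaPow_eq_integral hs hq]
  refine (norm_integral_le_integral_norm _).trans ?_
  rw [setIntegral_congr_fun measurableSet_Ioi
    (fun x hx => norm_cpow_mul_exp_neg q s (mem_Ioi.1 hx)), Real.integral_rpow_mul_exp_neg_mul_Ioi
    hs hq, one_div, Real.inv_rpow hq.le, Real.rpow_neg hq.le, mul_comm]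

theorem exp_cpow {w : ℂ} (h1 : -Real.pi < w.im) (h2 : w.im ≤ Real.pi) (s : ℂ) :
    exp w ^ s = exp (w * s) := by
  rw [cpow_def_of_ne_zero (exp_ne_zero w), log_exp h1 h2]

/-- Exponential decay of Γ on vertical lines by rotating the ray of integration: for q = e^{-iθ} the
factor q^{-s} has modulus e^{-θ Im s}, while |Γ(s) q^{-s}| is bounded by the integral of absolute
values. Any rate below π/2 is available. -/
theorem norm_Gamma_le_aux {θ : ℝ} (hθ : |θ| < Real.pi / 2) {s : ℂ} (hs : 0 < s.re) :
    ‖Complex.Gamma s‖ ≤ Real.Gamma s.re * Real.cos θ ^ (-s.re) * Real.exp (θ * s.im) := by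
  obtain ⟨h1, h2⟩ := abs_lt.1 hθ
  have hq : (exp (-(θ * I))).re = Real.cos θ := by simp [exp_re]
  have hc : 0 < (exp (-(θ * I))).re := by rw [hq]; exact Real.cos_pos_of_mem_Ioo ⟨h1, h2⟩
  have h := norm_gammaPow_le hs hc
  rw [hq, gammaPow, exp_cpow (by simp; linarith [Real.pi_pos]) (by simp; linarith [Real.pi_pos]),
    norm_mul, norm_exp] at h
  have e : (-(θ * I) * -s).re = -(θ * s.im) := by simp
  rw [e] at h
  have h3 : Real.exp (-(θ * s.im)) * Real.exp (θ * s.im) = 1 := by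
    rw [← Real.exp_add]; simp
  have : ‖Complex.Gamma s‖ * Real.exp (-(θ * s.im)) * Real.exp (θ * s.im) ≤
    Real.Gamma s.re * Real.cos θ ^ (-s.re) * Real.exp (θ * s.im) := by gcongr
  rw [mul_assoc, h3, mul_one] at this
  exact this

theorem norm_Gamma_le {θ : ℝ} (h0 : 0 ≤ θ) (hθ : θ < Real.pi / 2) {s : ℂ} (hs : 0 < s.re) :
    ‖Complex.Gamma s‖ ≤
      Real.Gamma s.re * Real.cos θ ^ (-s.re) * Real.exp (-(θ * |s.im|)) := by
  rcases le_total 0 s.im with h | h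
  · have := norm_Gamma_le_aux (θ := -θ) (by rwa [abs_neg, abs_of_nonneg h0]) hs
    rw [Real.cos_neg, neg_mul] at this
    rwa [abs_of_nonneg h]
  · have := norm_Gamma_le_aux (θ := θ) (by rwa [abs_of_nonneg h0]) hs
    rwa [abs_of_nonpos h, mul_neg, neg_neg]

theorem abs_arg_lt {q : ℂ} (hq : 0 < q.re) : |arg q| < Real.pi / 2 :=
  abs_arg_lt_pi_div_two_iff.2 (Or.inl hq)

theorem norm_cpow_neg_le {q : ℂ} (hq : q ≠ 0) (s : ℂ) :
    ‖q ^ (-s)‖ ≤ ‖q‖ ^ (-s.re) * Real.exp (|arg q| * |s.im|) := by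
  rw [norm_cpow_of_ne_zero hq, neg_re, neg_im, div_eq_mul_inv, ← Real.exp_neg, mul_neg, neg_neg]
  refine mul_le_mul_of_nonneg_left (Real.exp_le_exp.2 ?_) (by positivity)
  rw [← abs_mul]
  exact le_abs_self _

/-- On a vertical line `Γ(s) q^{-s}` decays exponentially. -/
theorem exists_norm_gammaPow_le {q : ℂ} (hq : 0 < q.re) {b : ℝ} (hb : 0 < b) :
    ∃ δ > 0, ∃ C : ℝ, ∀ s : ℂ, s.re = b → ‖gammaPow q s‖ ≤ C * Real.exp (-(δ * |s.im|)) := by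
  have ha := abs_arg_lt hq
  -- The midpoint of `|arg q|` and π/2: Γ then decays faster than q^{-s} grows.
  set θ := (|arg q| + Real.pi / 2) / 2 with hθ
  refine ⟨θ - |arg q|, by linarith, Real.Gamma b * Real.cos θ ^ (-b) * ‖q‖ ^ (-b),
    fun s hs => ?_⟩
  have h1 := norm_Gamma_le (θ := θ) (by have := abs_nonneg (arg q); positivity) (by linarith)
    (s := s) (by rw [hs]; exact hb)
  have h2 := norm_cpow_neg_le (ne_zero_of_re_pos hq) s
  rw [hs] at h1 h2
  have h3 := mul_le_mul h1 h2 (norm_nonneg _) ((norm_nonneg _).trans h1)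
  rw [gammaPow, norm_mul]
  refine h3.trans_eq ?_
  rw [show -((θ - |arg q|) * |s.im|) = -(θ * |s.im|) + |arg q| * |s.im| by ring, Real.exp_add]
  ring

theorem integrable_comp_abs {f : ℝ → ℝ} (h : IntegrableOn f (Ioi 0)) :
    Integrable fun t : ℝ => f |t| := by
  have h' : IntegrableOn (fun t : ℝ => f (-t)) (Iic 0) := by
    rw [integrableOn_Iic_iff_integrableOn_Iio]
    exact IntegrableOn.comp_neg_Iio (c := (0 : ℝ)) (by simpa using h)
  rw [← integrableOn_univ, ← Iic_union_Ioi (a := (0 : ℝ))]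
  refine IntegrableOn.union (h'.congr_fun (fun t ht => ?_) measurableSet_Iic)
    (h.congr_fun (fun t ht => ?_) measurableSet_Ioi)
  · simp [abs_of_nonpos (mem_Iic.1 ht)]
  · simp [abs_of_pos (mem_Ioi.1 ht)]

theorem integrable_exp_neg_mul_abs {δ : ℝ} (hδ : 0 < δ) :
    Integrable (fun t : ℝ => Real.exp (-(δ * |t|))) :=
  integrable_comp_abs (f := fun t => Real.exp (-(δ * t)))
    (by simpa using integrableOn_rpow_mul_exp_neg one_pos hδ)

theorem continuous_gammaPow_line {q : ℂ} (hq : 0 < q.re) {b : ℝ} (hb : 0 < b) :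
    Continuous fun t : ℝ => gammaPow q (b + I * t) := by
  have hq0 := ne_zero_of_re_pos hq
  refine Continuous.mul (continuous_iff_continuousAt.2 fun t => ?_)
    ((Continuous.const_cpow (by fun_prop) (Or.inl hq0)))
  refine ContinuousAt.comp (f := fun t : ℝ => (b + I * t : ℂ)) ?_ (by fun_prop)
  refine (Complex.differentiableAt_Gamma _ fun m hm => ?_).continuousAt
  have := congrArg Complex.re hm
  simp at this
  have hm' : (0 : ℝ) ≤ m := Nat.cast_nonneg m
  linarith

theorem integrable_gammaPow_line {q : ℂ} (hq : 0 < q.re) {b : ℝ} (hb : 0 < b) :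
    Integrable fun t : ℝ => gammaPow q (b + I * t) := by
  obtain ⟨δ, hδ, C, hC⟩ := exists_norm_gammaPow_le hq hb
  refine ((integrable_exp_neg_mul_abs hδ).const_mul C).mono'
    (continuous_gammaPow_line hq hb).aestronglyMeasurable (Eventually.of_forall fun t => ?_)
  simpa using hC (b + I * t) (by simp)

theorem mellin_exp_neg_mul {q s : ℂ} (hs : 0 < s.re) (hq : 0 < q.re) :
    mellin (fun x : ℝ => exp (-(q * x))) s = gammaPow q s := by
  simp [mellin, gammaPow_eq_integral hs hq]

/-- This is Mellin inversion for e^{-qx} on the line Re s = b. -/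
theorem integral_cpow_mul_gammaPow {q : ℂ} (hq : 0 < q.re) {b : ℝ} (hb : 0 < b) {x : ℝ}
    (hx : 0 < x) :
    ∫ t : ℝ, (x : ℂ) ^ (-(b + I * t)) * gammaPow q (b + I * t) =
      2 * Real.pi * exp (-(q * x)) := by
  have hline : ∀ t : ℝ, mellin (fun x : ℝ => exp (-(q * x))) (b + t * I) =
      gammaPow q (b + I * t) := fun t => by
    rw [mul_comm _ I]; exact mellin_exp_neg_mul (by simpa using hb) hq
  have h := mellinInv_mellin_eq b (fun x : ℝ => exp (-(q * x))) hx
    (by simpa [MellinConvergent] using integrableOn_cpow_mul_exp_neg (s := (b : ℂ))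
          (by simpa using hb) hq)
    (by simpa only [VerticalIntegrable, hline] using integrable_gammaPow_line hq hb)
    (by fun_prop)
  rw [← h, mellinInv]
  simp only [hline, real_smul, smul_eq_mul]
  have hpi : (Real.pi : ℂ) ≠ 0 := ofReal_ne_zero.2 Real.pi_ne_zero
  push_cast
  rw [← mul_assoc, mul_one_div_cancel (by simp [hpi]), one_mul]
  simp only [mul_comm I]

theorem norm_ofReal_cpow_line {x : ℝ} (hx : 0 < x) (t : ℝ) : ‖(x : ℂ) ^ (-(I * t))‖ = 1 := by
  rw [norm_cpow_eq_rpow_re_of_pos hx]; simp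

/-- Barnes' first lemma in the form of a Parseval formula for Mellin transforms. -/
theorem integral_gammaPow_mul_gammaPow {a b : ℝ} (ha : 0 < a) (hb : 0 < b) {p q : ℂ}
    (hp : 0 < p.re) (hq : 0 < q.re) :
    ∫ t : ℝ, gammaPow q (b + I * t) * gammaPow p (a - I * t) =
      2 * Real.pi * gammaPow (p + q) (a + b) := by
  have e1 : ∀ t : ℝ, gammaPow p (a - I * t) =
      ∫ x : ℝ in Ioi 0, (x : ℂ) ^ (-(I * t)) * ((x : ℂ) ^ ((a : ℂ) - 1) * exp (-(p * x))) := by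
    intro t
    rw [gammaPow_eq_integral (by simpa using ha) hp]
    refine setIntegral_congr_fun measurableSet_Ioi fun x hx => ?_
    have hx0 : (x : ℂ) ≠ 0 := ofReal_ne_zero.2 (ne_of_gt hx)
    rw [← mul_assoc, ← cpow_add _ _ hx0]
    ring_nf
  have hint : Integrable (Function.uncurry fun (t x : ℝ) => gammaPow q (b + I * t) *
      ((x : ℂ) ^ (-(I * t)) * ((x : ℂ) ^ ((a : ℂ) - 1) * exp (-(p * x)))))
      (volume.prod (volume.restrict (Ioi 0))) := by
    have h := (integrable_gammaPow_line hq hb).mul_prod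
      (integrableOn_cpow_mul_exp_neg (s := (a : ℂ)) (by simpa using ha) hp)
    have hm : Measurable fun z : ℝ × ℝ => (z.2 : ℂ) ^ (-(I * z.1)) := by fun_prop
    refine (h.norm).mono' ?_ ?_
    · refine (h.aestronglyMeasurable.mul hm.aestronglyMeasurable).congr
        (Eventually.of_forall fun z => ?_)
      simp only [Function.uncurry, Pi.mul_apply]
      ring
    · have : ∀ᵐ z : ℝ × ℝ ∂(volume.prod (volume.restrict (Ioi 0))), z.2 ∈ Ioi (0 : ℝ) :=
        Measure.quasiMeasurePreserving_snd.ae (ae_restrict_mem measurableSet_Ioi)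
      filter_upwards [this] with z hz
      simp only [Function.uncurry, norm_mul, norm_ofReal_cpow_line (mem_Ioi.1 hz), one_mul]
      rfl
  -- One factor is written as a Mellin integral; after Fubini the inner integral is Mellin inversion
  -- of the other, and the Mellin integral of e^{-(p+q)x} remains.
  calc ∫ t : ℝ, gammaPow q (b + I * t) * gammaPow p (a - I * t)
      = ∫ t : ℝ, ∫ x : ℝ in Ioi 0, gammaPow q (b + I * t) *
          ((x : ℂ) ^ (-(I * t)) * ((x : ℂ) ^ ((a : ℂ) - 1) * exp (-(p * x)))) := by
        simp only [e1, integral_const_mul]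
    _ = ∫ x : ℝ in Ioi 0, ∫ t : ℝ, gammaPow q (b + I * t) *
          ((x : ℂ) ^ (-(I * t)) * ((x : ℂ) ^ ((a : ℂ) - 1) * exp (-(p * x)))) :=
        integral_integral_swap hint
    _ = ∫ x : ℝ in Ioi 0, 2 * Real.pi *
          ((x : ℂ) ^ ((a + b : ℂ) - 1) * exp (-((p + q) * x))) := by
        refine setIntegral_congr_fun measurableSet_Ioi fun x hx => ?_
        have hx0 : (x : ℂ) ≠ 0 := ofReal_ne_zero.2 (ne_of_gt hx)
        have : ∀ t : ℝ, gammaPow q (b + I * t) *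
            ((x : ℂ) ^ (-(I * t)) * ((x : ℂ) ^ ((a : ℂ) - 1) * exp (-(p * x)))) =
            ((x : ℂ) ^ ((a + b : ℂ) - 1) * exp (-(p * x))) *
              ((x : ℂ) ^ (-(b + I * t)) * gammaPow q (b + I * t)) := fun t => by
          have : (x : ℂ) ^ (-(I * t)) * (x : ℂ) ^ ((a : ℂ) - 1) =
              (x : ℂ) ^ ((a + b : ℂ) - 1) * (x : ℂ) ^ (-(b + I * t)) := by
            rw [← cpow_add _ _ hx0, ← cpow_add _ _ hx0]; ring_nf
          linear_combination (gammaPow q (b + I * t) * exp (-(p * x))) * this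
        simp only [this]
        rw [integral_const_mul, integral_cpow_mul_gammaPow hq hb hx,
          show -((p + q) * x) = -(p * x) + -(q * x) by ring, exp_add]
        ring
    _ = 2 * Real.pi * gammaPow (p + q) (a + b) := by
        rw [integral_const_mul, gammaPow_eq_integral (by simp; positivity)
          (by rw [add_re]; positivity)]

theorem integrable_gammaPow_mul_gammaPow {a b : ℝ} (ha : 0 < a) (hb : 0 < b) {p q : ℂ}
    (hp : 0 < p.re) (hq : 0 < q.re) :
    Integrable fun t : ℝ => gammaPow q (b + I * t) * gammaPow p (a - I * t) := by
  refine (integrable_gammaPow_line hq hb).mul_bdd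
    (c := Real.Gamma a * p.re ^ (-a)) ?_ (Eventually.of_forall fun t => ?_)
  · have := (continuous_gammaPow_line hp ha).comp continuous_neg
    refine Continuous.aestronglyMeasurable ?_
    simpa [Function.comp_def, sub_eq_add_neg] using this
  · simpa using norm_gammaPow_le (q := p) (s := a - I * t) (by simpa using ha) hp

end Vilenkin

/-! ### Exponential vectors in the weighted space: Gram matrix and totality -/

namespace Vilenkin

open Complex Set Filter Topology FourierTransform
open scoped ComplexConjugate SchwartzMap ContDiff

/-- A test function is the Fourier transform of a Schwartz function, so moving the transform across
the pairing turns ∫ gG into an integral against 𝓕G = 0. -/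
theorem ae_eq_zero_of_fourier_eq_zero {G : ℝ → ℂ} (hG : Integrable G) (h : ∀ ξ, 𝓕 G ξ = 0) :
    ∀ᵐ t, G t = 0 := by
  refine ae_eq_zero_of_integral_contDiff_smul_eq_zero hG.locallyIntegrable fun g hg hgc => ?_
  have hgc' : HasCompactSupport (fun x => (g x : ℂ)) := hgc.comp_left (g := ((↑) : ℝ → ℂ)) rfl
  let S : 𝓢(ℝ, ℂ) := hgc'.toSchwartzMap (ofRealCLM.contDiff.comp hg)
  have hS : ∀ x, 𝓕 (𝓕⁻ S) x = g x := fun x => by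
    rw [FourierTransform.fourier_fourierInv_eq]; rfl
  have key := VectorFourier.integral_fourierIntegral_smul_eq_flip (L := innerₗ ℝ)
    (μ := volume) (ν := volume) Real.continuous_fourierChar continuous_inner
    (𝓕⁻ S : 𝓢(ℝ, ℂ)).integrable hG
  have e1 : ∀ x, VectorFourier.fourierIntegral Real.fourierChar volume (innerₗ ℝ)
      (𝓕⁻ S : 𝓢(ℝ, ℂ)) x = g x := fun x => by rw [← hS x]; rfl
  have e2 : ∀ x, VectorFourier.fourierIntegral Real.fourierChar volume (innerₗ ℝ).flip G x = 0 :=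
    fun x => by
      rw [← h x]
      simp [VectorFourier.fourierIntegral, Real.fourier_eq]
  simp only [e1, e2, smul_zero, integral_zero] at key
  simpa using key

/-- The two arguments of Γ are conjugate for real `t`. Unlike the modulus, the product is analytic,
which suits Barnes integrals and contour shifts. -/
theorem ofReal_weight (α t : ℝ) : (weight α t : ℂ) =
    Gamma (α / 2 + I * t) * Gamma (α / 2 - I * t) * exp (Real.pi * t) / (2 * Real.pi) := by
  have h : Gamma (α / 2 - I * t) = conj (Gamma (α / 2 + I * t)) := by
    rw [← Gamma_conj]; congr 1
    simp [sub_eq_add_neg, map_div₀, map_ofNat]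
  rw [h, mul_conj, normSq_eq_norm_sq, weight]
  push_cast
  rfl

theorem ae_weightMeasure_iff {α : ℝ} (hα : 0 < α) {P : ℝ → Prop} :
    (∀ᵐ t ∂weightMeasure α, P t) ↔ ∀ᵐ t, P t := by
  rw [weightMeasure, ae_withDensity_iff (measurable_weight hα).ennreal_ofReal]
  simp [weight_pos hα]

instance (α : ℝ) : SFinite (weightMeasure α) := by unfold weightMeasure; infer_instance

theorem integral_weightMeasure {α : ℝ} (hα : 0 < α) (f : ℝ → ℂ) :
    ∫ t, f t ∂weightMeasure α = ∫ t, (weight α t : ℂ) * f t := by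
  rw [weightMeasure, integral_withDensity_eq_integral_toReal_smul
    (measurable_weight hα).ennreal_ofReal (by simp)]
  simp [ENNReal.toReal_ofReal (weight_pos hα _).le]

theorem integrable_weightMeasure_iff {α : ℝ} (hα : 0 < α) {f : ℝ → ℂ} :
    Integrable f (weightMeasure α) ↔ Integrable fun t => (weight α t : ℂ) * f t := by
  rw [weightMeasure, integrable_withDensity_iff_integrable_smul'
    (measurable_weight hα).ennreal_ofReal (by simp)]
  simp [ENNReal.toReal_ofReal (weight_pos hα _).le]

/-- The exponential vector `e_p(z) = e^{-πz/2} p^{-(α/2 + iz)}`; it corresponds to `e^{-px}` under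
the Mellin transform. -/
noncomputable def expVec (α : ℝ) (p z : ℂ) : ℂ :=
  exp (-(Real.pi / 2 * z)) * p ^ (-(α / 2 + I * z))

theorem differentiable_expVec (α : ℝ) {p : ℂ} (hp : p ≠ 0) : Differentiable ℂ (expVec α p) := by
  intro z
  unfold expVec
  exact (by fun_prop : DifferentiableAt ℂ (fun z => exp (-(Real.pi / 2 * z))) z).mul
    ((by fun_prop : DifferentiableAt ℂ (fun z => -(α / 2 + I * z)) z).const_cpow (Or.inl hp))

/-- The exponential contributes e^{iπ/2} and the power contributes p^{-1}: exponential vectors are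
eigenvectors of the imaginary shifts, so 𝓛 acts on them as multiplication by an affine function. -/
theorem expVec_sub_I (α : ℝ) {p : ℂ} (hp : p ≠ 0) (z : ℂ) :
    expVec α p (z - I) = I / p * expVec α p z := by
  have h1 : exp (-(Real.pi / 2 * (z - I))) = I * exp (-(Real.pi / 2 * z)) := by
    rw [show -(Real.pi / 2 * (z - I)) = Real.pi / 2 * I + -(Real.pi / 2 * z) by ring, exp_add,
      exp_pi_div_two_mul_I]
  have h2 : p ^ (-(α / 2 + I * (z - I))) = p ^ (-(α / 2 + I * z)) / p := by
    rw [show -(α / 2 + I * (z - I)) = -(α / 2 + I * z) - 1 by linear_combination I_sq,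
      cpow_sub _ _ hp, cpow_one]
  rw [expVec, h1, h2, expVec]; ring

theorem expVec_add_I (α : ℝ) {p : ℂ} (hp : p ≠ 0) (z : ℂ) :
    expVec α p (z + I) = -I * p * expVec α p z := by
  have h := expVec_sub_I α hp (z + I)
  rw [add_sub_cancel_right] at h
  rw [h]
  field_simp
  linear_combination expVec α p (z + I) * I_sq

theorem diffExpr_expVec (α φ : ℝ) {p : ℂ} (hp : p ≠ 0) (z : ℂ) :
    diffExpr α φ (expVec α p) z =
      (2 * Real.cosh φ * z - (α / 2 + I * z) / p - (α / 2 - I * z) * p) * expVec α p z := by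
  rw [diffExpr, expVec_sub_I α hp, expVec_add_I α hp]
  linear_combination ((α / 2 + I * z) / p + (α / 2 - I * z) * p) * expVec α p z * I_sq

theorem conj_expVec (α : ℝ) {p : ℂ} (hp : 0 < p.re) (t : ℝ) :
    conj (expVec α p t) = exp (-(Real.pi / 2 * t)) * conj p ^ (-(α / 2 - I * t)) := by
  have harg : arg p ≠ Real.pi := by
    have := (abs_lt.1 (abs_arg_lt hp)).2
    linarith [Real.pi_pos]
  rw [expVec, map_mul, ← exp_conj, conj_cpow _ _ harg]
  congr 2
  · simp [map_div₀, map_ofNat]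
  · congr 1
    simp [sub_eq_add_neg, map_div₀, map_ofNat]

/-- The product of the weight with two exponential vectors. -/
theorem weight_mul_expVec_mul_conj (α : ℝ) (p : ℂ) {q : ℂ} (hq : 0 < q.re) (t : ℝ) :
    (weight α t : ℂ) * (expVec α p t * conj (expVec α q t)) =
      (2 * Real.pi : ℂ)⁻¹ * (gammaPow p ((α / 2 : ℝ) + I * t) *
        gammaPow (conj q) ((α / 2 : ℝ) - I * t)) := by
  -- The factors e^{-πt/2} in the two vectors cancel the e^{πt} of the weight, which is why they
  -- were put there.
  have he : exp (Real.pi * t) * (exp (-(Real.pi / 2 * t)) * exp (-(Real.pi / 2 * t))) = 1 := by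
    rw [← exp_add, ← exp_add, ← exp_zero]; ring_nf
  rw [ofReal_weight, conj_expVec α hq, expVec, gammaPow, gammaPow]
  push_cast
  linear_combination (Gamma (α / 2 + I * t) * Gamma (α / 2 - I * t) * (2 * Real.pi : ℂ)⁻¹ *
    p ^ (-(α / 2 + I * t : ℂ)) * conj q ^ (-(α / 2 - I * t : ℂ))) * he

theorem gammaPow_add_one {q s : ℂ} (hq : q ≠ 0) (hs : s ≠ 0) :
    gammaPow q (s + 1) = s / q * gammaPow q s := by
  rw [gammaPow, Gamma_add_one s hs, show -(s + 1) = -s - 1 by ring, cpow_sub _ _ hq, cpow_one,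
    gammaPow]
  ring

theorem integrable_expVec_mul_conj {α : ℝ} (hα : 0 < α) {p q : ℂ} (hp : 0 < p.re)
    (hq : 0 < q.re) :
    Integrable (fun t : ℝ => expVec α p t * conj (expVec α q t)) (weightMeasure α) := by
  rw [integrable_weightMeasure_iff hα]
  simp only [weight_mul_expVec_mul_conj α p hq]
  exact (integrable_gammaPow_mul_gammaPow (half_pos hα) (half_pos hα)
    (by simpa using hq) hp).const_mul _

/-- Barnes' first lemma with both abscissas equal to α/2. -/
theorem integral_expVec_mul_conj {α : ℝ} (hα : 0 < α) {p q : ℂ} (hp : 0 < p.re)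
    (hq : 0 < q.re) :
    ∫ t : ℝ, expVec α p t * conj (expVec α q t) ∂weightMeasure α = gammaPow (p + conj q) α := by
  have hpi : (Real.pi : ℂ) ≠ 0 := ofReal_ne_zero.2 Real.pi_ne_zero
  rw [integral_weightMeasure hα]
  simp only [weight_mul_expVec_mul_conj α p hq]
  rw [integral_const_mul, integral_gammaPow_mul_gammaPow (half_pos hα) (half_pos hα)
    (by simpa using hq) hp, ← mul_assoc, inv_mul_cancel₀ (by simp [hpi]), one_mul]
  push_cast
  rw [add_halves, add_comm]

theorem memLp_expVec {α : ℝ} (hα : 0 < α) {p : ℂ} (hp : 0 < p.re) :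
    MemLp (fun t : ℝ => expVec α p t) 2 (weightMeasure α) := by
  have hc : Continuous fun t : ℝ => expVec α p t :=
    (differentiable_expVec α (ne_zero_of_re_pos hp)).continuous.comp continuous_ofReal
  rw [memLp_two_iff_integrable_sq_norm hc.aestronglyMeasurable]
  refine (integrable_expVec_mul_conj hα hp hp).norm.congr (Eventually.of_forall fun t => ?_)
  simp [sq]

/-- `(α/2 + it) e_p(t)` is the exponential vector with parameter `α + 2`, up to a factor. -/
theorem memLp_mul_expVec {α : ℝ} (hα : 0 < α) {p : ℂ} (hp : 0 < p.re) :
    MemLp (fun t : ℝ => (t : ℂ) * expVec α p t) 2 (weightMeasure α) := by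
  have hp0 := ne_zero_of_re_pos hp
  have hc : Continuous fun t : ℝ => (α / 2 + I * t) * expVec α p t :=
    (by fun_prop : Continuous fun t : ℝ => (α / 2 + I * t : ℂ)).mul
      ((differentiable_expVec α hp0).continuous.comp continuous_ofReal)
  have h : MemLp (fun t : ℝ => (α / 2 + I * t) * expVec α p t) 2 (weightMeasure α) := by
    rw [memLp_two_iff_integrable_sq_norm hc.aestronglyMeasurable]
    have hpc : 0 < (conj p).re := by simpa using hp
    have h1 : Integrable (fun t : ℝ => (α / 2 + I * t) * expVec α p t *
        conj ((α / 2 + I * t) * expVec α p t)) (weightMeasure α) := by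
      rw [integrable_weightMeasure_iff hα]
      -- By Γ(s+1) = sΓ(s) the two linear factors raise both abscissas by one, and the Barnes
      -- integrand stays integrable.
      have h2 := (integrable_gammaPow_mul_gammaPow (a := α / 2 + 1) (b := α / 2 + 1)
        (by positivity) (by positivity) hpc hp).const_mul ((2 * Real.pi : ℂ)⁻¹ * (p * conj p))
      refine h2.congr (Eventually.of_forall fun t => ?_)
      have e := weight_mul_expVec_mul_conj α p hp t
      have hs1 : ((α / 2 : ℝ) + I * t : ℂ) ≠ 0 := fun h => by
        have := congrArg re h; simp at this; linarith
      have hs2 : ((α / 2 : ℝ) - I * t : ℂ) ≠ 0 := fun h => by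
        have := congrArg re h; simp at this; linarith
      have g1 := gammaPow_add_one hp0 hs1
      have g2 := gammaPow_add_one (ne_zero_of_re_pos hpc) hs2
      rw [show (α / 2 : ℝ) + I * t + 1 = ((α / 2 + 1 : ℝ) + I * t : ℂ) by push_cast; ring] at g1
      rw [show (α / 2 : ℝ) - I * t + 1 = ((α / 2 + 1 : ℝ) - I * t : ℂ) by push_cast; ring] at g2
      have hc : conj ((α / 2 + I * t : ℂ)) = α / 2 - I * t := by
        simp [sub_eq_add_neg, map_div₀, map_ofNat]
      simp only [g1, g2, map_mul, hc]
      have hpc0 := ne_zero_of_re_pos hpc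
      push_cast at e ⊢
      generalize gammaPow p (α / 2 + I * t) = A at e ⊢
      generalize gammaPow (conj p) (α / 2 - I * t) = B at e ⊢
      have hpp : p * conj p * (p⁻¹ * (conj p)⁻¹) = 1 := by field_simp
      linear_combination (-(α / 2 + I * t) * (α / 2 - I * t)) * e +
        ((2 * Real.pi : ℂ)⁻¹ * (α / 2 + I * t) * (α / 2 - I * t) * A * B) * hpp
    refine h1.norm.congr (Eventually.of_forall fun t => ?_)
    beta_reduce
    rw [norm_mul, norm_conj, sq]
  -- t = -i((α/2 + it) - α/2).
  refine ((h.sub ((memLp_expVec hα hp).const_mul (α / 2 : ℂ))).const_mul (-I)).ae_eq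
    (Eventually.of_forall fun t => ?_)
  simp only [Pi.sub_apply]
  linear_combination (-(t : ℂ) * expVec α p t) * I_sq

theorem expVec_ofReal (α : ℝ) {r : ℝ} (hr : 0 < r) (t : ℝ) :
    expVec α r t = exp (-(Real.pi / 2 * t)) * exp (-(α / 2 + I * t) * Real.log r) := by
  rw [expVec, cpow_def_of_ne_zero (ofReal_ne_zero.2 hr.ne'), ← ofReal_log hr.le,
    mul_comm (Real.log r : ℂ)]

/-- For positive `r` the power r^{-it} is a character of frequency log r, so varying `r` in pairings
with e_r amounts to taking a Fourier transform. -/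
theorem conj_expVec_ofReal (α : ℝ) {r : ℝ} (hr : 0 < r) (t : ℝ) :
    conj (expVec α r t) = exp (-(α / 2) * Real.log r) * exp (Real.log r * t * I) *
      conj (expVec α 1 t) := by
  have h1 := expVec_ofReal α one_pos t
  rw [ofReal_one] at h1
  rw [expVec_ofReal α hr, h1, ← exp_add, ← exp_add, ← exp_add, ← exp_conj, ← exp_conj, ← exp_add]
  congr 1
  simp [map_div₀, map_ofNat]
  ring

/-- The exponential vectors `e_r`, `r > 0`, separate functions. -/
theorem ae_eq_zero_of_integral_mul_conj_expVec {α : ℝ} (hα : 0 < α) {F : ℝ → ℂ}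
    (hF : Integrable (fun t => F t * conj (expVec α 1 t)) (weightMeasure α))
    (h : ∀ r : ℝ, 0 < r → ∫ t, F t * conj (expVec α r t) ∂weightMeasure α = 0) :
    ∀ᵐ t, F t = 0 := by
  rw [integrable_weightMeasure_iff hα] at hF
  have key := ae_eq_zero_of_fourier_eq_zero hF fun ξ => by
    -- With log r = -2πξ the character is the one in the definition of 𝓕 at ξ.
    have h1 := h (Real.exp (-(2 * Real.pi * ξ))) (Real.exp_pos _)
    rw [integral_weightMeasure hα] at h1
    rw [Real.fourier_eq']
    simp only [conj_expVec_ofReal α (Real.exp_pos _), Real.log_exp] at h1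
    have h2 : exp (-(α / 2) * ((-(2 * Real.pi * ξ) : ℝ) : ℂ)) ≠ 0 := exp_ne_zero _
    refine ((mul_eq_zero (a := exp (-(α / 2) * ((-(2 * Real.pi * ξ) : ℝ) : ℂ)))).1
      ?_).resolve_left h2
    rw [← integral_const_mul, ← h1]
    congr 1
    ext t
    rw [show ((-2 * Real.pi * inner ℝ t ξ : ℝ) : ℂ) * I = (-(2 * Real.pi * ξ) : ℝ) * t * I by
      simp; ring]
    simp only [smul_eq_mul]
    ring
  filter_upwards [key] with t ht
  have h1 : (weight α t : ℂ) ≠ 0 := ofReal_ne_zero.2 (weight_pos hα t).ne'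
  have h2 : conj (expVec α 1 t) ≠ 0 := by
    rw [Ne, map_eq_zero, expVec]; simp [exp_ne_zero]
  simpa [h1, h2] using ht

end Vilenkin

/-! ### The unitary operator determined by its action on exponential vectors -/

namespace Vilenkin

open Complex Set Filter Topology
open scoped ComplexConjugate

theorem inner_linearCombination_eq {ι H K : Type*} [NormedAddCommGroup H] [InnerProductSpace ℂ H]
    [NormedAddCommGroup K] [InnerProductSpace ℂ K] {v : ι → H} {w : ι → K}
    (h : ∀ i j, inner ℂ (v i) (v j) = inner ℂ (w i) (w j)) (x : ι →₀ ℂ) :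
    inner ℂ (Finsupp.linearCombination ℂ v x) (Finsupp.linearCombination ℂ v x) =
      inner ℂ (Finsupp.linearCombination ℂ w x) (Finsupp.linearCombination ℂ w x) := by
  simp only [Finsupp.linearCombination_apply, Finsupp.sum, sum_inner, inner_sum, inner_smul_left,
    inner_smul_right, h]

theorem denseRange_linearCombination {ι H : Type*} [NormedAddCommGroup H] [InnerProductSpace ℂ H]
    [CompleteSpace H] {v : ι → H} (h : ∀ u : H, (∀ i, inner ℂ (v i) u = 0) → u = 0) :
    DenseRange (Finsupp.linearCombination ℂ v) := by
  have h1 : (LinearMap.range (Finsupp.linearCombination ℂ v)).topologicalClosure = ⊤ := by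
    rw [Submodule.topologicalClosure_eq_top_iff, Submodule.eq_bot_iff]
    intro u hu
    refine h u fun i => (Submodule.mem_orthogonal _ _).1 hu _ ⟨Finsupp.single i 1, by simp⟩
  have h2 := Submodule.dense_iff_topologicalClosure_eq_top.2 h1
  rwa [LinearMap.coe_range] at h2

/-- Two total families with the same Gram matrix are related by a unitary operator. -/
theorem exists_linearIsometryEquiv_of_inner_eq {ι H : Type*} [NormedAddCommGroup H]
    [InnerProductSpace ℂ H] [CompleteSpace H] {v w : ι → H}
    (hv : ∀ u : H, (∀ i, inner ℂ (v i) u = 0) → u = 0)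
    (hw : ∀ u : H, (∀ i, inner ℂ (w i) u = 0) → u = 0)
    (h : ∀ i j, inner ℂ (v i) (v j) = inner ℂ (w i) (w j)) :
    ∃ U : H ≃ₗᵢ[ℂ] H, ∀ i, U (v i) = w i := by
  -- The comparison is made on formal combinations, so linear relations among the vectors need no
  -- separate treatment.
  have hn : ∀ x, ‖Finsupp.linearCombination ℂ w (LinearEquiv.refl ℂ (ι →₀ ℂ) x)‖ =
      ‖Finsupp.linearCombination ℂ v x‖ := fun x => by
    rw [LinearEquiv.refl_apply, norm_eq_sqrt_re_inner (𝕜 := ℂ), norm_eq_sqrt_re_inner (𝕜 := ℂ),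
      inner_linearCombination_eq h]
  refine ⟨(LinearEquiv.refl ℂ (ι →₀ ℂ)).extendOfIsometry _ _ (denseRange_linearCombination hv)
    (denseRange_linearCombination hw) hn, fun i => ?_⟩
  have := (LinearEquiv.refl ℂ (ι →₀ ℂ)).extendOfIsometry_eq _ _ (denseRange_linearCombination hv)
    (denseRange_linearCombination hw) hn (Finsupp.single i 1)
  simpa using this

theorem inner_L2w {α : ℝ} (u v : L2w α) :
    inner ℂ u v = ∫ t, v t * conj (u t) ∂weightMeasure α := by
  simp [L2.inner_def, RCLike.inner_apply]

open Classical in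
/-- The exponential vector `e_p` as an element of `L²(ℝ, w dt)`. -/
noncomputable def expL (α : ℝ) (p : ℂ) : L2w α :=
  if h : MemLp (fun t : ℝ => expVec α p t) 2 (weightMeasure α) then h.toLp else 0

theorem coeFn_expL {α : ℝ} (hα : 0 < α) {p : ℂ} (hp : 0 < p.re) :
    ∀ᵐ t ∂weightMeasure α, expL α p t = expVec α p t := by
  have h := memLp_expVec hα hp
  rw [expL, dif_pos h]
  exact h.coeFn_toLp

theorem inner_expL_left {α : ℝ} (hα : 0 < α) {p : ℂ} (hp : 0 < p.re) (u : L2w α) :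
    inner ℂ (expL α p) u = ∫ t, u t * conj (expVec α p t) ∂weightMeasure α := by
  rw [inner_L2w]
  refine integral_congr_ae ?_
  filter_upwards [coeFn_expL hα hp] with t ht
  rw [ht]

theorem integrable_mul_conj_expVec {α : ℝ} (hα : 0 < α) {p : ℂ} (hp : 0 < p.re) {u : ℝ → ℂ}
    (hu : MemLp u 2 (weightMeasure α)) :
    Integrable (fun t => u t * conj (expVec α p t)) (weightMeasure α) :=
  hu.integrable_mul (memLp_expVec hα hp).star

theorem inner_expL {α : ℝ} (hα : 0 < α) {p q : ℂ} (hp : 0 < p.re) (hq : 0 < q.re) :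
    inner ℂ (expL α q) (expL α p) = gammaPow (p + conj q) α := by
  rw [inner_expL_left hα hq, ← integral_expVec_mul_conj hα hp hq]
  refine integral_congr_ae ?_
  filter_upwards [coeFn_expL hα hp] with t ht
  rw [ht]

theorem eq_zero_of_inner_expL {α : ℝ} (hα : 0 < α) {u : L2w α}
    (h : ∀ r : ℝ, 0 < r → inner ℂ (expL α r) u = 0) : u = 0 := by
  refine Lp.ext ?_
  have h1 : ∀ᵐ t ∂weightMeasure α, u t = 0 := (ae_weightMeasure_iff hα).2 <|
    ae_eq_zero_of_integral_mul_conj_expVec hα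
      (integrable_mul_conj_expVec hα (by simp) (Lp.memLp u)) fun r hr => by
        rw [← inner_expL_left hα (by simpa using hr), h r hr]
  filter_upwards [h1, Lp.coeFn_zero ℂ 2 (weightMeasure α)] with t h1 h2
  rw [h1, h2]; rfl

/-! ### The Möbius transformation of the right half-plane -/

/-- The Möbius transformation of the right half-plane that implements the Vilenkin transform. -/
noncomputable def mob (φ : ℝ) (p : ℂ) : ℂ :=
  (Real.exp φ * p + I * Real.exp (-φ)) / (1 - I * p)

/-- The inverse of `mob φ`. -/
noncomputable def mobInv (φ : ℝ) (q : ℂ) : ℂ :=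
  (q - I * Real.exp (-φ)) / (Real.exp φ + I * q)

theorem one_sub_I_mul_ne_zero {p : ℂ} (hp : 0 < p.re) : 1 - I * p ≠ 0 := fun h => by
  have := congrArg im h
  simp at this
  linarith

theorem exp_add_I_mul_ne_zero (φ : ℝ) {q : ℂ} (hq : 0 < q.re) : Real.exp φ + I * q ≠ 0 :=
  fun h => by
  have := congrArg im h
  simp only [add_im, ofReal_im, mul_im, I_re, I_im, zero_im] at this
  linarith

theorem exp_mul_exp_neg (φ : ℝ) : (Real.exp φ : ℂ) * Real.exp (-φ) = 1 := by
  rw [← ofReal_mul, ← Real.exp_add]; simp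

theorem two_sinh (φ : ℝ) : (2 * Real.sinh φ : ℂ) = Real.exp φ - Real.exp (-φ) := by
  rw [Real.sinh_eq]; push_cast; ring

theorem two_cosh (φ : ℝ) : (2 * Real.cosh φ : ℂ) = Real.exp φ + Real.exp (-φ) := by
  rw [Real.cosh_eq]; push_cast; ring

/-- The covariance of the kernel p + q̄ under a Möbius map of the half-plane; 2 sinh φ = e^φ -
e^{-φ} is the determinant of the matrix. -/
theorem mob_add_conj_mob (φ : ℝ) {p q : ℂ} (hp : 0 < p.re) (hq : 0 < q.re) :
    mob φ p + conj (mob φ q) =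
      (2 * Real.sinh φ : ℝ) * (p + conj q) / ((1 - I * p) * (1 + I * conj q)) := by
  have h1 := one_sub_I_mul_ne_zero hp
  have h2 : 1 + I * conj q ≠ 0 := fun h => one_sub_I_mul_ne_zero hq (by
    have := congrArg conj h; simpa [sub_eq_add_neg] using this)
  have h3 : conj (mob φ q) = (Real.exp φ * conj q - I * Real.exp (-φ)) / (1 + I * conj q) := by
    simp only [mob, map_div₀, map_add, map_sub, map_mul, conj_ofReal, conj_I, map_one]
    congr 1 <;> ring
  rw [ofReal_mul, ofReal_ofNat, two_sinh, h3, mob, div_add_div _ _ h1 h2,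
    div_left_inj' (mul_ne_zero h1 h2)]
  linear_combination (Real.exp (-φ) * (p + conj q)) * I_sq

/-- The covariance on the diagonal: Re m(p) = 2 sinh φ · Re p / |1 - ip|². -/
theorem mob_re_pos {φ : ℝ} (hφ : 0 < φ) {p : ℂ} (hp : 0 < p.re) : 0 < (mob φ p).re := by
  have h := mob_add_conj_mob φ hp hp
  have hc : 1 + I * conj p = conj (1 - I * p) := by simp
  rw [add_conj, add_conj, hc, mul_conj, ← ofReal_mul, ← ofReal_div, ofReal_inj] at h
  have h1 : 0 < normSq (1 - I * p) := normSq_pos.2 (one_sub_I_mul_ne_zero hp)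
  have h2 : 0 < Real.sinh φ := Real.sinh_pos_iff.2 hφ
  have h3 : 0 < 2 * (mob φ p).re := h ▸ (by positivity)
  linarith

theorem mob_mobInv {φ : ℝ} (hφ : 0 < φ) {q : ℂ} (hq : 0 < q.re) : mob φ (mobInv φ q) = q := by
  have h1 := exp_add_I_mul_ne_zero φ hq
  have h2 : (2 * Real.sinh φ : ℂ) ≠ 0 := by
    norm_cast; exact (mul_pos two_pos (Real.sinh_pos_iff.2 hφ)).ne'
  rw [two_sinh] at h2
  have h3 : 1 - I * mobInv φ q = (Real.exp φ - Real.exp (-φ)) / (Real.exp φ + I * q) := by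
    rw [mobInv]; field_simp; linear_combination (Real.exp (-φ) : ℂ) * I_sq
  rw [mob, h3, div_eq_iff (div_ne_zero h2 h1), mobInv, mul_div_assoc', div_add' _ _ _ h1,
    mul_div_assoc', div_left_inj' h1]
  linear_combination (q * Real.exp (-φ) : ℂ) * I_sq

theorem one_sub_I_mul_mobInv (φ : ℝ) {q : ℂ} (hq : 0 < q.re) :
    1 - I * mobInv φ q = (2 * Real.sinh φ : ℝ) / (Real.exp φ + I * q) := by
  have h1 := exp_add_I_mul_ne_zero φ hq
  rw [ofReal_mul, ofReal_ofNat, two_sinh, mobInv]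
  field_simp
  linear_combination (Real.exp (-φ) : ℂ) * I_sq

theorem mobInv_re_pos {φ : ℝ} (hφ : 0 < φ) {q : ℂ} (hq : 0 < q.re) : 0 < (mobInv φ q).re := by
  have h := one_sub_I_mul_mobInv φ hq
  have h1 := congrArg im h
  have h2 : 0 < normSq (Real.exp φ + I * q) := normSq_pos.2 (exp_add_I_mul_ne_zero φ hq)
  have h3 : 0 < Real.sinh φ := Real.sinh_pos_iff.2 hφ
  rw [div_eq_mul_inv, im_ofReal_mul, inv_im] at h1
  simp only [sub_im, one_im, mul_im, I_re, I_im, add_im, ofReal_im] at h1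
  have h4 : (mobInv φ q).re = 2 * Real.sinh φ * q.re / normSq (Real.exp φ + I * q) := by
    linear_combination -h1
  rw [h4]
  positivity

/-- The two sides have equal exponentials, so they differ by 2πin. The arguments of `A` and `C` lie
in (-π/2, π/2), that of `B` in (-π, 0) and that of `D` in (0, π), so the difference is less than 2π
in modulus and n = 0. This is what permits principal powers with non-integer exponent α to be
multiplied. -/
theorem log_eq_of_eq_div {k : ℝ} (hk : 0 < k) {A B C D : ℂ} (hA : 0 < A.re) (hB : B.im < 0)
    (hC : 0 < C.re) (hD : 0 < D.im) (h : C = k * A / (B * D)) :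
    log C = Real.log k + log A - log B - log D := by
  have hB0 : B ≠ 0 := by rintro rfl; simp at hB
  have hD0 : D ≠ 0 := by rintro rfl; simp at hD
  have hA0 := ne_zero_of_re_pos hA
  have hC0 := ne_zero_of_re_pos hC
  have hk0 : (k : ℂ) ≠ 0 := ofReal_ne_zero.2 hk.ne'
  have he : exp (log C) = exp (Real.log k + log A - log B - log D) := by
    rw [exp_sub, exp_sub, exp_add, exp_log hA0, exp_log hB0, exp_log hC0, exp_log hD0, ofReal_log
      hk.le, exp_log hk0, h]
    field_simp
  obtain ⟨n, hn⟩ := exp_eq_exp_iff_exists_int.1 he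
  have him := congrArg im hn
  simp only [add_im, sub_im, log_im, ofReal_im, mul_im, intCast_re, intCast_im, I_re, I_im] at him
  obtain ⟨a1, a2⟩ := abs_lt.1 (abs_arg_lt hA)
  obtain ⟨c1, c2⟩ := abs_lt.1 (abs_arg_lt hC)
  have b1 := neg_pi_lt_arg B
  have b2 : arg B < 0 := arg_neg_iff.2 hB
  have d1 : 0 < arg D := (arg_nonneg_iff.2 hD.le).lt_of_ne' fun h0 => by
    rw [arg_eq_zero_iff] at h0; linarith [h0.2]
  have d2 := arg_le_pi D
  have d3 : arg D ≠ Real.pi := fun h0 => by rw [arg_eq_pi_iff] at h0; linarith [h0.2]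
  have d4 := lt_of_le_of_ne d2 d3
  simp at him
  have hpi := Real.pi_pos
  have hn0 : n = 0 := by
    have h1 : (n : ℝ) < 1 := by
      by_contra hc
      push Not at hc
      nlinarith
    have h2 : (-1 : ℝ) < n := by
      by_contra hc
      push Not at hc
      nlinarith
    have h1' : n < 1 := by exact_mod_cast h1
    have h2' : -1 < n := by exact_mod_cast h2
    omega
  simpa [hn0] using hn

/-- The automorphy factor of the Vilenkin transform. -/
noncomputable def mobFactor (α φ : ℝ) (p : ℂ) : ℂ :=
  ((2 * Real.sinh φ : ℝ) : ℂ) ^ (α / 2 : ℂ) * (1 - I * p) ^ (-α : ℂ)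

/-- The automorphy factor of the inverse Vilenkin transform. -/
noncomputable def mobInvFactor (α φ : ℝ) (q : ℂ) : ℂ :=
  ((2 * Real.sinh φ : ℝ) : ℂ) ^ (α / 2 : ℂ) * (Real.exp φ + I * q) ^ (-α : ℂ)

theorem mobFactor_mobInv_mul {α φ : ℝ} (hφ : 0 < φ) {q : ℂ} (hq : 0 < q.re) :
    mobFactor α φ (mobInv φ q) * mobInvFactor α φ q = 1 := by
  have hs : 0 < 2 * Real.sinh φ := mul_pos two_pos (Real.sinh_pos_iff.2 hφ)
  have hs0 : ((2 * Real.sinh φ : ℝ) : ℂ) ≠ 0 := ofReal_ne_zero.2 hs.ne'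
  have hD0 := exp_add_I_mul_ne_zero φ hq
  have harg : arg (Real.exp φ + I * q) ≠ Real.pi := fun h => by
    rw [arg_eq_pi_iff] at h
    have := h.2
    simp at this
    linarith
  have hlog : log ((2 * Real.sinh φ : ℝ) / (Real.exp φ + I * q)) =
      Real.log (2 * Real.sinh φ) - log (Real.exp φ + I * q) := by
    rw [div_eq_mul_inv, log_ofReal_mul hs (inv_ne_zero hD0), log_inv _ harg, sub_eq_add_neg]
  rw [mobFactor, mobInvFactor, one_sub_I_mul_mobInv φ hq, cpow_def_of_ne_zero hs0,
    cpow_def_of_ne_zero (div_ne_zero hs0 hD0), cpow_def_of_ne_zero hD0, hlog, ← ofReal_log hs.le,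
    ← exp_add, ← exp_add, ← exp_add, ← exp_zero]
  congr 1
  ring

/-- The covariance identity raised to the power -α; the automorphy factors absorb the determinant
and both denominators, and `log_eq_of_eq_div` rules out a branch correction. -/
theorem mobFactor_gram {α φ : ℝ} (hφ : 0 < φ) {p q : ℂ} (hp : 0 < p.re) (hq : 0 < q.re) :
    mobFactor α φ p * conj (mobFactor α φ q) * gammaPow (mob φ p + conj (mob φ q)) α =
      gammaPow (p + conj q) α := by
  have hs : 0 < 2 * Real.sinh φ := mul_pos two_pos (Real.sinh_pos_iff.2 hφ)
  have hs0 : ((2 * Real.sinh φ : ℝ) : ℂ) ≠ 0 := ofReal_ne_zero.2 hs.ne'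
  have hpq : 0 < (p + conj q).re := by simp; positivity
  have hpq' : 0 < (mob φ p + conj (mob φ q)).re := by
    have := mob_re_pos hφ hp; have := mob_re_pos hφ hq; simp; positivity
  have hB : (1 - I * p).im < 0 := by simpa using hp
  have hD : 0 < (1 + I * conj q).im := by simpa using hq
  have hlog := log_eq_of_eq_div hs hpq hB hpq' hD (mob_add_conj_mob φ hp hq)
  have hB0 := one_sub_I_mul_ne_zero hp
  have hD0 : 1 + I * conj q ≠ 0 := fun h => by simp [h] at hD
  have hconj : conj (mobFactor α φ q) =
      ((2 * Real.sinh φ : ℝ) : ℂ) ^ (α / 2 : ℂ) * (1 + I * conj q) ^ (-α : ℂ) := by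
    have harg : arg (1 + I * conj q) ≠ Real.pi := fun h => by
      rw [arg_eq_pi_iff] at h; linarith [h.2]
    rw [mobFactor, map_mul]
    congr 1
    · have := cpow_conj ((2 * Real.sinh φ : ℝ) : ℂ) (α / 2 : ℂ) (by
        rw [arg_ofReal_of_nonneg hs.le]; exact Real.pi_pos.ne)
      rw [conj_ofReal] at this
      rw [← this]
      simp [map_div₀, map_ofNat]
    · rw [show (1 - I * q) = conj (1 + I * conj q) by simp [sub_eq_add_neg], conj_cpow _ _ harg]
      simp
  rw [hconj, mobFactor, gammaPow, gammaPow, cpow_def_of_ne_zero (ne_zero_of_re_pos hpq'),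
    cpow_def_of_ne_zero (ne_zero_of_re_pos hpq), cpow_def_of_ne_zero hB0, cpow_def_of_ne_zero hD0,
    cpow_def_of_ne_zero hs0, hlog, ofReal_log hs.le]
  rw [show ∀ a b c d e : ℂ, exp a * exp b * (exp a * exp c) * (d * exp e) =
    d * exp (a + b + a + c + e) by intros; simp only [exp_add]; ring]
  congr 2
  ring

/-- The Vilenkin transform exists as a unitary operator, given on exponential vectors. -/
theorem exists_unitary {α φ : ℝ} (hα : 0 < α) (hφ : 0 < φ) :
    ∃ V : L2w α ≃ₗᵢ[ℂ] L2w α,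
      (∀ p : ℂ, 0 < p.re → V (expL α p) = mobFactor α φ p • expL α (mob φ p)) ∧
      ∀ q : ℂ, 0 < q.re → V.symm (expL α q) = mobInvFactor α φ q • expL α (mobInv φ q) := by
  obtain ⟨V, hV⟩ := exists_linearIsometryEquiv_of_inner_eq
    (v := fun p : {p : ℂ // 0 < p.re} => expL α p)
    (w := fun p : {p : ℂ // 0 < p.re} => mobFactor α φ p • expL α (mob φ p))
    (fun u hu => eq_zero_of_inner_expL hα fun r hr => hu ⟨r, by simpa using hr⟩)
    (fun u hu => eq_zero_of_inner_expL hα fun r hr => by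
      have hr' : 0 < (r : ℂ).re := by simpa using hr
      -- The image family is total because each e_r occurs in it, at p = m⁻¹(r), up to a nonzero
      -- scalar.
      have h := hu ⟨mobInv φ r, mobInv_re_pos hφ hr'⟩
      simp only [mob_mobInv hφ hr', inner_smul_left] at h
      refine (mul_eq_zero.1 h).resolve_left ?_
      refine (map_ne_zero _).2 ?_
      exact left_ne_zero_of_mul_eq_one (mobFactor_mobInv_mul (α := α) hφ hr'))
    (fun ⟨q, hq⟩ ⟨p, hp⟩ => by
      simp only [inner_smul_left, inner_smul_right]
      rw [inner_expL hα hp hq, inner_expL hα (mob_re_pos hφ hp) (mob_re_pos hφ hq),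
        ← mobFactor_gram hφ hp hq]
      ring)
  refine ⟨V, fun p hp => hV ⟨p, hp⟩, fun q hq => ?_⟩
  have h := hV ⟨mobInv φ q, mobInv_re_pos hφ hq⟩
  simp only [mob_mobInv hφ hq] at h
  rw [LinearIsometryEquiv.symm_apply_eq, map_smul, h, smul_smul, mul_comm,
    mobFactor_mobInv_mul hφ hq, one_smul]

end Vilenkin

/-! ### Integrals of the hypergeometric series against Gamma factors -/

namespace Vilenkin

open Complex Set Filter Topology
open scoped ComplexConjugate Nat

theorem factorial_inv_mul_ascPochhammer (a : ℂ) (n : ℕ) :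
    ((n ! : ℂ)⁻¹ * (ascPochhammer ℂ n).eval a) = Ring.choose (a + n - 1) n := by
  have h := Ring.factorial_nsmul_multichoose_eq_ascPochhammer a n
  rw [Ring.choose, show a + n - 1 - n + 1 = a by ring, Polynomial.ascPochhammer_smeval_eq_eval] at *
  rw [← h, nsmul_eq_mul, ← mul_assoc, inv_mul_cancel₀ (by exact_mod_cast n.factorial_ne_zero),
    one_mul]

/-- The binomial series. -/
theorem hasSum_ascPochhammer_mul_pow (a : ℂ) {y : ℂ} (hy : ‖y‖ < 1) :
    HasSum (fun n : ℕ => ((n ! : ℂ)⁻¹ * (ascPochhammer ℂ n).eval a) * y ^ n) ((1 - y) ^ (-a)) := by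
  have h := (one_div_one_sub_cpow_hasFPowerSeriesOnBall_zero a).hasSum (y := y)
    (by simpa [Metric.mem_eball, edist_eq_enorm_sub, enorm_eq_nnnorm] using
      (show ‖y‖₊ < 1 by exact_mod_cast hy))
  rw [zero_add, one_div, ← cpow_neg] at h
  refine h.congr_fun ?_
  intro n
  simp [factorial_inv_mul_ascPochhammer, mul_comm]

theorem ofReal_ascPochhammer (r : ℝ) (n : ℕ) :
    (((ascPochhammer ℝ n).eval r : ℝ) : ℂ) = (ascPochhammer ℂ n).eval (r : ℂ) := by
  induction n with
  | zero => simp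
  | succ n ih => simp [ascPochhammer_succ_eval, ih]

theorem hasSum_ascPochhammer_mul_pow_real (r : ℝ) {y : ℝ} (h0 : 0 ≤ y) (hy : y < 1) :
    HasSum (fun n : ℕ => ((n ! : ℝ)⁻¹ * (ascPochhammer ℝ n).eval r) * y ^ n)
      ((1 - y) ^ (-r)) := by
  have h := hasSum_ascPochhammer_mul_pow r (y := y) (by simpa [abs_of_nonneg h0] using hy)
  rw [← hasSum_ofReal]
  rw [ofReal_cpow (by linarith)]
  push_cast
  simpa [ofReal_ascPochhammer] using h

theorem norm_ascPochhammer_le (a : ℂ) (n : ℕ) :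
    ‖(ascPochhammer ℂ n).eval a‖ ≤ (ascPochhammer ℝ n).eval ‖a‖ := by
  induction n with
  | zero => simp
  | succ n ih =>
    rw [ascPochhammer_succ_eval, ascPochhammer_succ_eval, norm_mul]
    refine mul_le_mul ih ((norm_add_le _ _).trans (by simp)) (norm_nonneg _)
      ((norm_nonneg _).trans ih)

theorem ascPochhammer_eval_pos {r : ℝ} (hr : 0 < r) (n : ℕ) : 0 < (ascPochhammer ℝ n).eval r :=
  ascPochhammer_pos n r hr

theorem ascPochhammer_eval_le {r s : ℝ} (hr : 0 < r) (h : r ≤ s) (n : ℕ) :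
    (ascPochhammer ℝ n).eval r ≤ (ascPochhammer ℝ n).eval s := by
  induction n with
  | zero => simp
  | succ n ih =>
    rw [ascPochhammer_succ_eval, ascPochhammer_succ_eval]
    exact mul_le_mul ih (by linarith) (by positivity)
      (ascPochhammer_eval_pos (hr.trans_le h) n).le

theorem gammaPow_add_nat {q s : ℂ} (hq : q ≠ 0) (hs : 0 < s.re) (n : ℕ) :
    gammaPow q (s + n) * q ^ n = (ascPochhammer ℂ n).eval s * gammaPow q s := by
  induction n with
  | zero => simp
  | succ n ih =>
    have h : s + n ≠ 0 := fun h => by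
      have := congrArg re h
      simp at this
      have : (0 : ℝ) ≤ n := n.cast_nonneg
      linarith
    rw [Nat.cast_succ, ← add_assoc, gammaPow_add_one hq h, ascPochhammer_succ_eval, pow_succ]
    field_simp
    linear_combination ih

theorem gamma_add_nat {r : ℝ} (hr : 0 < r) (n : ℕ) :
    Real.Gamma (r + n) = (ascPochhammer ℝ n).eval r * Real.Gamma r := by
  induction n with
  | zero => simp
  | succ n ih =>
    rw [Nat.cast_succ, ← add_assoc, Real.Gamma_add_one (by positivity), ih,
      ascPochhammer_succ_eval]
    ring

/-- The `n`-th term of the hypergeometric series. -/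
noncomputable def hypTerm (a b c x : ℂ) (n : ℕ) : ℂ :=
  (n ! : ℂ)⁻¹ * (ascPochhammer ℂ n).eval a * (ascPochhammer ℂ n).eval b *
    ((ascPochhammer ℂ n).eval c)⁻¹ * x ^ n

theorem hyp_eq_tsum (a b c x : ℂ) : ₂F₁ a b c x = ∑' n, hypTerm a b c x n := by
  rw [ordinaryHypergeometric_eq_tsum]
  rfl

/-- The rising factorial of α/2 - it is absorbed by Γ. All dependence on `t` then sits in one Mellin
factor with abscissa α/2 + n, ready for Barnes' lemma. -/
theorem hypTerm_mul_gammaPow {α : ℝ} (hα : 0 < α) (a x : ℂ) {P : ℂ} (hP : 0 < P.re) (t : ℝ)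
    (n : ℕ) :
    hypTerm a (α / 2 - I * t) α x n * gammaPow P (α / 2 - I * t) =
      (n ! : ℂ)⁻¹ * (ascPochhammer ℂ n).eval a * ((ascPochhammer ℂ n).eval (α : ℂ))⁻¹ *
        (x * P) ^ n * gammaPow P (((α / 2 + n : ℝ) : ℂ) - I * t) := by
  have h := gammaPow_add_nat (s := α / 2 - I * t) (ne_zero_of_re_pos hP) (by simpa using hα) n
  rw [show ((α / 2 + n : ℝ) : ℂ) - I * t = α / 2 - I * t + n by push_cast; ring, hypTerm, mul_pow]
  linear_combination (-(n ! : ℂ)⁻¹ * (ascPochhammer ℂ n).eval a *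
    ((ascPochhammer ℂ n).eval (α : ℂ))⁻¹ * x ^ n) * h

/-- Here Γ(α/2 + n) = (α/2)_n Γ(α/2), and (α/2)_n ≤ (α)_n cancels the denominator of the series.
What is left is a term of a binomial series of ratio x‖P‖ / Re P, free of `t`. -/
theorem norm_hypTerm_mul_gammaPow_le {α : ℝ} (hα : 0 < α) (a : ℂ) {x : ℝ} (hx : 0 ≤ x) {P : ℂ}
    (hP : 0 < P.re) (t : ℝ) (n : ℕ) :
    ‖hypTerm a (α / 2 - I * t) α x n * gammaPow P (α / 2 - I * t)‖ ≤
      Real.Gamma (α / 2) * P.re ^ (-(α / 2)) *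
        ((n ! : ℝ)⁻¹ * (ascPochhammer ℝ n).eval ‖a‖ * (x * ‖P‖ / P.re) ^ n) := by
  have hα2 := half_pos hα
  have h1 := norm_gammaPow_le (q := P) (s := ((α / 2 + n : ℝ) : ℂ) - I * t)
    (by simp; positivity) hP
  have hre : (((α / 2 + n : ℝ) : ℂ) - I * t).re = α / 2 + n := by simp
  rw [hre, gamma_add_nat hα2, neg_add, Real.rpow_add hP, Real.rpow_neg hP.le (n : ℝ),
    Real.rpow_natCast] at h1
  have h2 := ascPochhammer_eval_le hα2 (by linarith : α / 2 ≤ α) n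
  have h3 := ascPochhammer_eval_pos hα n
  have h4 := norm_ascPochhammer_le a n
  have h5 := (ascPochhammer_eval_pos hα2 n)
  have h6 := Real.Gamma_pos_of_pos hα2
  rw [hypTerm_mul_gammaPow hα a x hP, ← ofReal_ascPochhammer]
  simp only [norm_mul, norm_inv, norm_pow, norm_real, norm_natCast, Real.norm_of_nonneg hx,
    Real.norm_of_nonneg h3.le]
  calc _ ≤ (n ! : ℝ)⁻¹ * (ascPochhammer ℝ n).eval ‖a‖ * ((ascPochhammer ℝ n).eval α)⁻¹ *
        (x * ‖P‖) ^ n * ((ascPochhammer ℝ n).eval α * Real.Gamma (α / 2) *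
          (P.re ^ (-(α / 2)) * (P.re ^ n)⁻¹)) := by
        have h7 : 0 ≤ (ascPochhammer ℝ n).eval ‖a‖ := (norm_nonneg _).trans h4
        gcongr
        refine h1.trans ?_
        gcongr
    _ = _ := by
        rw [div_pow]
        field_simp

theorem summable_hypTerm_mul {α : ℝ} (hα : 0 < α) (a : ℂ) {x : ℝ} (hx : 0 ≤ x) {P : ℂ}
    (hP : 0 < P.re) (hxP : x * ‖P‖ < P.re) (t : ℝ) :
    HasSum (fun n => hypTerm a (α / 2 - I * t) α x n * gammaPow P (α / 2 - I * t))
      (₂F₁ a (α / 2 - I * t) (α : ℂ) (x : ℂ) * gammaPow P (α / 2 - I * t)) := by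
  have hy : x * ‖P‖ / P.re < 1 := (div_lt_one hP).2 hxP
  have hs : Summable fun n => hypTerm a (α / 2 - I * t) α x n * gammaPow P (α / 2 - I * t) :=
    Summable.of_norm_bounded ((hasSum_ascPochhammer_mul_pow_real ‖a‖ (by positivity)
      hy).summable.mul_left _) fun n => norm_hypTerm_mul_gammaPow_le hα a hx hP t n
  rw [hyp_eq_tsum, ← tsum_mul_right]
  exact hs.hasSum

/-- A bound for the hypergeometric function that is uniform in `t`. -/
theorem norm_hyp_mul_gammaPow_le {α : ℝ} (hα : 0 < α) (a : ℂ) {x : ℝ} (hx : 0 ≤ x) {P : ℂ}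
    (hP : 0 < P.re) (hxP : x * ‖P‖ < P.re) (t : ℝ) :
    ‖₂F₁ a (α / 2 - I * t) (α : ℂ) (x : ℂ) * gammaPow P (α / 2 - I * t)‖ ≤
      Real.Gamma (α / 2) * P.re ^ (-(α / 2)) * (1 - x * ‖P‖ / P.re) ^ (-‖a‖) := by
  have hy : x * ‖P‖ / P.re < 1 := (div_lt_one hP).2 hxP
  rw [← (summable_hypTerm_mul hα a hx hP hxP t).tsum_eq]
  exact tsum_of_norm_bounded ((hasSum_ascPochhammer_mul_pow_real ‖a‖ (by positivity) hy).mul_left _)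
    fun n => norm_hypTerm_mul_gammaPow_le hα a hx hP t n

/-- Termwise integration gives Γ(α+n)(P+Q)^{-α-n} at each step. Since Γ(α+n) = (α)_n Γ(α), the lower
parameter of the hypergeometric series cancels, and a binomial series in xP/(P+Q) remains. -/
theorem integral_hyp_mul_gammaPow {α : ℝ} (hα : 0 < α) (a : ℂ) {x : ℝ} (hx : 0 ≤ x) {P Q : ℂ}
    (hP : 0 < P.re) (hxP : x * ‖P‖ < P.re) (hQ : 0 < Q.re) :
    ∫ t : ℝ, ₂F₁ a (α / 2 - I * t) (α : ℂ) (x : ℂ) * gammaPow P (α / 2 - I * t) *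
        gammaPow Q (α / 2 + I * t) =
      2 * Real.pi * gammaPow (P + Q) α * (1 - x * P / (P + Q)) ^ (-a) := by
  have hα2 := half_pos hα
  have hy : x * ‖P‖ / P.re < 1 := (div_lt_one hP).2 hxP
  have hPQ : 0 < (P + Q).re := by rw [add_re]; positivity
  have hPQ0 := ne_zero_of_re_pos hPQ
  have hsum := hasSum_ascPochhammer_mul_pow_real ‖a‖ (y := x * ‖P‖ / P.re) (by positivity) hy
  set C := Real.Gamma (α / 2) * P.re ^ (-(α / 2)) with hC
  have hQc := continuous_gammaPow_line hQ hα2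
  have hQi := integrable_gammaPow_line hQ hα2
  push_cast at hQc hQi
  have hterm : ∀ (n : ℕ) (t : ℝ), hypTerm a (α / 2 - I * t) α x n * gammaPow P (α / 2 - I * t) *
        gammaPow Q (α / 2 + I * t) =
      ((n ! : ℂ)⁻¹ * (ascPochhammer ℂ n).eval a * ((ascPochhammer ℂ n).eval (α : ℂ))⁻¹ *
        (x * P) ^ n) * (gammaPow Q ((α / 2 : ℝ) + I * t) *
          gammaPow P (((α / 2 + n : ℝ) : ℂ) - I * t)) := fun n t => by
    rw [hypTerm_mul_gammaPow hα a x hP]; push_cast; ring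
  have key := hasSum_integral_of_dominated_convergence (μ := (volume : Measure ℝ))
    (F := fun (n : ℕ) (t : ℝ) => hypTerm a (α / 2 - I * t) α x n * gammaPow P (α / 2 - I * t) *
        gammaPow Q (α / 2 + I * t))
    (f := fun t : ℝ => ₂F₁ a (α / 2 - I * t) (α : ℂ) (x : ℂ) * gammaPow P (α / 2 - I * t) *
        gammaPow Q (α / 2 + I * t))
    (fun n t => C * ((n ! : ℝ)⁻¹ * (ascPochhammer ℝ n).eval ‖a‖ * (x * ‖P‖ / P.re) ^ n) *
      ‖gammaPow Q (α / 2 + I * t)‖)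
    (fun n => by
      simp only [hterm]
      exact (integrable_gammaPow_mul_gammaPow (by positivity) hα2 hP
        hQ).aestronglyMeasurable.const_mul _)
    (fun n => Eventually.of_forall fun t => by
      rw [norm_mul]
      gcongr
      exact norm_hypTerm_mul_gammaPow_le hα a hx hP t n)
    (Eventually.of_forall fun t => (hsum.summable.mul_left C).mul_right _)
    (by
      simp only [tsum_mul_right]
      exact hQi.norm.const_mul _)
    (Eventually.of_forall fun t => (summable_hypTerm_mul hα a hx hP hxP t).mul_right _)
  -- |P + Q| ≥ Re(P + Q) ≥ Re P > x|P|.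
  have hz : ‖x * P / (P + Q)‖ < 1 := by
    rw [norm_div, div_lt_one (norm_pos_iff.2 hPQ0), norm_mul, norm_real, Real.norm_of_nonneg hx]
    calc x * ‖P‖ < P.re := hxP
      _ ≤ (P + Q).re := by rw [add_re]; linarith
      _ ≤ ‖P + Q‖ := re_le_norm _
  refine key.unique (((hasSum_ascPochhammer_mul_pow a hz).mul_left
    (2 * Real.pi * gammaPow (P + Q) α)).congr_fun fun n => ?_)
  simp only [hterm]
  rw [integral_const_mul, integral_gammaPow_mul_gammaPow (by positivity) hα2 hP hQ]
  have h := gammaPow_add_nat hPQ0 (s := (α : ℂ)) (by simpa using hα) n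
  have h0 : (ascPochhammer ℂ n).eval (α : ℂ) ≠ 0 := by
    rw [← ofReal_ascPochhammer]; exact ofReal_ne_zero.2 (ascPochhammer_eval_pos hα n).ne'
  rw [show ((α / 2 + n : ℝ) : ℂ) + (α / 2 : ℝ) = α + n by push_cast; ring, div_pow]
  field_simp
  linear_combination ((ascPochhammer ℂ n).eval a * x ^ n * P ^ n * (n ! : ℂ)⁻¹) * h

end Vilenkin

/-! ### Recognising integral operators by their adjoints on exponential vectors -/

namespace Vilenkin

open Complex Set Filter Topology
open scoped ComplexConjugate

theorem continuous_weight {α : ℝ} (hα : 0 < α) : Continuous (weight α) := by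
  have h := continuous_gammaPow_line (q := 1) (by simp) (half_pos hα)
  simp only [gammaPow, one_cpow, mul_one, ofReal_div, ofReal_ofNat] at h
  unfold weight
  fun_prop

theorem isLocallyFiniteMeasure_weightMeasure {α : ℝ} (hα : 0 < α) :
    IsLocallyFiniteMeasure (weightMeasure α) :=
  IsLocallyFiniteMeasure.withDensity_ofReal (continuous_weight hα)

theorem gammaPow_ne_zero {q s : ℂ} (hq : q ≠ 0) (hs : 0 < s.re) : gammaPow q s ≠ 0 :=
  mul_ne_zero (Gamma_ne_zero_of_re_pos hs) (by simp [cpow_eq_zero_iff, hq])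

theorem hypTerm_comm (a b c x : ℂ) (n : ℕ) : hypTerm a b c x n = hypTerm b a c x n := by
  unfold hypTerm; ring

theorem hyp_comm (a b c x : ℂ) : ₂F₁ a b c x = ₂F₁ b a c x := by
  simp only [hyp_eq_tsum, hypTerm_comm a b]

theorem conj_ascPochhammer (a : ℂ) (n : ℕ) :
    conj ((ascPochhammer ℂ n).eval a) = (ascPochhammer ℂ n).eval (conj a) := by
  induction n with
  | zero => simp
  | succ n ih => simp [ascPochhammer_succ_eval, ih]

theorem conj_hyp (a b c x : ℂ) : conj (₂F₁ a b c x) = ₂F₁ (conj a) (conj b) (conj c) (conj x) := by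
  simp only [hyp_eq_tsum, conj_tsum, hypTerm, map_mul, map_inv₀, map_pow, conj_ascPochhammer,
    map_natCast]

theorem measurable_hyp {α : ℝ} (hα : 0 < α) {x : ℝ} (h0 : 0 ≤ x) (h1 : x < 1) :
    Measurable fun z : ℝ × ℝ => ₂F₁ (α / 2 - I * z.1 : ℂ) (α / 2 + I * z.2) (α : ℂ) (x : ℂ) := by
  refine measurable_of_tendsto_metrizable
    (f := fun (N : ℕ) (z : ℝ × ℝ) => ∑ n ∈ Finset.range N,
      hypTerm (α / 2 - I * z.1 : ℂ) (α / 2 + I * z.2) (α : ℂ) (x : ℂ) n) (fun N => ?_) ?_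
  · refine Finset.measurable_sum _ fun n _ => ?_
    unfold hypTerm
    have hc : Continuous fun u : ℂ => (ascPochhammer ℂ n).eval u := (ascPochhammer ℂ n).continuous
    refine Continuous.measurable ?_
    fun_prop
  · rw [tendsto_pi_nhds]
    intro z
    -- Convergence of the series is taken from the bound with `P = 1`, whose condition is just `x <
    -- 1`, by cancelling the nonzero Gamma factor.
    have h := (summable_hypTerm_mul hα (α / 2 + I * z.2) h0 (P := 1) (by simp)
      (by simpa using h1) z.1).summable
    have hg := gammaPow_ne_zero (q := 1) (s := α / 2 - I * z.1) one_ne_zero (by simpa using hα)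
    have h' := (summable_mul_right_iff hg).1 h
    rw [hyp_eq_tsum]
    simp only [hypTerm_comm _ (α / 2 + I * z.2 : ℂ)] at h' ⊢
    exact h'.hasSum.tendsto_sum_nat

theorem measurable_kernel {α φ : ℝ} (hα : 0 < α) (hφ : 0 < φ) :
    Measurable fun z : ℝ × ℝ => kernel α φ z.1 z.2 := by
  have h1 : Real.exp (-2 * φ) < 1 := by rw [Real.exp_lt_one_iff]; linarith
  have h2 := Real.exp_pos (-2 * φ)
  have h := (measurable_hyp hα (x := 1 - Real.exp (-2 * φ)) (by linarith) (by linarith)).comp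
    measurable_swap
  simp only [Function.comp_def, Prod.fst_swap, Prod.snd_swap, ofReal_sub, ofReal_one] at h
  unfold kernel
  fun_prop

theorem conj_kernel (α φ t s : ℝ) : conj (kernel α φ t s) = inverseKernel α φ s t := by
  simp only [kernel, inverseKernel, map_mul, conj_ofReal, conj_hyp, ← exp_conj]
  simp only [map_sub, map_add, map_div₀, map_mul, conj_ofReal, map_ofNat, conj_I, map_neg, map_one]
  ring_nf

/-- A bounded operator is an integral operator with kernel `k` if the adjoint acts on exponential
vectors as the integral operator with the adjoint kernel. -/
theorem isIntegralOperator_of_adjoint {α : ℝ} (hα : 0 < α) {k : ℝ → ℝ → ℂ}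
    (hk : Measurable fun z : ℝ × ℝ => k z.1 z.2) (T U : L2w α →L[ℂ] L2w α)
    (hTU : ∀ u v, inner ℂ (U u) v = inner ℂ u (T v))
    (hbound : ∀ r : ℝ, 0 < r → ∃ H : ℝ → ℝ, ∃ B : ℝ → ℝ, Integrable H (weightMeasure α) ∧
      Continuous B ∧ ∀ x y, ‖k x y * conj (expVec α r x)‖ ≤ H x * B y)
    (hU : ∀ r : ℝ, 0 < r → ∀ᵐ y ∂weightMeasure α,
      U (expL α r) y = ∫ x, conj (k x y) * expVec α r x ∂weightMeasure α) :
    IsIntegralOperator k T := by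
  intro g hg hgc
  have := isLocallyFiniteMeasure_weightMeasure hα
  have hBg : ∀ B : ℝ → ℝ, Continuous B → Integrable (fun y => (B y : ℂ) * g y)
      (weightMeasure α) := fun B hB => by
    -- On its compact support an L² function is integrable, since the measure is locally finite.
    have hg1 : IntegrableOn g (tsupport g) (weightMeasure α) := by
      have : IsFiniteMeasure ((weightMeasure α).restrict (tsupport g)) :=
        isFiniteMeasure_restrict.2 hgc.isCompact.measure_lt_top.ne
      exact (hg.restrict _).integrable one_le_two
    have h2 := hg1.continuousOn_mul (continuous_ofReal.comp hB).continuousOn hgc.isCompact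
    refine (integrableOn_iff_integrable_of_support_subset fun y hy => ?_).1 h2
    exact subset_tsupport g (right_ne_zero_of_mul hy)
  have hne : ∀ x : ℝ, conj (expVec α 1 x) ≠ 0 := fun x => by
    refine (map_ne_zero _).2 ?_
    rw [expVec]; simp [exp_ne_zero]
  -- The bound at `r = 1` controls the kernel itself after division by e_1(x), which never vanishes.
  have hint : ∀ x, Integrable (fun y => k x y * g y) (weightMeasure α) := fun x => by
    obtain ⟨H, B, -, hB, hHB⟩ := hbound 1 one_pos
    refine ((hBg B hB).norm.const_mul (|H x| / ‖conj (expVec α 1 x)‖)).mono'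
      (((hk.comp (measurable_const.prodMk measurable_id)).aestronglyMeasurable).mul
        hg.aestronglyMeasurable) (Eventually.of_forall fun y => ?_)
    have h1 := hHB x y
    rw [norm_mul, ofReal_one, ← le_div_iff₀ (norm_pos_iff.2 (hne x))] at h1
    rw [norm_mul, norm_mul, norm_real, ← mul_assoc]
    refine mul_le_mul_of_nonneg_right (h1.trans ?_) (norm_nonneg _)
    rw [div_mul_eq_mul_div]
    refine div_le_div_of_nonneg_right ?_ (norm_nonneg _)
    rw [Real.norm_eq_abs, ← abs_mul]
    exact le_abs_self _
  have hprod : ∀ r : ℝ, 0 < r → Integrable (Function.uncurry fun x y =>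
      k x y * g y * conj (expVec α r x)) ((weightMeasure α).prod (weightMeasure α)) :=
    fun r hr => by
    obtain ⟨H, B, hH, hB, hHB⟩ := hbound r hr
    have he : Continuous fun x : ℝ => conj (expVec α r x) :=
      continuous_conj.comp ((differentiable_expVec α
        (ofReal_ne_zero.2 hr.ne')).continuous.comp continuous_ofReal)
    refine (hH.ofReal (𝕜 := ℂ)).mul_prod (hBg B hB) |>.mono
      ((hk.aestronglyMeasurable.mul hg.aestronglyMeasurable.comp_snd).mul
        (he.comp continuous_fst).aestronglyMeasurable) (Eventually.of_forall fun z => ?_)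
    have h1 := (hHB z.1 z.2).trans (le_abs_self _)
    rw [norm_mul, abs_mul] at h1
    simp only [Function.uncurry, norm_mul, RCLike.norm_ofReal, norm_real, Real.norm_eq_abs]
    simp only [RCLike.norm_conj] at h1 ⊢
    calc _ = ‖k z.1 z.2‖ * ‖expVec α r z.1‖ * ‖g z.2‖ := by ring
      _ ≤ |H z.1| * |B z.2| * ‖g z.2‖ := by gcongr
      _ = _ := by ring
  refine ⟨hint, ?_⟩
  set G : ℝ → ℂ := fun x => ∫ y, k x y * g y ∂weightMeasure α with hG
  have hGint : ∀ r : ℝ, 0 < r →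
      Integrable (fun x => G x * conj (expVec α r x)) (weightMeasure α) := fun r hr => by
    have := (hprod r hr).integral_prod_left
    simpa only [Function.uncurry, integral_mul_const] using this
  have hTint : ∀ r : ℝ, 0 < r →
      Integrable (fun x => T (hg.toLp g) x * conj (expVec α r x)) (weightMeasure α) :=
    fun r hr => integrable_mul_conj_expVec hα (by simpa using hr) (Lp.memLp _)
  -- `G` is not known to be in L², but it is integrable against every e_r. By Fubini it has the same
  -- pairings with them as `T g`, and these determine a function.
  have key : ∀ᵐ x, T (hg.toLp g) x - G x = 0 := by
    refine ae_eq_zero_of_integral_mul_conj_expVec hα ?_ fun r hr => ?_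
    · simp only [sub_mul]
      have h1 := (hTint 1 one_pos).sub (hGint 1 one_pos)
      rw [ofReal_one] at h1
      exact h1
    simp only [sub_mul]
    rw [integral_sub (hTint r hr) (hGint r hr), ← inner_expL_left hα (by simpa using hr), ← hTU,
      inner_L2w, sub_eq_zero]
    calc ∫ y, hg.toLp g y * conj (U (expL α r) y) ∂weightMeasure α
        = ∫ y, ∫ x, k x y * g y * conj (expVec α r x) ∂weightMeasure α ∂weightMeasure α := by
          refine integral_congr_ae ?_
          filter_upwards [hU r hr, hg.coeFn_toLp] with y h1 h2
          rw [h1, h2, ← integral_conj, ← integral_const_mul]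
          congr 1
          ext x
          rw [map_mul, conj_conj]
          ring
      _ = ∫ x, ∫ y, k x y * g y * conj (expVec α r x) ∂weightMeasure α ∂weightMeasure α :=
          (integral_integral_swap (hprod r hr)).symm
      _ = _ := by simp only [integral_mul_const, hG]
  filter_upwards [(ae_weightMeasure_iff hα).2 key] with x hx
  exact sub_eq_zero.1 hx

/-- The special case of kernels that are built from the hypergeometric function. -/
theorem isIntegralOperator_of_hyp {α : ℝ} (hα : 0 < α) {k : ℝ → ℝ → ℂ}
    (hk : Measurable fun z : ℝ × ℝ => k z.1 z.2) (T U : L2w α →L[ℂ] L2w α)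
    (hTU : ∀ u v, inner ℂ (U u) v = inner ℂ u (T v)) {x : ℝ} (hx : 0 ≤ x) {P : ℂ} (hP : 0 < P.re)
    (hxP : x * ‖P‖ < P.re)
    (h : ∀ r : ℝ, 0 < r → ∃ Q : ℂ, 0 < Q.re ∧ ∃ c : ℝ → ℂ, Continuous c ∧
      (∀ y t : ℝ, (weight α t : ℂ) * (conj (k t y) * expVec α r t) =
        c y * (₂F₁ (α / 2 + I * y : ℂ) (α / 2 - I * t) (α : ℂ) (x : ℂ) *
          gammaPow P (α / 2 - I * t) * gammaPow Q (α / 2 + I * t))) ∧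
      ∀ᵐ y ∂weightMeasure α, U (expL α r) y = c y * (2 * Real.pi * gammaPow (P + Q) α *
        (1 - x * P / (P + Q)) ^ (-(α / 2 + I * y : ℂ)))) :
    IsIntegralOperator k T := by
  refine isIntegralOperator_of_adjoint hα hk T U hTU (fun r hr => ?_) (fun r hr => ?_)
  · obtain ⟨Q, hQ, c, hc, hfac, -⟩ := h r hr
    have hQi := integrable_gammaPow_line hQ (half_pos hα)
    push_cast at hQi
    have hy : 0 < 1 - x * ‖P‖ / P.re := sub_pos.2 ((div_lt_one hP).2 hxP)
    -- Dividing by the weight makes the w-integral of the first factor a plain Lebesgue integral of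
    -- |gammaPow Q|.
    refine ⟨fun t => ‖gammaPow Q (α / 2 + I * t)‖ / weight α t, fun y => ‖c y‖ *
      (Real.Gamma (α / 2) * P.re ^ (-(α / 2)) * (1 - x * ‖P‖ / P.re) ^ (-‖(α / 2 + I * y : ℂ)‖)),
      ?_, ?_, fun t y => ?_⟩
    · rw [weightMeasure, integrable_withDensity_iff_integrable_smul'
        (measurable_weight hα).ennreal_ofReal (by simp)]
      refine hQi.norm.congr (Eventually.of_forall fun t => ?_)
      have := (weight_pos hα t).ne'
      simp only [ENNReal.toReal_ofReal (weight_pos hα _).le, smul_eq_mul]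
      field_simp
    · refine hc.norm.mul (continuous_const.mul ?_)
      exact Continuous.rpow continuous_const (by fun_prop) fun _ => Or.inl hy.ne'
    · have h1 := congrArg norm (hfac y t)
      have h2 := norm_hyp_mul_gammaPow_le hα (α / 2 + I * y) hx hP hxP t
      have hw := weight_pos hα t
      simp only [norm_mul, RCLike.norm_conj, norm_real, Real.norm_of_nonneg hw.le] at h1 h2 ⊢
      rw [div_mul_eq_mul_div, le_div_iff₀ hw]
      calc _ = weight α t * (‖k t y‖ * ‖expVec α r t‖) := by ring
        _ = _ := h1
        _ ≤ ‖c y‖ * (Real.Gamma (α / 2) * P.re ^ (-(α / 2)) *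
            (1 - x * ‖P‖ / P.re) ^ (-‖(α / 2 + I * y : ℂ)‖) * ‖gammaPow Q (α / 2 + I * t)‖) := by
          gcongr
        _ = _ := by ring
  · obtain ⟨Q, hQ, c, hc, hfac, hval⟩ := h r hr
    filter_upwards [hval] with y hy
    rw [hy, integral_weightMeasure hα]
    simp only [hfac]
    rw [integral_const_mul, integral_hyp_mul_gammaPow hα _ hx hP hxP hQ]

end Vilenkin

/-! ### Closed forms and the two Vilenkin kernels -/

namespace Vilenkin

open Complex Set Filter Topology
open scoped ComplexConjugate

/-- Used for the argument of `P`: cos ψ > x makes x‖P‖ < Re P, ψ < π/2 keeps `P` in the right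
half-plane, and ψ > 0 does the same for `Q`, whose argument is ±(π/2 - ψ). -/
theorem exists_angle {x : ℝ} (h0 : 0 ≤ x) (h1 : x < 1) :
    ∃ ψ : ℝ, 0 < ψ ∧ ψ < Real.pi / 2 ∧ x < Real.cos ψ := by
  refine ⟨Real.arccos ((1 + x) / 2), Real.arccos_pos.2 (by linarith), ?_, ?_⟩
  · rw [Real.arccos_lt_pi_div_two]; linarith
  · rw [Real.cos_arccos (by linarith) (by linarith)]; linarith

theorem exp_re_pos_of_abs_im {w : ℂ} (h1 : -(Real.pi / 2) < w.im) (h2 : w.im < Real.pi / 2) :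
    0 < (exp w).re := by
  rw [exp_re]
  exact mul_pos (Real.exp_pos _) (Real.cos_pos_of_mem_Ioo ⟨h1, h2⟩)

theorem rpow_one_sub_exp {α φ : ℝ} (hφ : 0 < φ) :
    (((1 - Real.exp (-2 * φ)) ^ (α / 2) : ℝ) : ℂ) =
      ((2 * Real.sinh φ : ℝ) : ℂ) ^ (α / 2 : ℂ) * exp (-(φ * α / 2)) := by
  have hs : 0 < 2 * Real.sinh φ := mul_pos two_pos (Real.sinh_pos_iff.2 hφ)
  have h : 1 - Real.exp (-2 * φ) = 2 * Real.sinh φ * Real.exp (-φ) := by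
    rw [Real.sinh_eq]
    have h1 : Real.exp φ * Real.exp (-φ) = 1 := by rw [← Real.exp_add]; simp
    have h2 : Real.exp (-2 * φ) = Real.exp (-φ) * Real.exp (-φ) := by
      rw [← Real.exp_add]; ring_nf
    rw [h2]
    linear_combination -h1
  rw [h, Real.mul_rpow hs.le (Real.exp_pos _).le, ← Real.exp_mul, ofReal_mul,
    ofReal_cpow hs.le, ofReal_exp]
  push_cast
  ring_nf

theorem sq_exp_neg (φ : ℝ) : (Real.exp (-2 * φ) : ℂ) * Real.exp φ = Real.exp (-φ) := by
  rw [← ofReal_mul, ← Real.exp_add]; ring_nf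

theorem one_sub_exp_mem {φ : ℝ} (hφ : 0 < φ) :
    0 ≤ 1 - Real.exp (-2 * φ) ∧ 1 - Real.exp (-2 * φ) < 1 := by
  have h1 : Real.exp (-2 * φ) < 1 := by rw [Real.exp_lt_one_iff]; linarith
  have h2 := Real.exp_pos (-2 * φ)
  constructor <;> linarith

/-- The closed form of the Vilenkin transform of an exponential vector. -/
theorem mobFactor_mul_expVec_mob {α φ : ℝ} (hφ : 0 < φ) {r : ℝ} (hr : 0 < r) (y : ℝ) :
    mobFactor α φ r * expVec α (mob φ r) y =
      (((1 - Real.exp (-2 * φ)) ^ (α / 2) : ℝ) : ℂ) * exp (-I * φ * y) *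
        exp (-(I * α * Real.pi / 4)) * exp (-α * log (1 - I * r)) *
        (1 - (1 - Real.exp (-2 * φ)) / (1 - I * r)) ^ (-(α / 2 + I * y : ℂ)) := by
  have hr' : 0 < (r : ℂ).re := by simpa using hr
  have h0 := one_sub_I_mul_ne_zero hr'
  have hm := mob_re_pos hφ hr'
  set u : ℂ := 1 - (1 - Real.exp (-2 * φ)) / (1 - I * r) with hu
  -- m(r) is i·u up to a positive scalar, where `u` is the base of the binomial power. Since `u`
  -- lies in the lower half-plane, log(iu) = iπ/2 + log u without correction.
  have hmu : mob φ r = Real.exp φ * (I * u) := by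
    rw [mob, hu, one_sub_div h0, mul_div_assoc', mul_div_assoc', div_left_inj' h0]
    linear_combination (-I) * sq_exp_neg φ + (r * Real.exp φ : ℂ) * I_sq
  have hIu : 0 < (I * u).re := by
    rw [hmu, re_ofReal_mul] at hm
    exact (pos_iff_pos_of_mul_pos hm).1 (Real.exp_pos _)
  have huim : u.im < 0 := by simpa using hIu
  have hu0 : u ≠ 0 := by rintro h; simp [h] at huim
  have hIu0 := ne_zero_of_re_pos hIu
  have hlog : log (mob φ r) = φ + (Real.pi / 2 * I + log u) := by
    rw [hmu, log_ofReal_mul (Real.exp_pos _) hIu0, Real.log_exp]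
    congr 1
    have h1 := neg_pi_lt_arg u
    have h2 : arg u < 0 := arg_neg_iff.2 huim
    rw [log_mul I_ne_zero hu0, log_I]
    rw [arg_I]
    constructor <;> linarith [Real.pi_pos]
  rw [mobFactor, expVec, cpow_def_of_ne_zero (ne_zero_of_re_pos hm), hlog,
    cpow_def_of_ne_zero hu0, cpow_def_of_ne_zero h0, rpow_one_sub_exp hφ]
  rw [show ∀ a b c d : ℂ, a * exp b * (exp c * exp d) = a * exp (b + c + d) by
    intros; simp only [exp_add]; ring]
  rw [show ∀ a b c d e f : ℂ, a * exp b * exp c * exp d * exp e * exp f =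
    a * exp (b + c + d + e + f) by intros; simp only [exp_add]; ring]
  congr 2
  linear_combination (-(Real.pi / 2 : ℂ) * y) * I_sq

/-- The closed form of the inverse Vilenkin transform of an exponential vector. -/
theorem mobInvFactor_mul_expVec_mobInv {α φ : ℝ} (hφ : 0 < φ) {r : ℝ} (hr : 0 < r) (y : ℝ) :
    mobInvFactor α φ r * expVec α (mobInv φ r) y =
      (((1 - Real.exp (-2 * φ)) ^ (α / 2) : ℝ) : ℂ) * exp (φ * α / 2) * exp (-(Real.pi * y)) *
        exp (I * α * Real.pi / 4) * exp (-α * log (Real.exp φ + I * r)) *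
        (1 - (1 - Real.exp (-2 * φ)) * Real.exp φ / (Real.exp φ + I * r)) ^
          (-(α / 2 + I * y : ℂ)) := by
  have hr' : 0 < (r : ℂ).re := by simpa using hr
  have h0 := exp_add_I_mul_ne_zero φ hr'
  have hm := mobInv_re_pos hφ hr'
  set u : ℂ := 1 - (1 - Real.exp (-2 * φ)) * Real.exp φ / (Real.exp φ + I * r) with hu
  -- Here `u` lies in the upper half-plane, so multiplication by -i costs exactly -iπ/2 in the
  -- logarithm.
  have hmu : mobInv φ r = -I * u := by
    rw [mobInv, hu, one_sub_div h0, mul_div_assoc', div_left_inj' h0]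
    linear_combination I * sq_exp_neg φ + (r : ℂ) * I_sq
  have huim : 0 < u.im := by rw [hmu] at hm; simpa using hm
  have hu0 : u ≠ 0 := by rintro h; simp [h] at huim
  have hlog : log (mobInv φ r) = -(Real.pi / 2 * I) + log u := by
    rw [hmu]
    have h1 := arg_le_pi u
    have h2 : 0 ≤ arg u := arg_nonneg_iff.2 huim.le
    rw [log_mul (neg_ne_zero.2 I_ne_zero) hu0, log_neg_I]
    · ring
    rw [arg_neg_I]
    constructor <;> linarith [Real.pi_pos]
  rw [mobInvFactor, expVec, cpow_def_of_ne_zero (ne_zero_of_re_pos hm), hlog,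
    cpow_def_of_ne_zero hu0, cpow_def_of_ne_zero h0, rpow_one_sub_exp hφ]
  rw [show ∀ a b c d : ℂ, a * exp b * (exp c * exp d) = a * exp (b + c + d) by
    intros; simp only [exp_add]; ring]
  rw [show ∀ a b c d e f g : ℂ, a * exp b * exp c * exp d * exp e * exp f * exp g =
    a * exp (b + c + d + e + f + g) by intros; simp only [exp_add]; ring]
  congr 2
  linear_combination ((Real.pi / 2 : ℂ) * y) * I_sq

theorem log_exp_I_mul_mul {ψ : ℝ} {z : ℂ} (hz : z ≠ 0) (h1 : -Real.pi < ψ + arg z)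
    (h2 : ψ + arg z ≤ Real.pi) : log (exp (ψ * I) * z) = ψ * I + log z := by
  conv_lhs => rw [← exp_log hz, ← exp_add]
  rw [log_exp] <;> simpa [log_im]

/-- The exponentials combine to e^{-πs/2}, which is divided between the two Mellin factors in the
proportion ψ : π/2 - ψ; the constant undoes the phases of the α/2-th powers. Putting all of it on
one factor would push the other parameter to the imaginary axis. -/
theorem weight_mul_kernel_mul_expVec (α φ : ℝ) {ψ r : ℝ} (hψ0 : 0 < ψ) (hψ1 : ψ < Real.pi / 2)
    (hr : 0 < r) (y s : ℝ) :
    (weight α s : ℂ) * (kernel α φ y s * expVec α r s) =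
      (((1 - Real.exp (-2 * φ)) ^ (α / 2) : ℝ) : ℂ) * exp (-I * φ * y) / Gamma α *
        exp (-(I * (α / 2) * (Real.pi / 2 - 2 * ψ))) / (2 * Real.pi) *
      (₂F₁ (α / 2 + I * y : ℂ) (α / 2 - I * s) (α : ℂ) ((1 - Real.exp (-2 * φ) : ℝ) : ℂ) *
        gammaPow (exp (ψ * I)) (α / 2 - I * s) *
        gammaPow (exp (Real.log r + (ψ - Real.pi / 2) * I)) (α / 2 + I * s)) := by
  rw [kernel, expVec_ofReal α hr, ofReal_weight, gammaPow, gammaPow,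
    exp_cpow (by simp; linarith) (by simp; linarith),
    exp_cpow (by simp; linarith) (by simp; linarith), hyp_comm, ofReal_div, ← Gamma_ofReal,
    ofReal_exp (-Real.pi * s), ofReal_sub, ofReal_one]
  have key : exp (Real.pi * s) * exp ((-Real.pi * s : ℝ) : ℂ) *
      (exp (-(Real.pi / 2 * s)) * exp (-(α / 2 + I * s) * Real.log r)) =
      exp (-(I * (α / 2) * (Real.pi / 2 - 2 * ψ))) * exp (ψ * I * -(α / 2 - I * s)) *
        exp ((Real.log r + (ψ - Real.pi / 2) * I) * -(α / 2 + I * s)) := by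
    simp only [← exp_add]
    congr 1
    push_cast
    linear_combination (-(Real.pi / 2 : ℂ) * s) * I_sq
  generalize ₂F₁ (α / 2 + I * y : ℂ) (α / 2 - I * s) (α : ℂ) (1 - (Real.exp (-2 * φ) : ℂ)) = F
  linear_combination ((((1 - Real.exp (-2 * φ)) ^ (α / 2) : ℝ) : ℂ) * exp (-I * φ * y) /
    Gamma α / (2 * Real.pi) * F * Gamma (α / 2 - I * s) * Gamma (α / 2 + I * s)) * key

theorem weight_mul_inverseKernel_mul_expVec (α φ : ℝ) {ψ r : ℝ} (hψ0 : 0 < ψ)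
    (hψ1 : ψ < Real.pi / 2) (hr : 0 < r) (y t : ℝ) :
    (weight α t : ℂ) * (inverseKernel α φ y t * expVec α r t) =
      (((1 - Real.exp (-2 * φ)) ^ (α / 2) : ℝ) : ℂ) * exp (-(Real.pi * y)) / Gamma α *
        exp (I * (α / 2) * (Real.pi / 2 - 2 * ψ) + φ * α / 2) / (2 * Real.pi) *
      (₂F₁ (α / 2 + I * y : ℂ) (α / 2 - I * t) (α : ℂ) ((1 - Real.exp (-2 * φ) : ℝ) : ℂ) *
        gammaPow (exp (φ - ψ * I)) (α / 2 - I * t) *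
        gammaPow (exp (Real.log r + (Real.pi / 2 - ψ) * I)) (α / 2 + I * t)) := by
  rw [inverseKernel, expVec_ofReal α hr, ofReal_weight, gammaPow, gammaPow,
    exp_cpow (by simp; linarith) (by simp; linarith),
    exp_cpow (by simp; linarith) (by simp; linarith), ofReal_div, ← Gamma_ofReal,
    ofReal_exp (-Real.pi * y), ofReal_sub, ofReal_one]
  have key : exp (Real.pi * t) * exp ((-Real.pi * y : ℝ) : ℂ) * exp (I * φ * t) *
      (exp (-(Real.pi / 2 * t)) * exp (-(α / 2 + I * t) * Real.log r)) =
      exp (-(Real.pi * y)) * exp (I * (α / 2) * (Real.pi / 2 - 2 * ψ) + φ * α / 2) *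
        exp ((φ - ψ * I) * -(α / 2 - I * t)) *
        exp ((Real.log r + (Real.pi / 2 - ψ) * I) * -(α / 2 + I * t)) := by
    simp only [← exp_add]
    congr 1
    push_cast
    linear_combination ((Real.pi / 2 : ℂ) * t) * I_sq
  generalize ₂F₁ (α / 2 + I * y : ℂ) (α / 2 - I * t) (α : ℂ) (1 - (Real.exp (-2 * φ) : ℂ)) = F
  linear_combination ((((1 - Real.exp (-2 * φ)) ^ (α / 2) : ℝ) : ℂ) /
    Gamma α / (2 * Real.pi) * F * Gamma (α / 2 - I * t) * Gamma (α / 2 + I * t)) * key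

theorem isIntegralOperator_inverseKernel {α φ : ℝ} (hα : 0 < α) (hφ : 0 < φ)
    (V : L2w α ≃ₗᵢ[ℂ] L2w α)
    (hV : ∀ p : ℂ, 0 < p.re → V (expL α p) = mobFactor α φ p • expL α (mob φ p)) :
    IsIntegralOperator (inverseKernel α φ) (V.symm : L2w α →L[ℂ] L2w α) := by
  obtain ⟨hx0, hx1⟩ := one_sub_exp_mem hφ
  obtain ⟨ψ, hψ0, hψ1, hψ⟩ := exists_angle hx0 hx1
  have hpi := Real.pi_pos
  have hmeas : Measurable fun z : ℝ × ℝ => inverseKernel α φ z.1 z.2 := by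
    have := continuous_conj.measurable.comp ((measurable_kernel hα hφ).comp measurable_swap)
    simpa [Function.comp_def, conj_kernel] using this
  have hG : (Gamma α : ℂ) ≠ 0 := Gamma_ne_zero_of_re_pos (by simpa using hα)
  have hP : 0 < (exp (ψ * I)).re := exp_re_pos_of_abs_im (by simp; linarith) (by simp; linarith)
  refine isIntegralOperator_of_hyp hα hmeas _ (V : L2w α →L[ℂ] L2w α) (fun u v => ?_) hx0 hP ?_
    fun r hr => ⟨exp (Real.log r + (ψ - Real.pi / 2) * I), ?_,
      fun y => (((1 - Real.exp (-2 * φ)) ^ (α / 2) : ℝ) : ℂ) * exp (-I * φ * y) / Gamma α *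
        exp (-(I * (α / 2) * (Real.pi / 2 - 2 * ψ))) / (2 * Real.pi), ?_, fun y s => ?_, ?_⟩
  · exact V.inner_map_eq_flip u v
  · rw [norm_exp_ofReal_mul_I, mul_one, exp_ofReal_mul_I_re]
    exact hψ
  · exact exp_re_pos_of_abs_im (by simp; linarith) (by simp; linarith)
  · fun_prop
  · rw [← conj_kernel, conj_conj]
    exact weight_mul_kernel_mul_expVec α φ hψ0 hψ1 hr y s
  · have hr' : 0 < (r : ℂ).re := by simpa using hr
    -- Q = -ir e^{iψ}, so the auxiliary angle factors out of P + Q and drops out of the result.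
    have hsum : exp (ψ * I) + exp (Real.log r + (ψ - Real.pi / 2) * I) =
        exp (ψ * I) * (1 - I * r) := by
      rw [exp_add, ← ofReal_exp, Real.exp_log hr, sub_mul, exp_sub, exp_pi_div_two_mul_I, div_I]
      ring
    have harg1 : arg (1 - I * r) < 0 := arg_neg_iff.2 (by simpa using hr)
    have harg2 : -(Real.pi / 2) < arg (1 - I * r) :=
      (abs_lt.1 (abs_arg_lt (q := 1 - I * r) (by simp))).1
    have hVr := hV r hr'
    filter_upwards [Lp.coeFn_smul (mobFactor α φ r) (expL α (mob φ r)),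
      coeFn_expL hα (mob_re_pos hφ hr')] with y h1 h2
    change (V (expL α r)) y = _
    rw [hVr, h1, Pi.smul_apply, h2, smul_eq_mul]
    have h0 := one_sub_I_mul_ne_zero hr'
    rw [mobFactor_mul_expVec_mob hφ hr, hsum, gammaPow, cpow_def_of_ne_zero
      (mul_ne_zero (exp_ne_zero _) h0), log_exp_I_mul_mul h0 (by linarith) (by linarith),
      mul_comm (exp (ψ * I)) (1 - I * r), mul_div_mul_right _ _ (exp_ne_zero _)]
    rw [ofReal_sub, ofReal_one]
    have key : exp (-(I * (α / 2) * (Real.pi / 2 - 2 * ψ))) *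
        exp ((ψ * I + log (1 - I * r)) * -α) =
        exp (-(I * α * Real.pi / 4)) * exp (-α * log (1 - I * r)) := by
      simp only [← exp_add]
      congr 1
      ring
    generalize (1 - (1 - (Real.exp (-2 * φ) : ℂ)) / (1 - I * r)) ^ (-(α / 2 + I * y : ℂ)) = W
    have hpi0 : (Real.pi : ℂ) ≠ 0 := ofReal_ne_zero.2 hpi.ne'
    rw [mul_assoc _ (exp (-(I * α * Real.pi / 4))), ← key]
    field_simp

theorem isIntegralOperator_kernel {α φ : ℝ} (hα : 0 < α) (hφ : 0 < φ)
    (V : L2w α ≃ₗᵢ[ℂ] L2w α)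
    (hV : ∀ q : ℂ, 0 < q.re → V.symm (expL α q) = mobInvFactor α φ q • expL α (mobInv φ q)) :
    IsIntegralOperator (kernel α φ) (V : L2w α →L[ℂ] L2w α) := by
  obtain ⟨hx0, hx1⟩ := one_sub_exp_mem hφ
  obtain ⟨ψ, hψ0, hψ1, hψ⟩ := exists_angle hx0 hx1
  have hpi := Real.pi_pos
  have hG : (Gamma α : ℂ) ≠ 0 := Gamma_ne_zero_of_re_pos (by simpa using hα)
  have hP : 0 < (exp (φ - ψ * I)).re :=
    exp_re_pos_of_abs_im (by simp; linarith) (by simp; linarith)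
  refine isIntegralOperator_of_hyp hα (measurable_kernel hα hφ) _ (V.symm : L2w α →L[ℂ] L2w α)
    (fun u v => ?_) hx0 hP ?_
    fun r hr => ⟨exp (Real.log r + (Real.pi / 2 - ψ) * I), ?_,
      fun y => (((1 - Real.exp (-2 * φ)) ^ (α / 2) : ℝ) : ℂ) * exp (-(Real.pi * y)) / Gamma α *
        exp (I * (α / 2) * (Real.pi / 2 - 2 * ψ) + φ * α / 2) / (2 * Real.pi), ?_,
      fun y t => ?_, ?_⟩
  · exact V.symm.inner_map_eq_flip u v
  · rw [norm_exp, exp_re]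
    simp only [sub_re, sub_im, ofReal_re, ofReal_im, mul_re, mul_im, I_re, I_im]
    rw [show φ - (ψ * 0 - 0 * 1) = φ by ring, show 0 - (ψ * 1 + 0 * 0) = -ψ by ring, Real.cos_neg,
      mul_comm]
    exact mul_lt_mul_of_pos_left hψ (Real.exp_pos _)
  · exact exp_re_pos_of_abs_im (by simp; linarith) (by simp; linarith)
  · fun_prop
  · rw [conj_kernel]
    exact weight_mul_inverseKernel_mul_expVec α φ hψ0 hψ1 hr y t
  · have hr' : 0 < (r : ℂ).re := by simpa using hr
    -- Q = ir e^{-iψ}, so ψ factors out here too.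
    have hsum : exp (φ - ψ * I) + exp (Real.log r + (Real.pi / 2 - ψ) * I) =
        exp ((-ψ : ℝ) * I) * (Real.exp φ + I * r) := by
      rw [exp_add, ← ofReal_exp (Real.log r), Real.exp_log hr, sub_mul, exp_sub, exp_sub,
        exp_pi_div_two_mul_I, ofReal_neg, neg_mul, exp_neg, ofReal_exp]
      ring
    have hPe : exp (φ - ψ * I) = exp ((-ψ : ℝ) * I) * Real.exp φ := by
      rw [ofReal_exp, ← exp_add]; push_cast; ring_nf
    have harg1 : 0 ≤ arg (Real.exp φ + I * r) := arg_nonneg_iff.2 (by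
      simp only [add_im, ofReal_im, mul_im, I_re, I_im, ofReal_re]; linarith)
    have harg2 : arg (Real.exp φ + I * r) < Real.pi / 2 :=
      (abs_lt.1 (abs_arg_lt (q := Real.exp φ + I * r) (by
        rw [add_re, ofReal_re, I_mul_re, ofReal_im, neg_zero, add_zero]; positivity))).2
    have hVr := hV r hr'
    filter_upwards [Lp.coeFn_smul (mobInvFactor α φ r) (expL α (mobInv φ r)),
      coeFn_expL hα (mobInv_re_pos hφ hr')] with y h1 h2
    change (V.symm (expL α r)) y = _
    rw [hVr, h1, Pi.smul_apply, h2, smul_eq_mul]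
    have h0 := exp_add_I_mul_ne_zero φ hr'
    rw [mobInvFactor_mul_expVec_mobInv hφ hr, hsum, gammaPow, cpow_def_of_ne_zero
      (mul_ne_zero (exp_ne_zero _) h0), log_exp_I_mul_mul h0 (by linarith) (by linarith), hPe,
      mul_left_comm _ (exp ((-ψ : ℝ) * I)), mul_div_mul_left _ _ (exp_ne_zero _)]
    rw [ofReal_sub, ofReal_one]
    have key : exp (I * (α / 2) * (Real.pi / 2 - 2 * ψ) + φ * α / 2) *
        exp (((-ψ : ℝ) * I + log (Real.exp φ + I * r)) * -α) =
        exp (φ * α / 2) * (exp (I * α * Real.pi / 4) *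
          exp (-α * log (Real.exp φ + I * r))) := by
      simp only [← exp_add]
      congr 1
      push_cast
      ring
    generalize (1 - (1 - (Real.exp (-2 * φ) : ℂ)) * Real.exp φ / (Real.exp φ + I * r)) ^
      (-(α / 2 + I * y : ℂ)) = W
    have hpi0 : (Real.pi : ℂ) ≠ 0 := ofReal_ne_zero.2 hpi.ne'
    generalize exp (((-ψ : ℝ) * I + log (Real.exp φ + I * r)) * -α) = A at *
    generalize exp (I * (α / 2) * (Real.pi / 2 - 2 * ψ) + φ * α / 2) = B at *
    generalize exp (-α * log (Real.exp φ + I * r)) = C at *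
    have hcancel : (Gamma α : ℂ)⁻¹ * Gamma α * ((2 * Real.pi : ℂ)⁻¹ * (2 * Real.pi)) = 1 := by
      field_simp
    linear_combination (-(((1 - Real.exp (-2 * φ)) ^ (α / 2) : ℝ) : ℂ) * exp (-(Real.pi * y)) * W) *
      key - ((((1 - Real.exp (-2 * φ)) ^ (α / 2) : ℝ) : ℂ) * exp (-(Real.pi * y)) * W * A * B) *
        hcancel

end Vilenkin

/-! ### Contour shifts in the strip -/

namespace Vilenkin

open Complex Set Filter Topology
open scoped ComplexConjugate

/-- Horizontal contour shift for functions that decay exponentially in a strip. -/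
theorem integral_add_mul_I_eq {h : ℂ → ℂ} {s : ℝ}
    (hd : ∀ z : ℂ, z.im ∈ uIcc 0 s → DifferentiableAt ℂ h z) {C δ : ℝ} (hδ : 0 < δ)
    (hb : ∀ z : ℂ, z.im ∈ uIcc 0 s → ‖h z‖ ≤ C * Real.exp (-(δ * |z.re|))) :
    Integrable (fun t : ℝ => h (t + s * I)) ∧ Integrable (fun t : ℝ => h t) ∧
      ∫ t : ℝ, h (t + s * I) = ∫ t : ℝ, h t := by
  have hint : ∀ y ∈ uIcc 0 s, Integrable (fun t : ℝ => h (t + y * I)) := fun y hy => by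
    have hc : Continuous (fun t : ℝ => h (t + y * I)) := continuous_iff_continuousAt.2 fun t =>
      ContinuousAt.comp (f := fun t : ℝ => (t + y * I : ℂ))
        (hd (t + y * I) (by simpa using hy)).continuousAt (by fun_prop)
    refine ((integrable_exp_neg_mul_abs hδ).const_mul C).mono' hc.aestronglyMeasurable
      (Eventually.of_forall fun t => ?_)
    simpa using hb (t + y * I) (by simpa using hy)
  have h0 : Integrable (fun t : ℝ => h t) := by simpa using hint 0 left_mem_uIcc
  have hs := hint s right_mem_uIcc
  refine ⟨hs, h0, ?_⟩
  -- Cauchy's theorem on the rectangle with horizontal sides [-T, T] at heights 0 and s; the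
  -- vertical sides vanish as T → ∞.
  have hrect : ∀ T : ℝ, (∫ x : ℝ in (-T)..T, h x) - (∫ x : ℝ in (-T)..T, h (x + s * I)) +
      I • (∫ y : ℝ in (0 : ℝ)..s, h (T + y * I)) -
      I • (∫ y : ℝ in (0 : ℝ)..s, h ((-T : ℝ) + y * I)) = 0 := fun T => by
    have := integral_boundary_rect_eq_zero_of_differentiableOn h ((-T : ℝ) : ℂ) (T + s * I)
      fun z hz => (hd z (by simpa using hz.2)).differentiableWithinAt
    simpa using this
  have hside : ∀ σ : ℝ, |σ| = 1 →
      Tendsto (fun T : ℝ => ∫ y : ℝ in (0 : ℝ)..s, h ((σ * T : ℝ) + y * I)) atTop (𝓝 0) :=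
    fun σ hσ => by
    have hlim : Tendsto (fun T : ℝ => C * Real.exp (-(δ * |T|)) * |s - 0|) atTop (𝓝 0) := by
      have h1 : Tendsto (fun T : ℝ => Real.exp (-(δ * |T|))) atTop (𝓝 0) :=
        Real.tendsto_exp_neg_atTop_nhds_zero.comp
          (tendsto_abs_atTop_atTop.const_mul_atTop hδ)
      simpa using (h1.const_mul C).mul_const |s - 0|
    refine squeeze_zero_norm (fun T => ?_) hlim
    refine intervalIntegral.norm_integral_le_of_norm_le_const fun y hy => ?_
    have := hb ((σ * T : ℝ) + y * I) (by simpa using uIoc_subset_uIcc hy)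
    simpa [abs_mul, hσ] using this
  have l1 := intervalIntegral_tendsto_integral h0 tendsto_neg_atTop_atBot tendsto_id
  have l2 := intervalIntegral_tendsto_integral hs tendsto_neg_atTop_atBot tendsto_id
  have l3 := (hside 1 (by simp)).const_smul I
  have l4 := (hside (-1) (by simp)).const_smul I
  simp only [one_mul, neg_one_mul] at l3 l4
  have l := ((l1.sub l2).add l3).sub l4
  simp only [id_eq, hrect, smul_zero, add_zero, sub_zero] at l
  exact (sub_eq_zero.1 (tendsto_nhds_unique tendsto_const_nhds l).symm).symm

/-- The constant in `norm_Gamma_le` depends continuously on Re s, hence is bounded on a compact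
interval. -/
theorem exists_norm_Gamma_le {a θ : ℝ} (ha : 0 < a) (h0 : 0 ≤ θ) (hθ : θ < Real.pi / 2) :
    ∃ C : ℝ, ∀ s : ℂ, s.re ∈ Icc a (a + 1) →
      ‖Gamma s‖ ≤ C * Real.exp (-(θ * |s.im|)) := by
  have hcos : 0 < Real.cos θ := Real.cos_pos_of_mem_Ioo ⟨by linarith [Real.pi_pos], hθ⟩
  have hc : ContinuousOn (fun x : ℝ => Real.Gamma x * Real.cos θ ^ (-x)) (Icc a (a + 1)) := by
    refine ContinuousOn.mul (fun x hx => ?_) ?_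
    · refine (Real.differentiableAt_Gamma fun m hm => ?_).continuousAt.continuousWithinAt
      have := hx.1
      have : (0 : ℝ) ≤ m := m.cast_nonneg
      linarith
    · exact (Continuous.rpow continuous_const (by fun_prop)
        fun _ => Or.inl hcos.ne').continuousOn
  obtain ⟨C, hC⟩ := isCompact_Icc.exists_bound_of_continuousOn hc
  refine ⟨C, fun s hs => (norm_Gamma_le h0 hθ (ha.trans_le hs.1)).trans ?_⟩
  exact mul_le_mul_of_nonneg_right ((le_abs_self _).trans (hC _ hs)) (Real.exp_pos _).le

theorem decayBound_le {α ε : ℝ} (hα : 0 < α) (hε : 0 < ε) (x : ℝ) :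
    decayBound α ε x ≤ Real.exp (Real.pi * (|x| - x) / 2) := by
  unfold decayBound
  refine mul_le_of_le_one_left (Real.exp_pos _).le ?_
  exact Real.rpow_le_one_of_one_le_of_nonpos (by linarith [abs_nonneg x]) (by linarith)

theorem nonneg_of_le_decayBound {α ε C : ℝ} {f : ℂ → ℂ}
    (h : ∀ z : ℂ, |z.im| ≤ 1 → ‖f z‖ ≤ C * decayBound α ε z.re) : 0 ≤ C := by
  have h1 := (norm_nonneg _).trans (h 0 (by simp))
  simpa [decayBound] using h1

/-- The integrand of the contour shift for the difference operator. -/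
noncomputable def shiftIntegrand (α a b : ℝ) (f : ℂ → ℂ) (P z : ℂ) : ℂ :=
  f z * (Gamma (a + I * z) * Gamma (b - I * z)) *
    (exp (Real.pi / 2 * z) * P ^ (-(α / 2 - I * z)))

/-- The conditions on `a` and `b` keep the real parts of both Gamma arguments in [α/2, α/2 + 1]
along the shift, away from the poles. The two Gamma factors outweigh the growth of `f`, of the
exponential and of the power of `P`. -/
theorem integral_shiftIntegrand {α : ℝ} (hα : 0 < α) {f : ℂ → ℂ} (hf : f ∈ stripSpace α) {P : ℂ}
    (hP : 0 < P.re) {a b s : ℝ} (hs : |s| ≤ 1)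
    (ha : ∀ y ∈ uIcc 0 s, a - y ∈ Icc (α / 2) (α / 2 + 1))
    (hb : ∀ y ∈ uIcc 0 s, b + y ∈ Icc (α / 2) (α / 2 + 1)) :
    Integrable (fun t : ℝ => shiftIntegrand α a b f P (t + s * I)) ∧
      Integrable (fun t : ℝ => shiftIntegrand α a b f P t) ∧
      ∫ t : ℝ, shiftIntegrand α a b f P (t + s * I) = ∫ t : ℝ, shiftIntegrand α a b f P t := by
  obtain ⟨⟨δ, hδ, hfd⟩, ε, hε, C, hfC⟩ := hf
  have hα2 := half_pos hα
  have hP0 := ne_zero_of_re_pos hP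
  have harg := abs_arg_lt hP
  have harg0 := abs_nonneg (arg P)
  have hpi := Real.pi_pos
  have hsy : ∀ y ∈ uIcc 0 s, |y| ≤ 1 := fun y hy => by
    have := abs_sub_left_of_mem_uIcc hy
    simp only [sub_zero] at this
    exact this.trans hs
  -- The growth to beat is e^{(π/2 + |arg P|)|x|} against e^{-2θ|x|}, so θ must exceed (π/2 + |arg
  -- P|)/2 and stay below π/2; this is the midpoint.
  set θ := (3 * Real.pi / 2 + |arg P|) / 4 with hθ
  obtain ⟨K, hK⟩ := exists_norm_Gamma_le (θ := θ) hα2 (by positivity) (by linarith)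
  have hcP : ContinuousOn (fun y : ℝ => ‖P‖ ^ (-(α / 2 + y))) (Icc (-1) 1) :=
    (Continuous.rpow continuous_const (by fun_prop)
      fun _ => Or.inl (norm_pos_iff.2 hP0).ne').continuousOn
  obtain ⟨M, hM⟩ := isCompact_Icc.exists_bound_of_continuousOn hcP
  refine integral_add_mul_I_eq (δ := (Real.pi / 2 - |arg P|) / 2) (C := C * (K * K) * M)
    (fun z hz => ?_) (by linarith) (fun z hz => ?_)
  · have h1 := hsy _ hz
    have hopen : IsOpen {z : ℂ | |z.im| < 1 + δ} := isOpen_lt (by fun_prop) continuous_const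
    have d1 : DifferentiableAt ℂ f z := hfd.differentiableAt (hopen.mem_nhds (by
      change |z.im| < 1 + δ; linarith))
    have d2 : DifferentiableAt ℂ (fun z => Gamma (a + I * z)) z := by
      refine DifferentiableAt.comp z (g := Gamma) (differentiableAt_Gamma _ fun m hm => ?_)
        (by fun_prop)
      have h2 := congrArg re hm
      simp at h2
      have := (ha _ hz).1
      have : (0 : ℝ) ≤ m := m.cast_nonneg
      linarith
    have d3 : DifferentiableAt ℂ (fun z => Gamma (b - I * z)) z := by
      refine DifferentiableAt.comp z (g := Gamma) (differentiableAt_Gamma _ fun m hm => ?_)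
        (by fun_prop)
      have h2 := congrArg re hm
      simp at h2
      have := (hb _ hz).1
      have : (0 : ℝ) ≤ m := m.cast_nonneg
      linarith
    have d4 : DifferentiableAt ℂ (fun z => P ^ (-(α / 2 - I * z))) z :=
      DifferentiableAt.const_cpow (by fun_prop) (Or.inl hP0)
    unfold shiftIntegrand
    fun_prop
  · have h1 := hsy _ hz
    have n1 := (hfC z h1).trans (mul_le_mul_of_nonneg_left (decayBound_le hα hε z.re)
      (nonneg_of_le_decayBound hfC))
    have n2 := hK (a + I * z) (by simpa [sub_eq_add_neg] using ha _ hz)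
    have n3 := hK (b - I * z) (by simpa using hb _ hz)
    have n4 := norm_cpow_neg_le hP0 (α / 2 - I * z)
    have n5 := (le_abs_self _).trans (hM z.im (abs_le.1 h1))
    have e1 : (α / 2 - I * z).re = α / 2 + z.im := by simp
    have e2 : |(α / 2 - I * z).im| = |z.re| := by simp
    have e3 : |(a + I * z).im| = |z.re| := by simp
    have e4 : |(b - I * z).im| = |z.re| := by simp
    rw [e1, e2] at n4
    rw [e3] at n2
    rw [e4] at n3
    have n6 : ‖exp (Real.pi / 2 * z)‖ = Real.exp (Real.pi / 2 * z.re) := by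
      rw [norm_exp]; simp
    have hC := nonneg_of_le_decayBound hfC
    have hK0 : 0 ≤ K := by
      have := (norm_nonneg _).trans n2
      exact nonneg_of_mul_nonneg_left this (Real.exp_pos _)
    have hM0 : 0 ≤ M := (by positivity : 0 ≤ ‖P‖ ^ (-(α / 2 + z.im))).trans n5
    rw [shiftIntegrand, norm_mul, norm_mul, norm_mul, norm_mul, n6]
    calc _ ≤ (C * Real.exp (Real.pi * (|z.re| - z.re) / 2)) *
          ((K * Real.exp (-(θ * |z.re|))) * (K * Real.exp (-(θ * |z.re|)))) *
          (Real.exp (Real.pi / 2 * z.re) * (M * Real.exp (|arg P| * |z.re|))) := by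
          gcongr
          exact n4.trans (by gcongr)
      _ = C * (K * K) * M * (Real.exp (Real.pi * (|z.re| - z.re) / 2) *
          Real.exp (-(θ * |z.re|)) * Real.exp (-(θ * |z.re|)) * Real.exp (Real.pi / 2 * z.re) *
          Real.exp (|arg P| * |z.re|)) := by ring
      _ = _ := by
          simp only [← Real.exp_add]
          congr 2
          rw [hθ]
          ring

end Vilenkin

/-! ### Growth of the weight and square integrability on the strip space -/

namespace Vilenkin

open Complex Set Filter Topology
open scoped ComplexConjugate

theorem continuous_of_mem_stripSpace {α : ℝ} {f : ℂ → ℂ} (hf : f ∈ stripSpace α) {y : ℝ}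
    (hy : |y| ≤ 1) : Continuous fun t : ℝ => f (t + y * I) := by
  obtain ⟨⟨δ, hδ, hfd⟩, -⟩ := hf
  have hopen : IsOpen {z : ℂ | |z.im| < 1 + δ} := isOpen_lt (by fun_prop) continuous_const
  refine continuous_iff_continuousAt.2 fun t =>
    ContinuousAt.comp (f := fun t : ℝ => (t + y * I : ℂ)) ?_ (by fun_prop)
  refine hfd.continuousOn.continuousAt (hopen.mem_nhds ?_)
  change |(t + y * I : ℂ).im| < 1 + δ
  simp
  linarith

theorem continuous_diffExpr {α : ℝ} (φ : ℝ) {f : ℂ → ℂ} (hf : f ∈ stripSpace α) :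
    Continuous fun t : ℝ => diffExpr α φ f t := by
  have h0 := continuous_of_mem_stripSpace hf (y := 0) (by simp)
  have h1 := continuous_of_mem_stripSpace hf (y := 1) (by simp)
  have h2 := continuous_of_mem_stripSpace hf (y := -1) (by simp)
  simp only [ofReal_zero, zero_mul, add_zero, ofReal_one, one_mul, ofReal_neg, neg_mul,
    ← sub_eq_add_neg] at h0 h1 h2
  unfold diffExpr
  exact (((by fun_prop : Continuous fun t : ℝ => I * (α / 2 + I * t : ℂ)).mul h2).add
    ((by fun_prop : Continuous fun t : ℝ => 2 * (Real.cosh φ : ℂ) * t).mul h0)).sub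
    ((by fun_prop : Continuous fun t : ℝ => I * (α / 2 - I * t : ℂ)).mul h1)

/-- For the unimodular p = e^{i(π-l)/2} one has |e_p(t)|² proportional, in fact equal, to e^{-lt}.
The integral is thus ‖e_p‖² = Γ(α)(2 Re p)^{-α}, with Re p = sin(l/2). -/
theorem integral_exp_neg_mul_weight {α : ℝ} (hα : 0 < α) {l : ℝ} (h0 : 0 < l)
    (h1 : l < Real.pi) :
    Integrable (fun t => weight α t * Real.exp (-(l * t))) ∧
      ∫ t, weight α t * Real.exp (-(l * t)) =
        Real.Gamma α * (2 * Real.sin (l / 2)) ^ (-α) := by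
  set p : ℂ := exp ((Real.pi - l) / 2 * I) with hp
  have hpi := Real.pi_pos
  have hpe : p = exp (((Real.pi - l) / 2 : ℝ) * I) := by rw [hp]; push_cast; rfl
  have hre : p.re = Real.sin (l / 2) := by
    rw [hpe, exp_ofReal_mul_I_re, ← Real.cos_pi_div_two_sub]
    ring_nf
  have hsin : 0 < Real.sin (l / 2) := Real.sin_pos_of_pos_of_lt_pi (by linarith) (by linarith)
  have hp0 : 0 < p.re := hre ▸ hsin
  have e : ∀ t : ℝ, (weight α t : ℂ) * (expVec α p t * conj (expVec α p t)) =
      ((weight α t * Real.exp (-(l * t)) : ℝ) : ℂ) := fun t => by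
    rw [mul_conj, normSq_eq_norm_sq, expVec, norm_mul, norm_exp, hpe,
      exp_cpow (by simp; linarith) (by simp; linarith), norm_exp, ← Real.exp_add,
      ← Real.exp_nat_mul, ← ofReal_mul]
    congr 3
    simp
    ring
  have h2 := (integrable_weightMeasure_iff hα).1 (integrable_expVec_mul_conj hα hp0 hp0)
  have h3 := integral_expVec_mul_conj hα hp0 hp0
  rw [integral_weightMeasure hα] at h3
  simp only [e] at h2 h3
  refine ⟨h2.re, ?_⟩
  rw [integral_complex_ofReal, add_conj, hre, gammaPow, Gamma_ofReal, ← ofReal_neg,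
    ← ofReal_cpow (by positivity), ← ofReal_mul, ofReal_inj] at h3
  exact h3

/-- The weight is integrable at `+∞` against powers decaying faster than `t^{-α}`. -/
theorem integrableOn_rpow_mul_weight {α β : ℝ} (hα : 0 < α) (hβ : α < β) :
    IntegrableOn (fun t => (1 + t) ^ (-β) * weight α t) (Ioi 0) := by
  have hβ0 : 0 < β := hα.trans hβ
  have hpi := Real.pi_gt_three
  set μ : Measure ℝ := volume.restrict (Ioi 0) with hμ
  -- Since Γ(β)(1+t)^{-β} = ∫ l^{β-1} e^{-(1+t)l} dl, integrability reduces by Tonelli to that of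
  -- l^{β-1} e^{-l} J(l). Near 0 the exact formula gives J(l) = O(l^{-α}), and β > α suffices.
  set J : ℝ → ℝ := fun l => ∫ t in Ioi 0, weight α t * Real.exp (-(l * t)) with hJ
  set K : ℝ := Real.Gamma α * (2 / Real.pi) ^ (-α) with hK
  have hG := Real.Gamma_pos_of_pos hα
  have hK0 : 0 < K := by positivity
  have hsmall : ∀ l, 0 < l → l ≤ 1 → J l ≤ K * l ^ (-α) := fun l h0 h1 => by
    obtain ⟨i1, i2⟩ := integral_exp_neg_mul_weight hα h0 (by linarith)
    have h3 : J l ≤ ∫ t, weight α t * Real.exp (-(l * t)) :=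
      setIntegral_le_integral i1 (Eventually.of_forall fun t =>
        mul_nonneg (weight_pos hα t).le (Real.exp_pos _).le)
    refine h3.trans ?_
    rw [i2, hK, mul_assoc, ← Real.mul_rpow (by positivity) h0.le]
    refine mul_le_mul_of_nonneg_left ?_ hG.le
    refine Real.rpow_le_rpow_of_nonpos (by positivity) ?_ (by linarith)
    have := Real.mul_le_sin (x := l / 2) (by linarith) (by linarith)
    linarith [this, show 2 / Real.pi * l = 2 * (2 / Real.pi * (l / 2)) by ring]
  have hi : ∀ l, 0 < l → IntegrableOn (fun t => weight α t * Real.exp (-(l * t))) (Ioi 0) :=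
    fun l h0 => by
    -- The exact formula needs l < π; on t > 0 larger values of `l` only make the integrand smaller.
    have h1 := (integral_exp_neg_mul_weight hα (l := min l 1) (by positivity)
      (by linarith [min_le_right l 1])).1.integrableOn (s := Ioi 0)
    refine h1.mono' ((continuous_weight hα).mul (by fun_prop)).aestronglyMeasurable ?_
    filter_upwards [ae_restrict_mem measurableSet_Ioi] with t ht
    have ht0 : 0 < t := ht
    rw [Real.norm_of_nonneg (mul_nonneg (weight_pos hα t).le (Real.exp_pos _).le)]
    refine mul_le_mul_of_nonneg_left ?_ (weight_pos hα t).le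
    gcongr
    exact min_le_left l 1
  have hlarge : ∀ l, 0 < l → J l ≤ K * (l ^ (-α) + 1) := fun l h0 => by
    rcases le_total l 1 with h1 | h1
    · exact (hsmall l h0 h1).trans (by nlinarith)
    · have h2 : J l ≤ J 1 := by
        refine setIntegral_mono_on (hi l h0) (hi 1 one_pos) measurableSet_Ioi fun t ht => ?_
        have ht0 : 0 < t := ht
        refine mul_le_mul_of_nonneg_left ?_ (weight_pos hα t).le
        gcongr
      have h3 := hsmall 1 one_pos le_rfl
      rw [Real.one_rpow] at h3
      have : 0 ≤ l ^ (-α) := by positivity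
      nlinarith
  have hprod : Integrable (fun z : ℝ × ℝ =>
      z.2 ^ (β - 1) * Real.exp (-((1 + z.1) * z.2)) * weight α z.1) (μ.prod μ) := by
    have hw := (continuous_weight hα).measurable
    have hm : Measurable (fun z : ℝ × ℝ =>
      z.2 ^ (β - 1) * Real.exp (-((1 + z.1) * z.2)) * weight α z.1) := by fun_prop
    have e : ∀ l t : ℝ, l ^ (β - 1) * Real.exp (-((1 + t) * l)) * weight α t =
        l ^ (β - 1) * Real.exp (-l) * (weight α t * Real.exp (-(l * t))) := fun l t => by
      rw [show -((1 + t) * l) = -l + -(l * t) by ring, Real.exp_add]; ring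
    rw [integrable_prod_iff' hm.aestronglyMeasurable]
    constructor
    · filter_upwards [ae_restrict_mem measurableSet_Ioi] with l hl
      simp only [e]
      exact (hi l hl).const_mul _
    · have hb : IntegrableOn (fun l : ℝ => K * (l ^ ((β - α) - 1) * Real.exp (-(1 * l)) +
          l ^ (β - 1) * Real.exp (-(1 * l)))) (Ioi 0) :=
        ((integrableOn_rpow_mul_exp_neg (by linarith) one_pos).add
          (integrableOn_rpow_mul_exp_neg hβ0 one_pos)).const_mul K
      refine hb.mono' (hm.norm.stronglyMeasurable.integral_prod_left'.aestronglyMeasurable) ?_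
      filter_upwards [ae_restrict_mem measurableSet_Ioi] with l hl
      have hl0 : 0 < l := hl
      have hnn : ∀ t, 0 ≤ l ^ (β - 1) * Real.exp (-l) * (weight α t * Real.exp (-(l * t))) :=
        fun t => mul_nonneg (by positivity) (mul_nonneg (weight_pos hα t).le (Real.exp_pos _).le)
      simp only [e, Real.norm_of_nonneg (hnn _)]
      rw [integral_const_mul, Real.norm_of_nonneg]
      · calc _ ≤ l ^ (β - 1) * Real.exp (-l) * (K * (l ^ (-α) + 1)) := by
              gcongr
              exact hlarge l hl0
          _ = _ := by
              rw [show β - α - 1 = (β - 1) + (-α) by ring, Real.rpow_add hl0, one_mul]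
              ring
      · exact mul_nonneg (by positivity) (integral_nonneg fun t =>
          mul_nonneg (weight_pos hα t).le (Real.exp_pos _).le)
  have h := hprod.integral_prod_left.const_mul (Real.Gamma β)⁻¹
  refine h.congr ?_
  filter_upwards [ae_restrict_mem measurableSet_Ioi] with t ht
  have ht0 : 0 < t := ht
  have hGβ := Real.Gamma_pos_of_pos hβ0
  rw [hμ, integral_mul_const, Real.integral_rpow_mul_exp_neg_mul_Ioi hβ0 (by linarith), one_div,
    Real.inv_rpow (by linarith), ← Real.rpow_neg (by linarith)]
  field_simp

theorem weight_neg (α t : ℝ) : weight α (-t) = Real.exp (-(2 * Real.pi * t)) * weight α t := by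
  have h : ‖Gamma (α / 2 + I * ((-t : ℝ) : ℂ))‖ = ‖Gamma (α / 2 + I * t)‖ := by
    rw [← RCLike.norm_conj, ← Gamma_conj]
    congr 2
    simp [map_div₀, map_ofNat]
  rw [weight, weight, h, show Real.pi * -t = -(2 * Real.pi * t) + Real.pi * t by ring,
    Real.exp_add]
  ring

/-- The weight is even up to e^{πt}, so the exponential factor of the decay condition, squared,
exactly compensates its asymmetry and reduces estimates to the positive half-line. -/
theorem exp_mul_weight (α t : ℝ) :
    Real.exp (Real.pi * (|t| - t)) * weight α t = weight α |t| := by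
  rcases le_total 0 t with h | h
  · simp [abs_of_nonneg h]
  · rw [abs_of_nonpos h, weight_neg]
    congr 2
    ring

theorem memLp_of_norm_le {α β : ℝ} (hα : 0 < α) (hβ : α < β) {F : ℝ → ℂ} (hF : Continuous F)
    {C : ℝ} (h : ∀ t, ‖F t‖ ≤ C * ((1 + |t|) ^ (-(β / 2)) *
      Real.exp (Real.pi * (|t| - t) / 2))) :
    MemLp F 2 (weightMeasure α) := by
  rw [memLp_two_iff_integrable_sq_norm hF.aestronglyMeasurable, weightMeasure,
    integrable_withDensity_iff_integrable_smul' (measurable_weight hα).ennreal_ofReal (by simp)]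
  have h1 := (integrable_comp_abs (integrableOn_rpow_mul_weight hα hβ)).const_mul (C ^ 2)
  refine h1.mono' ?_ (Eventually.of_forall fun t => ?_)
  · have hw := continuous_weight hα
    simp only [ENNReal.toReal_ofReal (weight_pos hα _).le, smul_eq_mul]
    exact (hw.mul (hF.norm.pow 2)).aestronglyMeasurable
  · have hw := weight_pos hα t
    rw [ENNReal.toReal_ofReal hw.le, smul_eq_mul, Real.norm_of_nonneg (by positivity)]
    calc weight α t * ‖F t‖ ^ 2 ≤ weight α t * (C * ((1 + |t|) ^ (-(β / 2)) *
          Real.exp (Real.pi * (|t| - t) / 2))) ^ 2 := by gcongr; exact h t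
      _ = C ^ 2 * (((1 + |t|) ^ (-(β / 2))) ^ 2 *
          ((Real.exp (Real.pi * (|t| - t) / 2)) ^ 2 * weight α t)) := by ring
      _ = _ := by
          rw [← Real.rpow_mul_natCast (by positivity), ← Real.exp_nat_mul]
          rw [show ((2 : ℕ) : ℝ) * (Real.pi * (|t| - t) / 2) = Real.pi * (|t| - t) by
            push_cast; ring, exp_mul_weight]
          congr 3
          push_cast
          ring

/-- The coefficients of 𝓛 grow linearly, which uses up the extra power 1 in the decay condition; the
exponent left over squares to α + 2ε > α. -/
theorem memLp_of_mem_stripSpace {α : ℝ} (hα : 0 < α) (φ : ℝ) {f : ℂ → ℂ}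
    (hf : f ∈ stripSpace α) :
    MemLp (fun t : ℝ => f t) 2 (weightMeasure α) ∧
      MemLp (fun t : ℝ => diffExpr α φ f t) 2 (weightMeasure α) := by
  have hc0 := continuous_of_mem_stripSpace hf (y := 0) (by simp)
  simp only [ofReal_zero, zero_mul, add_zero] at hc0
  have hc1 := continuous_diffExpr φ hf
  obtain ⟨-, ε, hε, C, hC⟩ := hf
  have hC0 := nonneg_of_le_decayBound hC
  have hcosh := Real.cosh_pos φ
  have hdb : ∀ t, (1 + |t|) * decayBound α ε t = (1 + |t|) ^ (-((α + 2 * ε) / 2)) *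
      Real.exp (Real.pi * (|t| - t) / 2) := fun t => by
    rw [decayBound, show -((α + 2 * ε) / 2) = -(α / 2 + 1 + ε) + 1 by ring,
      Real.rpow_add_one (by positivity)]
    ring
  have hdb0 : ∀ t, 0 ≤ decayBound α ε t := fun t => by unfold decayBound; positivity
  constructor
  · refine memLp_of_norm_le hα (β := α + 2 * ε) (by linarith) hc0 (C := C) fun t => ?_
    rw [← hdb]
    refine (hC t (by simp)).trans (mul_le_mul_of_nonneg_left ?_ hC0)
    rw [ofReal_re]
    exact le_mul_of_one_le_left (hdb0 t) (by linarith [abs_nonneg t])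
  · refine memLp_of_norm_le hα (β := α + 2 * ε) (by linarith) hc1
      (C := (α + 2 + 2 * Real.cosh φ) * C) fun t => ?_
    rw [← hdb]
    have b0 := hC t (by simp)
    have b1 := hC (t - I) (by simp)
    have b2 := hC (t + I) (by simp)
    simp only [sub_re, add_re, ofReal_re, I_re, sub_zero, add_zero] at b0 b1 b2
    have ht := abs_nonneg t
    have n1 : ‖(α / 2 + I * t : ℂ)‖ ≤ α / 2 + |t| := by
      refine (norm_add_le _ _).trans ?_
      simp [abs_of_pos hα]
    have n2 : ‖(α / 2 - I * t : ℂ)‖ ≤ α / 2 + |t| := by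
      refine (norm_sub_le _ _).trans ?_
      simp [abs_of_pos hα]
    calc ‖diffExpr α φ f t‖ ≤ ‖(α / 2 + I * t : ℂ)‖ * ‖f (t - I)‖ +
          2 * Real.cosh φ * |t| * ‖f t‖ + ‖(α / 2 - I * t : ℂ)‖ * ‖f (t + I)‖ := by
          rw [diffExpr]
          refine (norm_sub_le _ _).trans (add_le_add ((norm_add_le _ _).trans
            (add_le_add ?_ ?_)) ?_)
          · simp
          · simp only [norm_mul, norm_real, Real.norm_eq_abs, abs_of_pos hcosh]
            simp
          · simp
      _ ≤ (α / 2 + |t|) * (C * decayBound α ε t) + 2 * Real.cosh φ * |t| *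
          (C * decayBound α ε t) + (α / 2 + |t|) * (C * decayBound α ε t) := by gcongr
      _ = (α + 2 * |t| + 2 * Real.cosh φ * |t|) * (C * decayBound α ε t) := by ring
      _ ≤ ((α + 2 + 2 * Real.cosh φ) * (1 + |t|)) * (C * decayBound α ε t) := by
          refine mul_le_mul_of_nonneg_right ?_ (mul_nonneg hC0 (hdb0 t))
          nlinarith [mul_nonneg hα.le ht]
      _ = _ := by ring

end Vilenkin

/-! ### The difference operator paired with exponential vectors -/

namespace Vilenkin

open Complex Set Filter Topology
open scoped ComplexConjugate

theorem exists_exp_neg_le_rpow {c k : ℝ} (hc : 0 < c) (hk : 0 < k) :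
    ∃ C, 0 ≤ C ∧ ∀ x : ℝ, 0 ≤ x → Real.exp (-(c * x)) ≤ C * (1 + x) ^ (-k) := by
  -- The constant comes from log y ≤ y - 1 at y = (c/k)(1 + x).
  refine ⟨Real.exp (c - k * Real.log (c / k)), (Real.exp_pos _).le, fun x hx => ?_⟩
  have h1 : (0 : ℝ) < 1 + x := by linarith
  have h2 := Real.log_le_sub_one_of_pos (mul_pos (div_pos hc hk) h1)
  rw [Real.log_mul (div_pos hc hk).ne' h1.ne'] at h2
  rw [Real.rpow_def_of_pos h1, ← Real.exp_add, Real.exp_le_exp]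
  have h3 : k * (Real.log (c / k) + Real.log (1 + x)) ≤ k * (c / k * (1 + x) - 1) := by gcongr
  have h4 : k * (c / k * (1 + x) - 1) = c * (1 + x) - k := by field_simp
  linarith

/-- As |arg p| < π/2, there is a spare factor e^{-(π/2 - |arg p|)|x|}, which beats any power. -/
theorem expVec_mem_stripSpace {α : ℝ} (hα : 0 < α) {p : ℂ} (hp : 0 < p.re) :
    expVec α p ∈ stripSpace α := by
  have hp0 := ne_zero_of_re_pos hp
  refine ⟨⟨1, one_pos, (differentiable_expVec α hp0).differentiableOn⟩, 1, one_pos, ?_⟩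
  obtain ⟨K, hK0, hK⟩ := exists_exp_neg_le_rpow (c := Real.pi / 2 - |arg p|) (k := α / 2 + 1 + 1)
    (by linarith [abs_arg_lt hp]) (by linarith)
  have hc : ContinuousOn (fun y : ℝ => ‖p‖ ^ (-(α / 2 - y))) (Icc (-1) 1) :=
    (Continuous.rpow continuous_const (by fun_prop)
      fun _ => Or.inl (norm_pos_iff.2 hp0).ne').continuousOn
  obtain ⟨M, hM⟩ := isCompact_Icc.exists_bound_of_continuousOn hc
  refine ⟨M * K, fun z hz => ?_⟩
  have n1 := norm_cpow_neg_le hp0 (α / 2 + I * z)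
  have n2 := (le_abs_self _).trans (hM z.im (abs_le.1 hz))
  have n3 := hK |z.re| (abs_nonneg _)
  have e1 : (α / 2 + I * z).re = α / 2 - z.im := by simp [sub_eq_add_neg]
  have e2 : |(α / 2 + I * z).im| = |z.re| := by simp
  have hM0 : 0 ≤ M := (by positivity : 0 ≤ ‖p‖ ^ (-(α / 2 - z.im))).trans n2
  rw [e1, e2] at n1
  have n4 : ‖exp (-(Real.pi / 2 * z))‖ = Real.exp (-(Real.pi / 2 * z.re)) := by
    rw [norm_exp]; simp
  rw [expVec, norm_mul, n4, decayBound]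
  calc _ ≤ Real.exp (-(Real.pi / 2 * z.re)) * (M * Real.exp (|arg p| * |z.re|)) := by
        gcongr
        exact n1.trans (by gcongr)
    _ = M * Real.exp (-((Real.pi / 2 - |arg p|) * |z.re|)) *
          Real.exp (Real.pi * (|z.re| - z.re) / 2) := by
        rw [mul_left_comm, mul_assoc, ← Real.exp_add, ← Real.exp_add]
        ring_nf
    _ ≤ M * (K * (1 + |z.re|) ^ (-(α / 2 + 1 + 1))) *
          Real.exp (Real.pi * (|z.re| - z.re) / 2) := by gcongr
    _ = _ := by ring

/-! ### Symmetry of the difference operator against exponential vectors -/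

theorem weight_mul_conj_expVec (α : ℝ) {p : ℂ} (hp : 0 < p.re) (t : ℝ) :
    (weight α t : ℂ) * conj (expVec α p t) = (2 * Real.pi : ℂ)⁻¹ *
      (Gamma (α / 2 + I * t) * Gamma (α / 2 - I * t) *
        (exp (Real.pi / 2 * t) * conj p ^ (-(α / 2 - I * t)))) := by
  have he : exp (Real.pi * t) * exp (-(Real.pi / 2 * t)) = exp (Real.pi / 2 * t) := by
    rw [← exp_add]; ring_nf
  rw [ofReal_weight, conj_expVec α hp, ← he]
  ring

/-- On Im z = -1 the extra unit in the Gamma arguments moves from the second to the first, so the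
functional equation yields α/2 + it, the coefficient of f(t - i); on the real line the same
integrand carries α/2 - it instead. -/
theorem shiftIntegrand_sub_I {α : ℝ} (hα : 0 < α) (f : ℂ → ℂ) {P : ℂ} (hP : P ≠ 0) (t : ℝ) :
    shiftIntegrand α (α / 2 : ℝ) (α / 2 + 1 : ℝ) f P (t + (-1 : ℝ) * I) =
      f (t - I) * (α / 2 + I * t) * (Gamma (α / 2 + I * t) * Gamma (α / 2 - I * t) *
        (exp (Real.pi / 2 * t) * P ^ (-(α / 2 - I * t)))) * (-I * P) := by
  have h0 : (α / 2 + I * t : ℂ) ≠ 0 := ne_zero_of_re_pos (by simp [hα])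
  have h1 : exp (Real.pi / 2 * (t + (-1 : ℝ) * I)) = -I * exp (Real.pi / 2 * t) := by
    rw [show (Real.pi / 2 * (t + (-1 : ℝ) * I) : ℂ) = -Real.pi / 2 * I + Real.pi / 2 * t by
      push_cast; ring, exp_add, exp_neg_pi_div_two_mul_I]
  have h2 : P ^ (-(α / 2 - I * (t + (-1 : ℝ) * I))) = P ^ (-(α / 2 - I * t)) * P := by
    rw [show -(α / 2 - I * (t + (-1 : ℝ) * I)) = -(α / 2 - I * t) + 1 by
      push_cast; linear_combination -I_sq, cpow_add _ _ hP, cpow_one]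
  have h3 : ((α / 2 : ℝ) : ℂ) + I * (t + (-1 : ℝ) * I) = α / 2 + I * t + 1 := by
    push_cast; linear_combination -I_sq
  have h4 : ((α / 2 + 1 : ℝ) : ℂ) - I * (t + (-1 : ℝ) * I) = α / 2 - I * t := by
    push_cast; linear_combination I_sq
  rw [shiftIntegrand, h1, h2, h3, h4, Gamma_add_one _ h0,
    show (t + (-1 : ℝ) * I : ℂ) = t - I by push_cast; ring]
  ring

theorem shiftIntegrand_add_I {α : ℝ} (hα : 0 < α) (f : ℂ → ℂ) {P : ℂ} (hP : P ≠ 0) (t : ℝ) :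
    shiftIntegrand α (α / 2 + 1 : ℝ) (α / 2 : ℝ) f P (t + (1 : ℝ) * I) =
      f (t + I) * (α / 2 - I * t) * (Gamma (α / 2 + I * t) * Gamma (α / 2 - I * t) *
        (exp (Real.pi / 2 * t) * P ^ (-(α / 2 - I * t)))) * (I / P) := by
  have h0 : (α / 2 - I * t : ℂ) ≠ 0 := ne_zero_of_re_pos (by simp [hα])
  have h1 : exp (Real.pi / 2 * (t + (1 : ℝ) * I)) = I * exp (Real.pi / 2 * t) := by
    rw [show (Real.pi / 2 * (t + (1 : ℝ) * I) : ℂ) = Real.pi / 2 * I + Real.pi / 2 * t by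
      push_cast; ring, exp_add, exp_pi_div_two_mul_I]
  have h2 : P ^ (-(α / 2 - I * (t + (1 : ℝ) * I))) = P ^ (-(α / 2 - I * t)) / P := by
    rw [show -(α / 2 - I * (t + (1 : ℝ) * I)) = -(α / 2 - I * t) - 1 by
      push_cast; linear_combination I_sq, cpow_sub _ _ hP, cpow_one]
  have h3 : ((α / 2 : ℝ) : ℂ) - I * (t + (1 : ℝ) * I) = α / 2 - I * t + 1 := by
    push_cast; linear_combination -I_sq
  have h4 : ((α / 2 + 1 : ℝ) : ℂ) + I * (t + (1 : ℝ) * I) = α / 2 + I * t := by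
    push_cast; linear_combination I_sq
  rw [shiftIntegrand, h1, h2, h3, h4, Gamma_add_one _ h0,
    show (t + (1 : ℝ) * I : ℂ) = t + I by push_cast; ring]
  ring

/-- Shifting the contour by one unit in each direction replaces f(t ∓ i) by f(t) and passes the
coefficients to the exponential vector; the middle term is real multiplication. Only exponential
vectors are needed on the other side, since they determine the graph of 𝓝. -/
theorem integral_diffExpr_mul_conj_expVec {α : ℝ} (hα : 0 < α) (φ : ℝ) {f : ℂ → ℂ}
    (hf : f ∈ stripSpace α) {p : ℂ} (hp : 0 < p.re) :
    ∫ t : ℝ, diffExpr α φ f t * conj (expVec α p t) ∂weightMeasure α =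
      ∫ t : ℝ, f t * conj (diffExpr α φ (expVec α p) t) ∂weightMeasure α := by
  have hp0 := ne_zero_of_re_pos hp
  have hP : 0 < (conj p).re := by simpa using hp
  have hP0 := ne_zero_of_re_pos hP
  have hpi : (Real.pi : ℂ) ≠ 0 := ofReal_ne_zero.2 Real.pi_ne_zero
  obtain ⟨h1, h2, h3⟩ := integral_shiftIntegrand (a := α / 2) (b := α / 2 + 1) (s := -1) hα hf hP
    (by simp) (fun y hy => by rw [uIcc_of_ge (by simp)] at hy; constructor <;> linarith [hy.1, hy.2])
    (fun y hy => by rw [uIcc_of_ge (by simp)] at hy; constructor <;> linarith [hy.1, hy.2])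
  obtain ⟨k1, k2, k3⟩ := integral_shiftIntegrand (a := α / 2 + 1) (b := α / 2) (s := 1) hα hf hP
    (by simp) (fun y hy => by rw [uIcc_of_le (by simp)] at hy; constructor <;> linarith [hy.1, hy.2])
    (fun y hy => by rw [uIcc_of_le (by simp)] at hy; constructor <;> linarith [hy.1, hy.2])
  set H : ℂ → ℂ := shiftIntegrand α (α / 2 : ℝ) (α / 2 + 1 : ℝ) f (conj p) with hH
  set K : ℂ → ℂ := shiftIntegrand α (α / 2 + 1 : ℝ) (α / 2 : ℝ) f (conj p) with hK
  have hM := (memLp_of_mem_stripSpace hα φ hf).1.integrable_mul (memLp_mul_expVec hα hp).star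
  have hM' := ((integrable_weightMeasure_iff hα).1 hM).const_mul (2 * Real.cosh φ : ℂ)
  set M : ℝ → ℂ := fun t => (2 * Real.cosh φ : ℂ) * ((weight α t : ℂ) *
    (f t * conj ((t : ℂ) * expVec α p t))) with hMdef
  have hMi : Integrable M := hM'
  have eL : ∀ t : ℝ, (weight α t : ℂ) * (diffExpr α φ f t * conj (expVec α p t)) =
      -(2 * Real.pi * conj p)⁻¹ * H (t + (-1 : ℝ) * I) + M t +
        -(conj p / (2 * Real.pi)) * K (t + (1 : ℝ) * I) := fun t => by
    rw [hH, hK, shiftIntegrand_sub_I hα f hP0, shiftIntegrand_add_I hα f hP0, hMdef]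
    simp only [map_mul, conj_ofReal]
    rw [show (weight α t : ℂ) * (f t * (t * conj (expVec α p t))) =
      f t * t * ((weight α t : ℂ) * conj (expVec α p t)) by ring,
      show (weight α t : ℂ) * (diffExpr α φ f t * conj (expVec α p t)) =
      diffExpr α φ f t * ((weight α t : ℂ) * conj (expVec α p t)) by ring,
      weight_mul_conj_expVec α hp, diffExpr]
    field_simp
    ring
  have eR : ∀ t : ℝ, (weight α t : ℂ) * (f t * conj (diffExpr α φ (expVec α p) t)) =
      -(2 * Real.pi * conj p)⁻¹ * H t + M t + -(conj p / (2 * Real.pi)) * K t := fun t => by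
    have g1 : (α / 2 - I * t : ℂ) ≠ 0 := ne_zero_of_re_pos (by simp [hα])
    have g2 : (α / 2 + I * t : ℂ) ≠ 0 := ne_zero_of_re_pos (by simp [hα])
    have hc : conj (diffExpr α φ (expVec α p) t) = (2 * Real.cosh φ * t -
        (α / 2 - I * t) / conj p - (α / 2 + I * t) * conj p) * conj (expVec α p t) := by
      rw [diffExpr_expVec α φ hp0]
      simp only [map_mul, map_sub, map_div₀, map_add, conj_ofReal, conj_I, map_ofNat]
      ring
    have e1 : ((α / 2 + 1 : ℝ) : ℂ) - I * t = α / 2 - I * t + 1 := by push_cast; ring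
    have e2 : ((α / 2 + 1 : ℝ) : ℂ) + I * t = α / 2 + I * t + 1 := by push_cast; ring
    have e3 : ((α / 2 : ℝ) : ℂ) = α / 2 := by push_cast; rfl
    rw [hH, hK, shiftIntegrand, shiftIntegrand, hMdef, hc, e1, e2, e3, Gamma_add_one _ g1,
      Gamma_add_one _ g2]
    simp only [map_mul, conj_ofReal]
    rw [show (weight α t : ℂ) * (f t * (t * conj (expVec α p t))) =
      f t * t * ((weight α t : ℂ) * conj (expVec α p t)) by ring,
      show ∀ c : ℂ, (weight α t : ℂ) * (f t * (c * conj (expVec α p t))) =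
      f t * c * ((weight α t : ℂ) * conj (expVec α p t)) by intro c; ring,
      weight_mul_conj_expVec α hp]
    field_simp
    ring
  rw [integral_weightMeasure hα, integral_weightMeasure hα]
  simp only [eL, eR]
  have key : ∀ {a b : ℂ} {u v : ℝ → ℂ}, Integrable u → Integrable v →
      ∫ t, (a * u t + M t + b * v t) = a * (∫ t, u t) + (∫ t, M t) + b * ∫ t, v t :=
    fun {a b u v} hu hv => by
    rw [integral_add (f := fun t => a * u t + M t) ((hu.const_mul a).add hMi) (hv.const_mul b),
      integral_add (hu.const_mul a) hMi, integral_const_mul a u, integral_const_mul b v]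
  rw [key h1 k1, key h2 k2, h3, k3]

/-! ### First moments of the exponential vectors -/

/-- Writing t = -i(α/2 + it) + iα/2 leaves the Gram integral and a Barnes integral with one abscissa
raised by one. -/
theorem integral_mul_expVec_mul_conj {α : ℝ} (hα : 0 < α) {p q : ℂ} (hp : 0 < p.re)
    (hq : 0 < q.re) :
    ∫ t : ℝ, (t : ℂ) * expVec α p t * conj (expVec α q t) ∂weightMeasure α =
      -(I * α / 2) * (p - conj q) / (p + conj q) * gammaPow (p + conj q) α := by
  have hp0 := ne_zero_of_re_pos hp
  have hα2 := half_pos hα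
  have hq' : 0 < (conj q).re := by simpa using hq
  have hpq : 0 < (p + conj q).re := by simp; positivity
  have hpq0 := ne_zero_of_re_pos hpq
  have hα0 : (α : ℂ) ≠ 0 := ofReal_ne_zero.2 hα.ne'
  have hpi : (Real.pi : ℂ) ≠ 0 := ofReal_ne_zero.2 Real.pi_ne_zero
  have e : ∀ t : ℝ, (weight α t : ℂ) * ((t : ℂ) * expVec α p t * conj (expVec α q t)) =
      -(I * p / (2 * Real.pi)) * (gammaPow p ((α / 2 + 1 : ℝ) + I * t) *
        gammaPow (conj q) ((α / 2 : ℝ) - I * t)) + I * α / 2 * ((weight α t : ℂ) *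
        (expVec α p t * conj (expVec α q t))) := fun t => by
    have h0 : ((α / 2 : ℝ) + I * t : ℂ) ≠ 0 := ne_zero_of_re_pos (by simp [hα])
    rw [show ((α / 2 + 1 : ℝ) : ℂ) + I * t = ((α / 2 : ℝ) + I * t) + 1 by push_cast; ring,
      gammaPow_add_one hp0 h0, show (weight α t : ℂ) * ((t : ℂ) * expVec α p t *
      conj (expVec α q t)) = t * ((weight α t : ℂ) * (expVec α p t * conj (expVec α q t))) by ring,
      weight_mul_expVec_mul_conj α p hq]
    generalize gammaPow p _ = g₁
    generalize gammaPow (conj q) _ = g₂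
    push_cast
    field_simp
    linear_combination (2 * t * g₁ * g₂ : ℂ) * I_sq
  have i1 := integrable_gammaPow_mul_gammaPow (a := α / 2) (b := α / 2 + 1) hα2 (by linarith)
    hq' hp
  have i2 := (integrable_weightMeasure_iff hα).1 (integrable_expVec_mul_conj hα hp hq)
  rw [integral_weightMeasure hα]
  simp only [e]
  rw [integral_add (i1.const_mul _) (i2.const_mul _), integral_const_mul, integral_const_mul,
    ← integral_weightMeasure hα, integral_expVec_mul_conj hα hp hq,
    integral_gammaPow_mul_gammaPow hα2 (by linarith) hq' hp, add_comm (conj q) p,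
    show ((α / 2 : ℝ) + (α / 2 + 1 : ℝ) : ℂ) = α + 1 by push_cast; ring,
    gammaPow_add_one hpq0 hα0]
  field_simp
  ring

end Vilenkin

/-! ### Intertwining of the two operators on exponential vectors -/

namespace Vilenkin

open Complex Set Filter Topology
open scoped ComplexConjugate

theorem integral_diffExpr_expVec_mul_conj {α : ℝ} (hα : 0 < α) (φ : ℝ) {a b : ℂ} (ha : 0 < a.re)
    (hb : 0 < b.re) :
    ∫ t : ℝ, diffExpr α φ (expVec α a) t * conj (expVec α b t) ∂weightMeasure α =
      α * (-I * Real.cosh φ * (a - conj b) - 1 - a * conj b) / (a + conj b) *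
        gammaPow (a + conj b) α := by
  have ha0 := ne_zero_of_re_pos ha
  have hab : a + conj b ≠ 0 := ne_zero_of_re_pos (by simp; positivity)
  have e : ∀ t : ℝ, diffExpr α φ (expVec α a) t * conj (expVec α b t) =
      (2 * Real.cosh φ - I / a + I * a) * ((t : ℂ) * expVec α a t * conj (expVec α b t)) +
        -(α / 2 * (1 / a + a)) * (expVec α a t * conj (expVec α b t)) := fun t => by
    rw [diffExpr_expVec α φ ha0]
    field_simp
    ring
  have i1 := integrable_mul_conj_expVec hα hb (memLp_mul_expVec hα ha)
  have i2 := integrable_expVec_mul_conj hα ha hb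
  simp only [e]
  rw [integral_add (i1.const_mul _) (i2.const_mul _), integral_const_mul, integral_const_mul,
    integral_mul_expVec_mul_conj hα ha hb, integral_expVec_mul_conj hα ha hb]
  field_simp
  generalize conj b = c
  ring_nf
  simp only [I_sq]
  ring

open Classical in
/-- The function `2 s sinh φ · e_p(s)` as an element of `L²(ℝ, w ds)`. -/
noncomputable def mulExpL (α φ : ℝ) (p : ℂ) : L2w α :=
  if h : MemLp (fun s : ℝ => (2 * s * Real.sinh φ : ℂ) * expVec α p s) 2 (weightMeasure α)
  then h.toLp else 0

theorem coeFn_mulExpL {α : ℝ} (hα : 0 < α) (φ : ℝ) {p : ℂ} (hp : 0 < p.re) :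
    ∀ᵐ s : ℝ ∂weightMeasure α, mulExpL α φ p s = (2 * s * Real.sinh φ : ℂ) * expVec α p s := by
  have h : MemLp (fun s : ℝ => (2 * s * Real.sinh φ : ℂ) * expVec α p s) 2 (weightMeasure α) := by
    refine ((memLp_mul_expVec hα hp).const_mul (2 * Real.sinh φ : ℂ)).ae_eq (.of_forall fun s => ?_)
    simp only
    ring
  rw [mulExpL, dif_pos h]
  exact h.coeFn_toLp

open Classical in
/-- The image of `e_p` under the difference operator as an element of `L²(ℝ, w dt)`. -/
noncomputable def diffExpL (α φ : ℝ) (p : ℂ) : L2w α :=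
  if h : MemLp (fun t : ℝ => diffExpr α φ (expVec α p) t) 2 (weightMeasure α) then h.toLp else 0

theorem coeFn_diffExpL {α : ℝ} (hα : 0 < α) (φ : ℝ) {p : ℂ} (hp : 0 < p.re) :
    ∀ᵐ t : ℝ ∂weightMeasure α, diffExpL α φ p t = diffExpr α φ (expVec α p) t := by
  have h := (memLp_of_mem_stripSpace hα φ (expVec_mem_stripSpace hα hp)).2
  rw [diffExpL, dif_pos h]
  exact h.coeFn_toLp

theorem expL_diffExpL_mem_diffGraph {α : ℝ} (hα : 0 < α) (φ : ℝ) {p : ℂ} (hp : 0 < p.re) :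
    (expL α p, diffExpL α φ p) ∈ diffGraph α φ :=
  ⟨expVec α p, expVec_mem_stripSpace hα hp, coeFn_expL hα hp, coeFn_diffExpL hα φ hp⟩

theorem inner_expL_mulExpL {α : ℝ} (hα : 0 < α) (φ : ℝ) {p q : ℂ} (hp : 0 < p.re)
    (hq : 0 < q.re) :
    inner ℂ (expL α q) (mulExpL α φ p) =
      -(I * α * Real.sinh φ) * (p - conj q) / (p + conj q) * gammaPow (p + conj q) α := by
  have h : ∫ t : ℝ, mulExpL α φ p t * conj (expVec α q t) ∂weightMeasure α =
      2 * Real.sinh φ * ∫ t : ℝ, (t : ℂ) * expVec α p t * conj (expVec α q t) ∂weightMeasure α := by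
    rw [← integral_const_mul]
    refine integral_congr_ae ?_
    filter_upwards [coeFn_mulExpL hα φ hp] with t ht
    rw [ht]
    ring
  rw [inner_expL_left hα hq, h, integral_mul_expVec_mul_conj hα hp hq]
  ring

theorem inner_expL_diffExpL {α : ℝ} (hα : 0 < α) (φ : ℝ) {a b : ℂ} (ha : 0 < a.re)
    (hb : 0 < b.re) :
    inner ℂ (expL α b) (diffExpL α φ a) =
      α * (-I * Real.cosh φ * (a - conj b) - 1 - a * conj b) / (a + conj b) *
        gammaPow (a + conj b) α := by
  rw [inner_expL_left hα hb, ← integral_diffExpr_expVec_mul_conj hα φ ha hb]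
  refine integral_congr_ae ?_
  filter_upwards [coeFn_diffExpL hα φ ha] with t ht
  rw [ht]

/-- The matrix elements of 𝓝 at (p, q) and of 𝓛 at (m(p), m(q)), each divided by α times its Gram
kernel. After the covariance identity this is a rational identity modulo e^φ e^{-φ} = 1. -/
theorem sinh_mul_div_eq {φ : ℝ} (hφ : 0 < φ) {p q : ℂ} (hp : 0 < p.re) (hq : 0 < q.re) :
    -(I * Real.sinh φ) * (p - conj q) / (p + conj q) =
      (-I * Real.cosh φ * (mob φ p - conj (mob φ q)) - 1 - mob φ p * conj (mob φ q)) /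
        (mob φ p + conj (mob φ q)) := by
  have h1 := one_sub_I_mul_ne_zero hp
  have h2 : 1 + I * conj q ≠ 0 := fun h => one_sub_I_mul_ne_zero hq (by
    have := congrArg conj h; simpa [sub_eq_add_neg] using this)
  have h3 : conj (mob φ q) = (Real.exp φ * conj q - I * Real.exp (-φ)) / (1 + I * conj q) := by
    simp only [mob, map_div₀, map_add, map_sub, map_mul, conj_ofReal, conj_I, map_one]
    congr 1 <;> ring
  have h4 : p + conj q ≠ 0 := ne_zero_of_re_pos (by simp; positivity)
  have h5 : mob φ p + conj (mob φ q) ≠ 0 :=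
    ne_zero_of_re_pos (by simpa using add_pos (mob_re_pos hφ hp) (mob_re_pos hφ hq))
  have hEF : (Real.exp φ : ℂ) * Real.exp (-φ) = 1 := exp_mul_exp_neg φ
  have hsh : (2 * Real.sinh φ : ℂ) = Real.exp φ - Real.exp (-φ) := two_sinh φ
  have hch : (2 * Real.cosh φ : ℂ) = Real.exp φ + Real.exp (-φ) := two_cosh φ
  have hI : I ^ 2 = -1 := I_sq
  rw [div_eq_div_iff h4 h5, mob_add_conj_mob φ hp hq, h3, mob, ofReal_mul, ofReal_ofNat]
  generalize conj q = c at *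
  generalize (Real.exp φ : ℂ) = E at *
  generalize (Real.exp (-φ) : ℂ) = F at *
  generalize (Real.sinh φ : ℂ) = s at *
  generalize (Real.cosh φ : ℂ) = k at *
  have key : -(I * s) * (p - c) * (2 * s) = -I * k * ((E * p + I * F) * (1 + I * c) -
      (E * c - I * F) * (1 - I * p)) - (1 - I * p) * (1 + I * c) -
      (E * p + I * F) * (E * c - I * F) := by grind
  field_simp
  linear_combination key

/-- Both sides have equal inner products with Ve_q; for q = m⁻¹(r) this is a nonzero multiple of
e_r, and the e_r are total. -/
theorem apply_mulExpL {α φ : ℝ} (hα : 0 < α) (hφ : 0 < φ) {V : L2w α ≃ₗᵢ[ℂ] L2w α}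
    (hV : ∀ p : ℂ, 0 < p.re → V (expL α p) = mobFactor α φ p • expL α (mob φ p)) {p : ℂ}
    (hp : 0 < p.re) :
    V (mulExpL α φ p) = mobFactor α φ p • diffExpL α φ (mob φ p) := by
  rw [← sub_eq_zero]
  refine eq_zero_of_inner_expL hα fun r hr => ?_
  have hr' : 0 < (r : ℂ).re := by simpa using hr
  have hq := mobInv_re_pos hφ hr'
  set q := mobInv φ r with hqdef
  have hqr : mob φ q = r := mob_mobInv hφ hr'
  have hj : conj (mobFactor α φ q) ≠ 0 :=
    (map_ne_zero _).2 (left_ne_zero_of_mul_eq_one (mobFactor_mobInv_mul (α := α) hφ hr'))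
  have h1 : inner ℂ (V (expL α q)) (V (mulExpL α φ p) - mobFactor α φ p • diffExpL α φ (mob φ p)) =
      0 := by
    rw [inner_sub_right, V.inner_map_map, hV q hq, inner_smul_left, inner_smul_right,
      inner_expL_mulExpL hα φ hp hq,
      inner_expL_diffExpL hα φ (mob_re_pos hφ hp) (mob_re_pos hφ hq),
      ← mobFactor_gram hφ hp hq]
    linear_combination α * (mobFactor α φ p * conj (mobFactor α φ q) *
      gammaPow (mob φ p + conj (mob φ q)) α) * sinh_mul_div_eq hφ hp hq
  rw [hV q hq, hqr, inner_smul_left] at h1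
  exact (mul_eq_zero.1 h1).resolve_left hj

/-! ### The multiplication operator -/

theorem mem_graph_mulOp {α φ : ℝ} {u v : L2w α} :
    (u, v) ∈ (mulOp α φ).graph ↔
      ∀ᵐ s : ℝ ∂weightMeasure α, v s = (2 * s * Real.sinh φ : ℂ) * u s := by
  rw [LinearPMap.mem_graph_iff]
  constructor
  · rintro ⟨y, rfl, hy⟩
    have h : MemLp (fun s : ℝ => (2 * s * Real.sinh φ : ℂ) * (y : L2w α) s) 2 (weightMeasure α) :=
      y.2
    have hy' : h.toLp = v := hy
    rw [← hy']
    exact h.coeFn_toLp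
  · intro h
    have hu : MemLp (fun s : ℝ => (2 * s * Real.sinh φ : ℂ) * u s) 2 (weightMeasure α) :=
      (Lp.memLp v).ae_eq h
    refine ⟨⟨u, hu⟩, rfl, ?_⟩
    change hu.toLp = v
    refine Lp.ext ?_
    filter_upwards [h, hu.coeFn_toLp] with s h1 h2
    rw [h1, h2]

theorem inner_eq_of_mem_graph_mulOp {α φ : ℝ} {u v u' v' : L2w α}
    (h : (u, v) ∈ (mulOp α φ).graph) (h' : (u', v') ∈ (mulOp α φ).graph) :
    inner ℂ v u' = inner ℂ u v' := by
  rw [mem_graph_mulOp] at h h'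
  rw [inner_L2w, inner_L2w]
  refine integral_congr_ae ?_
  filter_upwards [h, h'] with s h1 h2
  rw [h1, h2]
  simp only [map_mul, conj_ofReal, map_ofNat]
  ring

theorem inner_mulExpL_left {α : ℝ} (hα : 0 < α) (φ : ℝ) {p : ℂ} (hp : 0 < p.re) (u : L2w α) :
    inner ℂ (mulExpL α φ p) u =
      ∫ s : ℝ, (2 * s * Real.sinh φ : ℂ) * u s * conj (expVec α p s) ∂weightMeasure α := by
  rw [inner_L2w]
  refine integral_congr_ae ?_
  filter_upwards [coeFn_mulExpL hα φ hp] with s hs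
  rw [hs]
  simp only [map_mul, conj_ofReal, map_ofNat]
  ring

theorem integrable_mul_mul_conj_expVec {α : ℝ} (hα : 0 < α) (φ : ℝ) {p : ℂ} (hp : 0 < p.re)
    (u : L2w α) : Integrable (fun s : ℝ =>
      (2 * s * Real.sinh φ : ℂ) * u s * conj (expVec α p s)) (weightMeasure α) := by
  refine (((Lp.memLp u).integrable_mul (memLp_mul_expVec hα hp).star).const_mul
    (2 * Real.sinh φ : ℂ)).congr (.of_forall fun s => ?_)
  simp [conj_ofReal]
  ring

/-- The product 2s sinh φ · u(s) need not be known to lie in L²: separation by exponential vectors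
only asks for integrability against e_1. Thus the adjoint of 𝓝 restricted to the real exponential
vectors is already 𝓝. -/
theorem mem_graph_mulOp_of_inner {α φ : ℝ} (hα : 0 < α) {u v : L2w α}
    (h : ∀ r : ℝ, 0 < r → inner ℂ (expL α r) v = inner ℂ (mulExpL α φ r) u) :
    (u, v) ∈ (mulOp α φ).graph := by
  have hi : ∀ r : ℝ, 0 < r → Integrable (fun s : ℝ => v s * conj (expVec α r s))
      (weightMeasure α) := fun r hr => integrable_mul_conj_expVec hα (by simpa using hr) (Lp.memLp v)
  have hi' : ∀ r : ℝ, 0 < r → Integrable (fun s : ℝ =>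
      (2 * s * Real.sinh φ : ℂ) * u s * conj (expVec α r s)) (weightMeasure α) :=
    fun r hr => integrable_mul_mul_conj_expVec hα φ (by simpa using hr) u
  have h1 := ae_eq_zero_of_integral_mul_conj_expVec hα
    (F := fun s => v s - (2 * s * Real.sinh φ : ℂ) * u s)
    (by
      have := (hi 1 one_pos).sub (hi' 1 one_pos)
      rw [ofReal_one] at this
      refine this.congr (.of_forall fun s => ?_)
      simp only [Pi.sub_apply]
      ring)
    (fun r hr => by
      simp only [sub_mul]
      rw [integral_sub (hi r hr) (hi' r hr), ← inner_expL_left hα (by simpa using hr),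
        ← inner_mulExpL_left hα φ (by simpa using hr), h r hr, sub_self])
  rw [mem_graph_mulOp, ae_weightMeasure_iff hα]
  filter_upwards [h1] with s hs
  exact sub_eq_zero.1 hs

theorem isClosed_graph_mulOp {α φ : ℝ} (hα : 0 < α) :
    IsClosed ((mulOp α φ).graph : Set (L2w α × L2w α)) := by
  have e : ((mulOp α φ).graph : Set (L2w α × L2w α)) = ⋂ r : {r : ℝ // 0 < r},
      {x | inner ℂ (expL α (r : ℝ)) x.2 = inner ℂ (mulExpL α φ (r : ℝ)) x.1} := by
    ext ⟨u, v⟩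
    simp only [mem_iInter, Subtype.forall, mem_ofPred_eq, SetLike.mem_coe]
    refine ⟨fun h r hr => ?_, mem_graph_mulOp_of_inner hα⟩
    have hr' : 0 < (r : ℂ).re := by simpa using hr
    refine (inner_eq_of_mem_graph_mulOp (mem_graph_mulOp.2 ?_) h).symm
    filter_upwards [coeFn_expL hα hr', coeFn_mulExpL hα φ hr'] with s h1 h2
    rw [h1, h2]
  rw [e]
  exact isClosed_iInter fun r => isClosed_eq (by fun_prop) (by fun_prop)

end Vilenkin

/-! ### Closure, self-adjointness and spectrum -/

namespace Vilenkin

open Complex Set Filter Topology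
open scoped ComplexConjugate

/-- A subspace of `E × F` that contains a closed subspace equals it as soon as it contains no
nonzero vector orthogonal to it. -/
theorem le_of_orthogonal_eq_zero {E F : Type*} [NormedAddCommGroup E] [InnerProductSpace ℂ E]
    [CompleteSpace E] [NormedAddCommGroup F] [InnerProductSpace ℂ F] [CompleteSpace F]
    {K L : Submodule ℂ (E × F)} (hK : IsClosed (K : Set (E × F))) (hKL : K ≤ L)
    (h : ∀ x ∈ L, (∀ y ∈ K, inner ℂ y.1 x.1 + inner ℂ y.2 x.2 = 0) → x = 0) : L ≤ K := by
  intro x hx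
  -- The product carries the sup norm; orthogonal projection takes place in its Hilbert space
  -- version.
  set K' : Submodule ℂ (WithLp 2 (E × F)) :=
    K.comap (WithLp.linearEquiv 2 ℂ (E × F)).toLinearMap with hK'
  have hcl : IsClosed (K' : Set (WithLp 2 (E × F))) :=
    hK.preimage (WithLp.prod_continuous_ofLp 2 E F)
  have : CompleteSpace K' := hcl.completeSpace_coe
  set x' : WithLp 2 (E × F) := WithLp.toLp 2 x with hx'
  have hP : (K'.starProjection x').ofLp ∈ K := K'.starProjection_apply_mem x'
  have h0 : x - (K'.starProjection x').ofLp = 0 := by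
    refine h _ (L.sub_mem hx (hKL hP)) fun y hy => ?_
    have := K'.starProjection_inner_eq_zero x' (WithLp.toLp 2 y) hy
    rw [← inner_conj_symm, map_eq_zero] at this
    exact this
  rw [sub_eq_zero.1 h0]
  exact hP

/-- The hypothesis says that (u, v) belongs to the adjoint of 𝓛 restricted to exponential vectors.
Transport by V turns it into the test for 𝓝 on each e_r, the automorphy factors being common to both
sides. -/
theorem mem_graph_mulOp_symm_of_inner {α φ : ℝ} (hα : 0 < α) (hφ : 0 < φ)
    {V : L2w α ≃ₗᵢ[ℂ] L2w α}
    (hV : ∀ p : ℂ, 0 < p.re → V (expL α p) = mobFactor α φ p • expL α (mob φ p)) {u v : L2w α}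
    (h : ∀ p : ℂ, 0 < p.re → inner ℂ (expL α p) v = inner ℂ (diffExpL α φ p) u) :
    (V.symm u, V.symm v) ∈ (mulOp α φ).graph := by
  refine mem_graph_mulOp_of_inner hα fun r hr => ?_
  have hr' : 0 < (r : ℂ).re := by simpa using hr
  rw [← V.inner_map_map (expL α r), ← V.inner_map_map (mulExpL α φ r), V.apply_symm_apply,
    V.apply_symm_apply, hV _ hr',
    apply_mulExpL hα hφ hV hr', inner_smul_left, inner_smul_left, h _ (mob_re_pos hφ hr')]

theorem mem_graph_mulOp_symm_of_mem_diffGraph {α φ : ℝ} (hα : 0 < α) (hφ : 0 < φ)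
    {V : L2w α ≃ₗᵢ[ℂ] L2w α}
    (hV : ∀ p : ℂ, 0 < p.re → V (expL α p) = mobFactor α φ p • expL α (mob φ p)) {u v : L2w α}
    (h : (u, v) ∈ diffGraph α φ) : (V.symm u, V.symm v) ∈ (mulOp α φ).graph := by
  obtain ⟨f, hf, hu, hv⟩ := h
  refine mem_graph_mulOp_symm_of_inner hα hφ hV fun p hp => ?_
  rw [inner_L2w, inner_L2w]
  calc _ = ∫ t : ℝ, diffExpr α φ f t * conj (expVec α p t) ∂weightMeasure α := by
        refine integral_congr_ae ?_
        filter_upwards [hv, coeFn_expL hα hp] with t h1 h2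
        rw [h2, ← h1]
    _ = _ := integral_diffExpr_mul_conj_expVec hα φ hf hp
    _ = _ := by
        refine integral_congr_ae ?_
        filter_upwards [hu, coeFn_diffExpL hα φ hp] with t h1 h2
        rw [h2, ← h1]

/-- One inclusion holds because 𝓝 is closed. For the other, no nonzero vector of the transported
graph of 𝓝 is orthogonal to the graph of 𝓛. -/
theorem mem_topologicalClosure_diffGraph_iff {α φ : ℝ} (hα : 0 < α) (hφ : 0 < φ)
    {V : L2w α ≃ₗᵢ[ℂ] L2w α}
    (hV : ∀ p : ℂ, 0 < p.re → V (expL α p) = mobFactor α φ p • expL α (mob φ p)) (u v : L2w α) :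
    (u, v) ∈ (diffGraph α φ).topologicalClosure ↔
      (V.symm u, V.symm v) ∈ (mulOp α φ).graph := by
  set L : Submodule ℂ (L2w α × L2w α) := (mulOp α φ).graph.comap
    (LinearMap.prodMap V.symm.toLinearEquiv.toLinearMap V.symm.toLinearEquiv.toLinearMap) with hL
  have hmem : ∀ u v : L2w α, (u, v) ∈ L ↔ (V.symm u, V.symm v) ∈ (mulOp α φ).graph :=
    fun u v => Iff.rfl
  have hLc : IsClosed (L : Set (L2w α × L2w α)) := (isClosed_graph_mulOp hα).preimage
    (f := fun x : L2w α × L2w α => (V.symm x.1, V.symm x.2)) (by fun_prop)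
  have hle : (diffGraph α φ).topologicalClosure ≤ L :=
    Submodule.topologicalClosure_minimal _
      (fun ⟨u, v⟩ h => mem_graph_mulOp_symm_of_mem_diffGraph hα hφ hV h) hLc
  rw [← hmem]
  refine ⟨fun h => hle h, fun h => ?_⟩
  refine le_of_orthogonal_eq_zero (Submodule.isClosed_topologicalClosure _) hle ?_ h
  rintro ⟨a, b⟩ hab horth
  -- Orthogonality to (e_p, 𝓛e_p) reads ⟨e_p, -a⟩ = ⟨𝓛e_p, b⟩. Combined with V⁻¹b = 𝓝V⁻¹a, this
  -- gives (1 + 𝓝²)V⁻¹a = 0.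
  have h1 : (V.symm b, V.symm (-a)) ∈ (mulOp α φ).graph := by
    refine mem_graph_mulOp_symm_of_inner hα hφ hV fun p hp => ?_
    have := horth _ ((diffGraph α φ).le_topologicalClosure (expL_diffExpL_mem_diffGraph hα φ hp))
    rw [inner_neg_right]
    linear_combination -this
  have h2 := (hmem a b).1 hab
  rw [mem_graph_mulOp] at h1 h2
  have h3 : V.symm a = 0 := by
    refine Lp.ext ?_
    rw [map_neg] at h1
    filter_upwards [h1, h2, Lp.coeFn_neg (V.symm a), Lp.coeFn_zero ℂ 2 (weightMeasure α)]
      with s e1 e2 e3 e4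
    rw [e3, Pi.neg_apply, e2] at e1
    have e5 : ((1 + (2 * s * Real.sinh φ) ^ 2 : ℝ) : ℂ) * V.symm a s = 0 := by
      push_cast
      push_cast at e1
      linear_combination -e1
    rw [e4]
    refine (mul_eq_zero.1 e5).resolve_left (ofReal_ne_zero.2 ?_)
    positivity
  have h4 : a = 0 := by simpa using h3
  have h5 : V.symm b = 0 := by
    refine Lp.ext ?_
    filter_upwards [h2, Lp.coeFn_zero ℂ 2 (weightMeasure α)] with s e1 e2
    rw [e1, h3, e2]
    simp
  have h6 : b = 0 := by simpa using h5
  rw [h4, h6]; rfl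

theorem isClosable_diffOp {α φ : ℝ} (hα : 0 < α) (hφ : 0 < φ) : (diffOp α φ).IsClosable := by
  obtain ⟨V, hV, -⟩ := exists_unitary hα hφ
  refine ⟨(diffGraph α φ).topologicalClosure.toLinearPMap, ?_⟩
  rw [diffOp_graph hα, Submodule.toLinearPMap_graph_eq]
  rintro ⟨u, v⟩ h h0
  simp only at h0
  subst h0
  rw [mem_topologicalClosure_diffGraph_iff hα hφ hV, map_zero] at h
  simpa using (mulOp α φ).graph_fst_eq_zero_snd h rfl

theorem mem_graph_closure_diffOp {α φ : ℝ} (hα : 0 < α) (hφ : 0 < φ)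
    {V : L2w α ≃ₗᵢ[ℂ] L2w α}
    (hV : ∀ p : ℂ, 0 < p.re → V (expL α p) = mobFactor α φ p • expL α (mob φ p)) (u v : L2w α) :
    (u, v) ∈ (diffOp α φ).closure.graph ↔ (V.symm u, V.symm v) ∈ (mulOp α φ).graph := by
  rw [← (isClosable_diffOp hα hφ).graph_closure_eq_closure_graph, diffOp_graph hα,
    mem_topologicalClosure_diffGraph_iff hα hφ hV]

/-- A pair in the adjoint satisfies the test against all (e_p, 𝓛e_p), hence lies in the closure; the
converse is the symmetry of real multiplication. The domain is dense since it contains the total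
family e_r. -/
theorem isSelfAdjoint_closure_diffOp {α φ : ℝ} (hα : 0 < α) (hφ : 0 < φ) :
    IsSelfAdjoint (diffOp α φ).closure := by
  obtain ⟨V, hV, -⟩ := exists_unitary hα hφ
  have hmem := mem_graph_closure_diffOp hα hφ hV
  set A := (diffOp α φ).closure with hA
  have hexp : ∀ p : ℂ, 0 < p.re → (expL α p, diffExpL α φ p) ∈ A.graph := fun p hp => by
    rw [hA, ← (isClosable_diffOp hα hφ).graph_closure_eq_closure_graph, diffOp_graph hα]
    exact (diffGraph α φ).le_topologicalClosure (expL_diffExpL_mem_diffGraph hα φ hp)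
  have hdense : Dense (A.domain : Set (L2w α)) := by
    rw [Submodule.dense_iff_topologicalClosure_eq_top, Submodule.topologicalClosure_eq_top_iff,
      Submodule.eq_bot_iff]
    intro u hu
    refine eq_zero_of_inner_expL hα fun r hr => ?_
    exact (Submodule.mem_orthogonal _ _).1 hu _
      (LinearPMap.mem_domain_of_mem_graph (hexp r (by simpa using hr)))
  rw [LinearPMap.isSelfAdjoint_def]
  refine LinearPMap.eq_of_eq_graph ?_
  rw [LinearPMap.adjoint_graph_eq_graph_adjoint hdense]
  ext ⟨u, v⟩
  rw [Submodule.mem_adjoint_iff]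
  constructor
  · intro h
    rw [hmem]
    refine mem_graph_mulOp_symm_of_inner hα hφ hV fun p hp => ?_
    exact (sub_eq_zero.1 (h _ _ (hexp p hp))).symm
  · intro h a b hab
    rw [hmem] at h hab
    have := inner_eq_of_mem_graph_mulOp hab h
    rw [V.symm.inner_map_map, V.symm.inner_map_map] at this
    rw [this, sub_self]

/-! ### The spectrum -/

/-- Multiplication by a bounded measurable function as an operator on `L²`. -/
theorem exists_bounded_mul {X : Type*} [MeasurableSpace X] {μ : Measure X} {m : X → ℂ}
    (hm : Measurable m) {C : ℝ} (hC : ∀ s, ‖m s‖ ≤ C) :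
    ∃ M : Lp ℂ 2 μ →L[ℂ] Lp ℂ 2 μ, ∀ u : Lp ℂ 2 μ, ∀ᵐ s ∂μ, M u s = m s * u s := by
  have hb : ∀ u : Lp ℂ 2 μ, MemLp (fun s => m s * u s) 2 μ := fun u =>
    (Lp.memLp u).of_le_mul (c := C)
      (hm.aestronglyMeasurable.mul (Lp.aestronglyMeasurable u)) (.of_forall fun s => by
        rw [norm_mul]
        gcongr
        exact hC s)
  have hT : ∀ u : Lp ℂ 2 μ, ∀ᵐ s ∂μ, ((hb u).toLp : Lp ℂ 2 μ) s = m s * u s := fun u => (hb u).coeFn_toLp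
  let T : Lp ℂ 2 μ →ₗ[ℂ] Lp ℂ 2 μ :=
    { toFun := fun u => (hb u).toLp
      map_add' := fun u v => by
        refine Lp.ext ?_
        filter_upwards [hT (u + v), hT u, hT v, Lp.coeFn_add u v,
          Lp.coeFn_add (hb u).toLp (hb v).toLp] with s h1 h2 h3 h4 h5
        rw [h1, h5, Pi.add_apply, h2, h3, h4, Pi.add_apply, mul_add]
      map_smul' := fun c u => by
        refine Lp.ext ?_
        filter_upwards [hT (c • u), hT u, Lp.coeFn_smul c u, Lp.coeFn_smul c (hb u).toLp]
          with s h1 h2 h3 h4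
        rw [h1, RingHom.id_apply, h4, Pi.smul_apply, h2, h3, Pi.smul_apply, smul_eq_mul,
          smul_eq_mul, mul_left_comm] }
  refine ⟨T.mkContinuous C fun u => Lp.norm_le_mul_norm_of_ae_le_mul ?_, fun u => hT u⟩
  filter_upwards [hT u] with s h1
  change ‖((hb u).toLp : Lp ℂ 2 μ) s‖ ≤ _
  rw [h1, norm_mul]
  gcongr
  exact hC s

/-- The resolvent is conjugate under V to multiplication by (2s sinh φ - z)⁻¹, which is bounded by
1/|Im z|. -/
theorem notMem_unboundedSpectrum {α φ : ℝ} {V : L2w α ≃ₗᵢ[ℂ] L2w α} {A : L2w α →ₗ.[ℂ] L2w α}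
    (hA : ∀ u v, (u, v) ∈ A.graph ↔ (V.symm u, V.symm v) ∈ (mulOp α φ).graph) {z : ℂ}
    (hz : z.im ≠ 0) : z ∉ unboundedSpectrum A := by
  have him : ∀ s : ℝ, (2 * s * Real.sinh φ - z : ℂ).im = -z.im := fun s => by
    rw [sub_im, show (2 * s * Real.sinh φ : ℂ) = ((2 * s * Real.sinh φ : ℝ) : ℂ) by push_cast; rfl,
      ofReal_im, zero_sub]
  have hne : ∀ s : ℝ, (2 * s * Real.sinh φ - z : ℂ) ≠ 0 := fun s h => by
    have := him s
    rw [h, zero_im] at this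
    exact hz (by linarith)
  obtain ⟨M, hM⟩ := exists_bounded_mul (μ := weightMeasure α)
    (m := fun s : ℝ => (2 * s * Real.sinh φ - z : ℂ)⁻¹) (by fun_prop) (C := |z.im|⁻¹) fun s => by
      rw [norm_inv]
      refine inv_anti₀ (abs_pos.2 hz) ?_
      have := abs_im_le_norm (2 * s * Real.sinh φ - z : ℂ)
      rwa [him, abs_neg] at this
  rw [unboundedSpectrum, notMem_compl_iff]
  refine ⟨(V : L2w α →L[ℂ] L2w α) ∘L M ∘L (V.symm : L2w α →L[ℂ] L2w α), fun x => ?_, fun x => ?_⟩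
  · have h : (V (M (V.symm x)), x + z • V (M (V.symm x))) ∈ A.graph := by
      rw [hA, mem_graph_mulOp, map_add, map_smul, V.symm_apply_apply]
      filter_upwards [hM (V.symm x), Lp.coeFn_add (V.symm x) (z • M (V.symm x)),
        Lp.coeFn_smul z (M (V.symm x))] with s h1 h2 h3
      have := hne s
      rw [h2, Pi.add_apply, h3, Pi.smul_apply, h1, smul_eq_mul]
      field_simp
      ring
    refine ⟨LinearPMap.mem_domain_of_mem_graph h, ?_⟩
    have h' := A.mem_graph ⟨_, LinearPMap.mem_domain_of_mem_graph h⟩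
    have h'' := A.mem_graph_snd_inj h' h rfl
    change A ⟨V (M (V.symm x)), _⟩ - z • V (M (V.symm x)) = x
    rw [h'', add_sub_cancel_right]
  · have h := (hA _ _).1 (A.mem_graph x)
    rw [mem_graph_mulOp] at h
    change V (M (V.symm (A x - z • (x : L2w α)))) = x
    rw [← V.eq_symm_apply]
    rw [map_sub, map_smul]
    refine Lp.ext ?_
    filter_upwards [h, hM (V.symm (A x) - z • V.symm x), Lp.coeFn_smul z (V.symm (x : L2w α)),
      Lp.coeFn_sub (V.symm (A x)) (z • V.symm (x : L2w α))] with s h1 h2 h3 h4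
    have := hne s
    rw [h2, h4, Pi.sub_apply, h3, Pi.smul_apply, h1, smul_eq_mul]
    field_simp

/-- Indicators of short intervals at the zero s₀ of 2s sinh φ - x are approximate eigenvectors,
which already excludes a bounded left inverse. -/
theorem mem_unboundedSpectrum {α φ : ℝ} (hα : 0 < α) (hφ : 0 < φ) {V : L2w α ≃ₗᵢ[ℂ] L2w α}
    {A : L2w α →ₗ.[ℂ] L2w α}
    (hA : ∀ u v, (u, v) ∈ A.graph ↔ (V.symm u, V.symm v) ∈ (mulOp α φ).graph) (x : ℝ) :
    (x : ℂ) ∈ unboundedSpectrum A := by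
  rintro ⟨R, -, hR⟩
  have hs : 0 < 2 * Real.sinh φ := mul_pos two_pos (Real.sinh_pos_iff.2 hφ)
  have hR0 := norm_nonneg R
  set s₀ : ℝ := x / (2 * Real.sinh φ) with hs₀
  -- On an interval of this length the multiplier is at most 1/(‖R‖ + 1), so ‖f‖ ≤ ‖R‖/(‖R‖ + 1) ·
  -- ‖f‖ and the indicator would vanish almost everywhere.
  set ε : ℝ := ((‖R‖ + 1) * (2 * Real.sinh φ))⁻¹ with hε
  have hε0 : 0 < ε := by positivity
  set S : Set ℝ := Icc s₀ (s₀ + ε) with hS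
  have : IsLocallyFiniteMeasure (weightMeasure α) := isLocallyFiniteMeasure_weightMeasure hα
  have hf : MemLp (S.indicator fun _ => (1 : ℂ)) 2 (weightMeasure α) :=
    memLp_indicator_const 2 measurableSet_Icc 1 (Or.inr isCompact_Icc.measure_lt_top.ne)
  have hb : ∀ s : ℝ, ‖(2 * s * Real.sinh φ - x : ℂ) * S.indicator (fun _ => (1 : ℂ)) s‖ ≤
      (‖R‖ + 1)⁻¹ * ‖S.indicator (fun _ => (1 : ℂ)) s‖ := fun s => by
    rw [norm_mul]
    by_cases h : s ∈ S
    · gcongr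
      rw [show (2 * s * Real.sinh φ - x : ℂ) = ((2 * s * Real.sinh φ - x : ℝ) : ℂ) by push_cast; rfl,
        norm_real, Real.norm_eq_abs, show 2 * s * Real.sinh φ - x =
        (s - s₀) * (2 * Real.sinh φ) by rw [hs₀]; field_simp,
        abs_of_nonneg (mul_nonneg (by linarith [h.1]) hs.le)]
      calc (s - s₀) * (2 * Real.sinh φ) ≤ ε * (2 * Real.sinh φ) := by
            gcongr
            linarith [h.2]
        _ = _ := by rw [hε]; field_simp
    · simp [h]
  have hg : MemLp (fun s : ℝ => (2 * s * Real.sinh φ - x : ℂ) * S.indicator (fun _ => (1 : ℂ)) s) 2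
      (weightMeasure α) := hf.of_le_mul (c := (‖R‖ + 1)⁻¹)
    ((by fun_prop : Measurable fun s : ℝ => (2 * s * Real.sinh φ - x : ℂ)).aestronglyMeasurable.mul
      hf.aestronglyMeasurable) (.of_forall hb)
  set f : L2w α := hf.toLp with hfdef
  set g : L2w α := hg.toLp with hgdef
  have hgraph : (V f, V (g + (x : ℂ) • f)) ∈ A.graph := by
    rw [hA, V.symm_apply_apply, V.symm_apply_apply, mem_graph_mulOp]
    filter_upwards [hf.coeFn_toLp, hg.coeFn_toLp, Lp.coeFn_add g ((x : ℂ) • f),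
      Lp.coeFn_smul (x : ℂ) f] with s h1 h2 h3 h4
    rw [h3, Pi.add_apply, h4, Pi.smul_apply, h1, h2, smul_eq_mul]
    ring
  obtain ⟨y, hy1, hy2⟩ := (LinearPMap.mem_graph_iff _).1 hgraph
  simp only at hy1 hy2
  have h1 := hR y
  rw [hy2, hy1, ← map_smul, ← map_sub, add_sub_cancel_right] at h1
  have h2 : ‖g‖ ≤ (‖R‖ + 1)⁻¹ * ‖f‖ := by
    refine Lp.norm_le_mul_norm_of_ae_le_mul ?_
    filter_upwards [hf.coeFn_toLp, hg.coeFn_toLp] with s e1 e2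
    rw [e1, e2]
    exact hb s
  have h3 : ‖f‖ ≤ ‖R‖ * ((‖R‖ + 1)⁻¹ * ‖f‖) := by
    calc ‖f‖ = ‖R (V g)‖ := by rw [h1, V.norm_map]
      _ ≤ ‖R‖ * ‖V g‖ := R.le_opNorm _
      _ ≤ _ := by rw [V.norm_map]; gcongr
  have h4 : f = 0 := by
    have h5 : ‖R‖ * ((‖R‖ + 1)⁻¹ * ‖f‖) = ‖f‖ - (‖R‖ + 1)⁻¹ * ‖f‖ := by field_simp; ring
    have h6 : 0 < (‖R‖ + 1)⁻¹ := by positivity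
    have h7 := norm_nonneg f
    refine norm_eq_zero.1 (le_antisymm ?_ h7)
    nlinarith
  have h5 : ∀ᵐ s : ℝ, s ∉ S := by
    rw [← ae_weightMeasure_iff hα]
    filter_upwards [hf.coeFn_toLp, Lp.coeFn_zero ℂ 2 (weightMeasure α)] with s e1 e2 hs
    rw [← hfdef, h4, e2, indicator_of_mem hs] at e1
    exact zero_ne_one e1
  have h6 : volume S = 0 := by simpa using measure_eq_zero_iff_ae_notMem.2 h5
  rw [hS, Real.volume_Icc, ENNReal.ofReal_eq_zero] at h6
  linarith

theorem unboundedSpectrum_eq_range_ofReal {α φ : ℝ} (hα : 0 < α) (hφ : 0 < φ)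
    {V : L2w α ≃ₗᵢ[ℂ] L2w α} {A : L2w α →ₗ.[ℂ] L2w α}
    (hA : ∀ u v, (u, v) ∈ A.graph ↔ (V.symm u, V.symm v) ∈ (mulOp α φ).graph) :
    unboundedSpectrum A = range ((↑) : ℝ → ℂ) := by
  ext z
  refine ⟨fun h => ?_, ?_⟩
  · by_contra hz
    refine notMem_unboundedSpectrum hA (fun h0 => hz ⟨z.re, ?_⟩) h
    exact Complex.ext (by simp) (by simp [h0])
  · rintro ⟨x, rfl⟩
    exact mem_unboundedSpectrum hα hφ hA x

end Vilenkin

theorem mainTheorem1 (α φ : ℝ) (hα : 0 < α) (hφ : 0 < φ) :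
    -- the difference operator maps the whole of `𝓗[w] ⊆ L²(w)` to `L²(w)`
    (∀ f ∈ Vilenkin.stripSpace α,
      MemLp (fun t : ℝ => f t) 2 (Vilenkin.weightMeasure α) ∧
      MemLp (fun t : ℝ => Vilenkin.diffExpr α φ f t) 2 (Vilenkin.weightMeasure α)) ∧
    -- it is essentially self-adjoint there
    (Vilenkin.diffOp α φ).IsClosable ∧
    IsSelfAdjoint (Vilenkin.diffOp α φ).closure ∧
    -- the Vilenkin transform is unitary, its inverse takes `𝓛` to `𝓝`
    (∃ V : Vilenkin.L2w α ≃ₗᵢ[ℂ] Vilenkin.L2w α,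
      Vilenkin.IsIntegralOperator (Vilenkin.kernel α φ) (V : Vilenkin.L2w α →L[ℂ] Vilenkin.L2w α) ∧
      Vilenkin.IsIntegralOperator (Vilenkin.inverseKernel α φ)
        (V.symm : Vilenkin.L2w α →L[ℂ] Vilenkin.L2w α) ∧
      ∀ u v : Vilenkin.L2w α, (u, v) ∈ (Vilenkin.diffOp α φ).closure.graph ↔
        (V.symm u, V.symm v) ∈ (Vilenkin.mulOp α φ).graph) ∧
    -- the spectrum is the real line
    Vilenkin.unboundedSpectrum (Vilenkin.diffOp α φ).closure = Set.range ((↑) : ℝ → ℂ) := by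
  obtain ⟨V, hV, hVsymm⟩ := Vilenkin.exists_unitary hα hφ
  have hA := Vilenkin.mem_graph_closure_diffOp hα hφ hV
  exact ⟨fun f hf => Vilenkin.memLp_of_mem_stripSpace hα φ hf, Vilenkin.isClosable_diffOp hα hφ,
    Vilenkin.isSelfAdjoint_closure_diffOp hα hφ,
    ⟨V, Vilenkin.isIntegralOperator_kernel hα hφ V hVsymm,
      Vilenkin.isIntegralOperator_inverseKernel hα hφ V hV, hA⟩,
    Vilenkin.unboundedSpectrum_eq_range_ofReal hα hφ hA⟩
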